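/- There are universal constants $c\in\mathbb{N}$ and $C\in\mathbb{R}$ such that for every real $\varepsilon>0$ there is an algorithm that, given a 3SAT formula $\varphi$ (a conjunction of clauses, each a disjunction of at most three literals) with $n$ variables and $m$ clauses, constructs an instance of the Steiner Tree problem with unit weights, that is, a finite simple undirected graph $G$ and a set $T\subseteq V(G)$ of terminals, together with an integer budget $k$, such that - $G$ is planar and, if $n+m\ge 1$, has at most $A\cdot 2^{\varepsilon(n+m)}\cdot(n+m)^{c}$ vertices, where $A$ depends only on $\varepsilon$; - $|T|\le C\,\varepsilon^{-1}(n+m)$; and - $\varphi$ is satisfiable if and only if $G$ contains a tree that contains all vertices of $T$ and has total weight (number of edges) at most $k$. Moreover, the algorithm runs in time at most $B\cdot S$, where $S=|V(G)|+2|E(G)|+3$ is the size of the output instance (the number of words in which it is written) and $B$ depends only on $\varepsilon$. Time is counted on a word RAM: a random access machine whose words are integers between $0$ and $S^{D}$, with $D$ depending only on $\varepsilon$ (words of $O(\log S)$ bits), and whose elementary instructions (constants, addition, truncated subtraction, multiplication, integer division, indirect reading and writing of memory, output of a word, test for zero) cost one step each. -/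

import Mathlib

/-! ### 3SAT -/

/-- A literal over the variables `Fin n`: a variable with the value that makes the literal true. -/
abbrev Literal (n : ℕ) := Fin n × Bool

/-- A clause of a 3SAT formula: a disjunction of at most three literals. -/
abbrev Clause3 (n : ℕ) := {c : List (Literal n) // c.length ≤ 3}

/-- A 3SAT formula with `n` variables: a conjunction of clauses; its number of clauses
is the length of the list. -/
abbrev Formula3 (n : ℕ) := List (Clause3 n)

/-- Some assignment makes at least one literal true in every clause. -/
def Formula3.Satisfiable {n : ℕ} (φ : Formula3 n) : Prop :=
  ∃ a : Fin n → Bool, ∀ c ∈ φ, ∃ l ∈ c.1, a l.1 = l.2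

/-- The code of a literal: `2x + 1` for the literal `¬x` and `2x + 2` for the literal `x`. -/
def Literal.code {n : ℕ} (l : Literal n) : ℕ := 2 * (l.1 : ℕ) + (if l.2 then 1 else 0) + 1

/-- A clause is written as three words, one for each literal; an unused position holds `0`. -/
def Clause3.encode {n : ℕ} (c : Clause3 n) : List ℕ :=
  (List.range 3).map fun i => (c.1[i]?).elim 0 Literal.code

/-- A formula is written as `n`, the number of clauses, and then the clauses one after another. -/
def Formula3.encode {n : ℕ} (φ : Formula3 n) : List ℕ :=
  n :: φ.length :: φ.flatMap Clause3.encode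

/-! ### Planar graphs -/

/-- A graph is planar if it can be drawn in the plane: the vertices are distinct points, every edge
is a simple arc between its two endpoints, an arc passes through no vertex except its endpoints,
and two distinct arcs meet only in common endpoints. -/
def SimpleGraph.IsPlanar {V : Type*} (G : SimpleGraph V) : Prop :=
  ∃ (pos : V → ℝ × ℝ) (arc : Sym2 V → unitInterval → ℝ × ℝ),
    Function.Injective pos ∧
    (∀ e ∈ G.edgeSet, Continuous (arc e) ∧ Function.Injective (arc e) ∧
      ∃ u v, e = s(u, v) ∧ arc e 0 = pos u ∧ arc e 1 = pos v) ∧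
    (∀ e ∈ G.edgeSet, ∀ t v, arc e t = pos v → v ∈ e) ∧
    (∀ e ∈ G.edgeSet, ∀ f ∈ G.edgeSet, e ≠ f → ∀ s t, arc e s = arc f t →
      ∃ v, v ∈ e ∧ v ∈ f ∧ arc e s = pos v)

/-! ### Steiner Tree with unit weights -/

/-- An instance of Steiner Tree in which every edge has weight one: a finite undirected graph,
a set of terminals and an integer budget. -/
structure SteinerInstance where
  vertexCount : ℕ
  graph : SimpleGraph (Fin vertexCount)
  terminals : Finset (Fin vertexCount)
  budget : ℤ

namespace SteinerInstance

/-- A Steiner tree is a subgraph that is a tree and contains all terminals. -/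
def IsSteinerTree (I : SteinerInstance) (H : I.graph.Subgraph) : Prop :=
  H.coe.IsTree ∧ ∀ v ∈ I.terminals, v ∈ H.verts

/-- There is a Steiner tree whose total weight (with unit weights, its number of edges)
is at most the budget. -/
def HasTreeWithinBudget (I : SteinerInstance) : Prop :=
  ∃ H : I.graph.Subgraph, I.IsSteinerTree H ∧ (H.edgeSet.ncard : ℤ) ≤ I.budget

open Classical in
/-- The word that marks whether a vertex is a terminal. -/
noncomputable def flag (I : SteinerInstance) (v : Fin I.vertexCount) : ℕ :=
  if v ∈ I.terminals then 1 else 0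

/-- `out` is a written form of the instance: the number of vertices, the budget as the pair of its
positive and negative parts, one word for each vertex telling whether it is a terminal, and the
edges, every edge exactly once, in any order and in any orientation, as the pair of its endpoints.
So the length of `out` is `3 + |V| + 2|E|`. -/
def IsEncoding (I : SteinerInstance) (out : List ℕ) : Prop :=
  ∃ es : List (Fin I.vertexCount × Fin I.vertexCount),
    (es.map fun e => s(e.1, e.2)).Nodup ∧
    (∀ e, e ∈ I.graph.edgeSet ↔ e ∈ es.map fun e => s(e.1, e.2)) ∧
    out = I.vertexCount :: I.budget.toNat :: (-I.budget).toNat ::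
      ((List.finRange I.vertexCount).map I.flag ++
        es.flatMap fun e => [(e.1 : ℕ), (e.2 : ℕ)])

end SteinerInstance

/-! ### The word RAM

Algorithms are programs of a random access machine with finitely many registers (those that the
program names), a memory with indirect addressing and a write-only output. Every elementary
instruction and every test costs one step. The programs are structured by sequences, branches and
loops. All words that are computed or read have to be at most `W`, where `W` is a parameter of the
execution, so that the machine works with words of about `log₂ W` bits. -/

namespace WordRAM

/-- The arithmetic operations on words: addition, subtraction truncated at `0`, multiplication and
integer division (with `x / 0 = 0`). -/
inductive Op
  | add | sub | mul | div

def Op.eval : Op → ℕ → ℕ → ℕ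
  | .add, x, y => x + y
  | .sub, x, y => x - y
  | .mul, x, y => x * y
  | .div, x, y => x / y

inductive Prog
  /-- do nothing -/
  | skip
  /-- register `d` becomes the constant `x` -/
  | const (d x : ℕ)
  /-- register `d` becomes the result of the operation on the registers `a` and `b` -/
  | arith (o : Op) (d a b : ℕ)
  /-- register `d` becomes the content of the memory cell whose address is in register `a` -/
  | load (d a : ℕ)
  /-- the memory cell whose address is in register `a` becomes the content of register `b` -/
  | store (a b : ℕ)
  /-- write the content of register `a` to the output -/
  | emit (a : ℕ)
  /-- run the first program and then the second one -/
  | seq (p q : Prog)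
  /-- run the first program if register `a` is nonzero, and the second one otherwise -/
  | branch (a : ℕ) (p q : Prog)
  /-- run the program again and again as long as register `a` is nonzero -/
  | loop (a : ℕ) (p : Prog)

structure State where
  reg : ℕ → ℕ
  mem : ℕ → ℕ
  out : List ℕ

/-- At the start the registers are `0`, the input stands in the memory cells `0, 1, 2, …`, all other
cells are `0`, and nothing has been written to the output. -/
def init (input : List ℕ) : State where
  reg := fun _ => 0
  mem := fun i => input.getD i 0
  out := []

/-- `Run W p s s' t`: from state `s`, with words at most `W`, the program `p` halts in state `s'`
after exactly `t` steps. -/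
inductive Run (W : ℕ) : Prog → State → State → ℕ → Prop
  | skip (s : State) : Run W .skip s s 1
  | const (s : State) (d x : ℕ) (h : x ≤ W) :
      Run W (.const d x) s { s with reg := Function.update s.reg d x } 1
  | arith (s : State) (o : Op) (d a b : ℕ) (h : o.eval (s.reg a) (s.reg b) ≤ W) :
      Run W (.arith o d a b) s
        { s with reg := Function.update s.reg d (o.eval (s.reg a) (s.reg b)) } 1
  | load (s : State) (d a : ℕ) (h : s.mem (s.reg a) ≤ W) :
      Run W (.load d a) s { s with reg := Function.update s.reg d (s.mem (s.reg a)) } 1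
  | store (s : State) (a b : ℕ) :
      Run W (.store a b) s { s with mem := Function.update s.mem (s.reg a) (s.reg b) } 1
  | emit (s : State) (a : ℕ) :
      Run W (.emit a) s { s with out := s.out ++ [s.reg a] } 1
  | seq {p q : Prog} {s s' s'' : State} {t t' : ℕ}
      (hp : Run W p s s' t) (hq : Run W q s' s'' t') : Run W (.seq p q) s s'' (t + t')
  | branch_true {a : ℕ} {p q : Prog} {s s' : State} {t : ℕ} (h : s.reg a ≠ 0)
      (hp : Run W p s s' t) : Run W (.branch a p q) s s' (t + 1)
  | branch_false {a : ℕ} {p q : Prog} {s s' : State} {t : ℕ} (h : s.reg a = 0)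
      (hq : Run W q s s' t) : Run W (.branch a p q) s s' (t + 1)
  | loop_done {a : ℕ} {p : Prog} {s : State} (h : s.reg a = 0) : Run W (.loop a p) s s 1
  | loop_again {a : ℕ} {p : Prog} {s s' s'' : State} {t t' : ℕ} (h : s.reg a ≠ 0)
      (hp : Run W p s s' t) (hl : Run W (.loop a p) s' s'' t') :
      Run W (.loop a p) s s'' (t + 1 + t')

/-- On the given input, with words at most `W`, the program halts within `t` steps, and what it has
written to the output is `out`. -/
def Prog.OutputsWithin (p : Prog) (W : ℕ) (input out : List ℕ) (t : ℕ) : Prop :=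
  ∃ s t', t' ≤ t ∧ Run W p (init input) s t' ∧ s.out = out

end WordRAM

namespace SimpleGraph

/-- Every component of a subgraph of `G` is spanned by a tree. -/
theorem exists_subtree {V : Type*} {G G' : SimpleGraph V} (hle : G' ≤ G) (root : V) :
    ∃ H : G.Subgraph, H.coe.IsTree ∧ H.verts = {v | G'.Reachable root v} ∧
      H.edgeSet ⊆ G'.edgeSet := by
  obtain ⟨C, hC⟩ : ∃ C, C = G'.connectedComponentMk root := ⟨_, rfl⟩
  obtain ⟨T, hT, htree⟩ := C.connected_toSimpleGraph.exists_isTree_le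
  refine ⟨{ verts := C.supp
            Adj := fun u v => ∃ (hu : u ∈ C.supp) (hv : v ∈ C.supp), T.Adj ⟨u, hu⟩ ⟨v, hv⟩
            adj_sub := ?_
            edge_vert := fun ⟨hu, _⟩ => hu
            symm := ⟨fun u v ⟨hu, hv, h⟩ => ⟨hv, hu, h.symm⟩⟩ }, ?_, ?_, ?_⟩
  · rintro u v ⟨hu, hv, h⟩
    exact hle (hT h)
  · refine (SimpleGraph.Iso.isTree_iff (G := T) ⟨Equiv.refl _, ?_⟩).1 htree
    rintro ⟨u, hu⟩ ⟨v, hv⟩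
    constructor
    · rintro ⟨_, _, h⟩
      exact h
    · intro h
      exact ⟨hu, hv, h⟩
  · ext v
    simp only [hC, ConnectedComponent.mem_supp_iff, ConnectedComponent.eq, Set.mem_ofPred_eq]
    exact ⟨fun h => h.symm, fun h => h.symm⟩
  · intro e
    induction e using Sym2.ind with
    | _ u v =>
      rintro ⟨hu, hv, h⟩
      exact hT h

/-- A vertex property that does not change along the edges of a connected subgraph is constant
on it. -/
theorem Subgraph.iff_of_connected {V : Type*} {G : SimpleGraph V} {H : G.Subgraph}
    (hH : H.coe.Connected) {Q : V → Prop} (hQ : ∀ u v, H.Adj u v → (Q u ↔ Q v))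
    {u v : V} (hu : u ∈ H.verts) (hv : v ∈ H.verts) : Q u ↔ Q v := by
  obtain ⟨p⟩ := hH.preconnected ⟨u, hu⟩ ⟨v, hv⟩
  have key : ∀ (a b : H.verts), H.coe.Walk a b → (Q a ↔ Q b) := by
    intro a b p
    induction p with
    | nil => rfl
    | cons h _ ih => exact (hQ _ _ h).trans ih
  exact key _ _ p

end SimpleGraph

/-- A weighted subgraph of the grid with `X` columns and `Y` rows. The edge from `(x, y)` to
`(x + 1, y)` has the weight `w false x y`, the edge from `(x, y)` to `(x, y + 1)` the weight
`w true x y`; the weight `0` means that the edge is absent, and all weights are at most `N`. -/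
structure WeightedGrid where
  X : ℕ
  Y : ℕ
  N : ℕ
  w : Bool → ℕ → ℕ → ℕ
  X_pos : 0 < X
  Y_pos : 0 < Y
  w_le : ∀ d x y, w d x y ≤ N
  w_horizontal : ∀ x y, w false x y ≠ 0 → x + 1 < X ∧ y < Y
  w_vertical : ∀ x y, w true x y ≠ 0 → x < X ∧ y + 1 < Y

namespace WeightedGrid

variable (W : WeightedGrid)

/-- The number of the `o`-th vertex that belongs to the grid point `(x, y)`. -/
def vid (x y o : ℕ) : ℕ := (y * W.X + x) * (2 * W.N + 1) + o

/-- The number of vertices after every edge has been subdivided. -/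
def card : ℕ := W.X * W.Y * (2 * W.N + 1)

/-- Where the subdivision vertices of an edge start. -/
def off (d : Bool) : ℕ := if d then W.N else 0

/-- The other end of the edge that starts at `(x, y)`. -/
def dst (d : Bool) (x y : ℕ) : ℕ × ℕ := if d then (x, y + 1) else (x + 1, y)

/-- The triple `(x, y, o)` of the `t`-th vertex on a subdivided edge. -/
def place (d : Bool) (x y t : ℕ) : ℕ × ℕ × ℕ :=
  if t = 0 then (x, y, 0) else if t = W.w d x y then ((dst d x y).1, (dst d x y).2, 0)
  else (x, y, W.off d + t)

def vidOf (p : ℕ × ℕ × ℕ) : ℕ := W.vid p.1 p.2.1 p.2.2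

/-- The number of the `t`-th vertex on a subdivided edge. -/
def node (d : Bool) (x y t : ℕ) : ℕ := W.vidOf (W.place d x y t)

def Valid (p : ℕ × ℕ × ℕ) : Prop := p.1 < W.X ∧ p.2.1 < W.Y ∧ p.2.2 < 2 * W.N + 1

variable {W}

theorem vidOf_lt {p : ℕ × ℕ × ℕ} (hp : W.Valid p) : W.vidOf p < W.card := by
  obtain ⟨x, y, o⟩ := p
  obtain ⟨hx, hy, ho⟩ := hp
  simp only [vidOf, vid, card] at *
  have h1 : y * W.X + x + 1 ≤ W.X * W.Y := by nlinarith
  nlinarith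

theorem vidOf_inj {p p' : ℕ × ℕ × ℕ} (hp : W.Valid p) (hp' : W.Valid p')
    (h : W.vidOf p = W.vidOf p') : p = p' := by
  obtain ⟨x, y, o⟩ := p
  obtain ⟨x', y', o'⟩ := p'
  obtain ⟨hx, hy, ho⟩ := hp
  obtain ⟨hx', hy', ho'⟩ := hp'
  simp only [vidOf, vid] at *
  have h1 : y * W.X + x = y' * W.X + x' := by
    have := congrArg (· / (2 * W.N + 1)) h
    simpa only [add_comm _ o, add_comm _ o', Nat.add_mul_div_right _ _ (Nat.succ_pos (2 * W.N)),
      Nat.div_eq_of_lt ho, Nat.div_eq_of_lt ho', zero_add] using this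
  have h2 : o = o' := by rw [h1] at h; omega
  have h3 : y = y' := by
    have := congrArg (· / W.X) h1
    simpa [Nat.div_eq_of_lt, hx, hx', add_comm, Nat.add_mul_div_right, W.X_pos] using this
  have h4 : x = x' := by rw [h3] at h1; omega
  simp [h2, h3, h4]

theorem place_valid {d : Bool} {x y t : ℕ} (ht : t ≤ W.w d x y) (hw : W.w d x y ≠ 0) :
    W.Valid (W.place d x y t) := by
  have hle := W.w_le d x y
  unfold place Valid
  cases d
  · have := W.w_horizontal x y hw
    split_ifs <;> simp [dst, off] <;> omega
  · have := W.w_vertical x y hw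
    split_ifs <;> simp [dst, off] <;> omega

theorem exists_place_of_valid {p : ℕ} (hp : p < W.card) : ∃ a, W.Valid a ∧ W.vidOf a = p := by
  refine ⟨(p / (2 * W.N + 1) % W.X, p / (2 * W.N + 1) / W.X, p % (2 * W.N + 1)), ?_, ?_⟩
  · refine ⟨Nat.mod_lt _ W.X_pos, ?_, Nat.mod_lt _ (by omega)⟩
    simp only [card] at hp
    rw [Nat.div_lt_iff_lt_mul W.X_pos, Nat.div_lt_iff_lt_mul (by omega)]
    linarith [mul_comm W.X W.Y, congrArg (· * (2 * W.N + 1)) (mul_comm W.X W.Y)]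
  · simp only [vidOf, vid]
    rw [mul_comm _ W.X, Nat.div_add_mod, mul_comm, Nat.div_add_mod]

theorem node_lt {d : Bool} {x y t : ℕ} (ht : t ≤ W.w d x y) (hw : W.w d x y ≠ 0) :
    W.node d x y t < W.card := vidOf_lt (place_valid ht hw)

theorem node_zero (d : Bool) (x y : ℕ) : W.node d x y 0 = W.vid x y 0 := by
  simp [node, place, vidOf]

theorem node_end {d : Bool} {x y : ℕ} (hw : W.w d x y ≠ 0) :
    W.node d x y (W.w d x y) = W.vid (dst d x y).1 (dst d x y).2 0 := by
  simp [node, place, vidOf, hw]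

theorem node_lt_succ {d : Bool} {x y t : ℕ} (ht : t < W.w d x y) :
    W.node d x y t < W.node d x y (t + 1) := by
  have hle := W.w_le d x y
  have hX := W.X_pos
  have h1 : (y * W.X + x + 1) * (2 * W.N + 1) ≤ ((y + 1) * W.X + x) * (2 * W.N + 1) :=
    Nat.mul_le_mul_right _ (by rw [add_mul]; omega)
  have h2 : (y * W.X + x + 1) * (2 * W.N + 1) = (y * W.X + x) * (2 * W.N + 1) + (2 * W.N + 1) := by
    ring
  cases d
  · have hw := W.w_horizontal x y (by omega)
    simp only [node, place, vidOf, dst, off]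
    split_ifs <;> simp_all [vid, ← add_assoc] <;> omega
  · have hw := W.w_vertical x y (by omega)
    simp only [node, place, vidOf, dst, off]
    split_ifs <;> simp_all [vid, ← add_assoc] <;> omega

theorem edge_injective {d d' : Bool} {x y t x' y' t' : ℕ} (ht : t < W.w d x y)
    (ht' : t' < W.w d' x' y') (h1 : W.node d x y t = W.node d' x' y' t')
    (h2 : W.node d x y (t + 1) = W.node d' x' y' (t' + 1)) :
    d = d' ∧ x = x' ∧ y = y' ∧ t = t' := by
  have e1 := vidOf_inj (place_valid ht.le (by omega)) (place_valid ht'.le (by omega)) h1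
  have e2 := vidOf_inj (place_valid ht (by omega)) (place_valid ht' (by omega)) h2
  have hle := W.w_le d x y
  have hle' := W.w_le d' x' y'
  unfold place at e1 e2
  cases d <;> cases d' <;> simp only [dst, off] at e1 e2 <;> split_ifs at e1 e2 <;>
    simp at e1 e2 ⊢ <;> omega

end WeightedGrid


namespace WeightedGrid

variable (W : WeightedGrid)

theorem card_pos : 0 < W.card :=
  Nat.mul_pos (Nat.mul_pos W.X_pos W.Y_pos) (Nat.succ_pos _)

/-- A number, read as a vertex. -/
def vertex (i : ℕ) : Fin W.card := ⟨i % W.card, Nat.mod_lt _ W.card_pos⟩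

variable {W} in
theorem vertex_val {i : ℕ} (h : i < W.card) : (W.vertex i : ℕ) = i := Nat.mod_eq_of_lt h

variable {W} in
theorem vertex_coe (v : Fin W.card) : W.vertex v = v := Fin.ext (vertex_val v.2)

/-- The `t`-th edge on a subdivided edge. -/
def unitEdge (s : Bool × ℕ × ℕ) (t : ℕ) : Sym2 (Fin W.card) :=
  s(W.vertex (W.node s.1 s.2.1 s.2.2 t), W.vertex (W.node s.1 s.2.1 s.2.2 (t + 1)))

/-- The weight of an edge of the grid. -/
def weight (s : Bool × ℕ × ℕ) : ℕ := W.w s.1 s.2.1 s.2.2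

/-- The graph in which every edge of weight `w` is replaced by a path of `w` edges. -/
def subdivision : SimpleGraph (Fin W.card) where
  Adj u v := u ≠ v ∧ ∃ s t, t < W.weight s ∧ s(u, v) = W.unitEdge s t
  symm := ⟨fun u v ⟨hne, s, t, ht, h⟩ => ⟨hne.symm, s, t, ht, by rw [Sym2.eq_swap]; exact h⟩⟩
  loopless := ⟨fun _ h => h.1 rfl⟩

open Classical in
/-- The unweighted Steiner Tree instance of a weighted grid. -/
noncomputable def toInstance (term : ℕ → ℕ → Prop) (k : ℤ) : SteinerInstance where
  vertexCount := W.card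
  graph := W.subdivision
  terminals := Finset.univ.filter fun v =>
    ∃ x y, x < W.X ∧ y < W.Y ∧ term x y ∧ (v : ℕ) = W.vid x y 0
  budget := k

variable {W}

theorem mem_terminals {term : ℕ → ℕ → Prop} {k : ℤ} {v : Fin W.card} :
    v ∈ (W.toInstance term k).terminals ↔
      ∃ x y, x < W.X ∧ y < W.Y ∧ term x y ∧ (v : ℕ) = W.vid x y 0 := by
  classical
  refine Finset.mem_filter.trans ?_
  exact and_iff_right (Finset.mem_univ _)

theorem vertex_node_lt {s : Bool × ℕ × ℕ} {t : ℕ} (ht : t < W.weight s) :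
    (W.vertex (W.node s.1 s.2.1 s.2.2 t) : ℕ) < W.vertex (W.node s.1 s.2.1 s.2.2 (t + 1)) := by
  unfold weight at ht
  rw [vertex_val (node_lt ht.le (by omega)), vertex_val (node_lt ht (by omega))]
  exact node_lt_succ ht

theorem unitEdge_inj {s s' : Bool × ℕ × ℕ} {t t' : ℕ} (ht : t < W.weight s)
    (ht' : t' < W.weight s') (h : W.unitEdge s t = W.unitEdge s' t') : s = s' ∧ t = t' := by
  have h1 := vertex_node_lt ht
  have h2 := vertex_node_lt ht'
  rw [unitEdge, unitEdge, Sym2.eq_iff] at h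
  rcases h with ⟨e1, e2⟩ | ⟨e1, e2⟩
  · have e1 := congrArg Fin.val e1
    have e2 := congrArg Fin.val e2
    unfold weight at ht ht'
    rw [vertex_val (node_lt ht.le (by omega)), vertex_val (node_lt ht'.le (by omega))] at e1
    rw [vertex_val (node_lt ht (by omega)), vertex_val (node_lt ht' (by omega))] at e2
    obtain ⟨a, b, c, d⟩ := edge_injective ht ht' e1 e2
    exact ⟨Prod.ext a (Prod.ext b c), d⟩
  · rw [e1, e2] at h1
    omega

theorem mem_edgeSet {e : Sym2 (Fin W.card)} :
    e ∈ W.subdivision.edgeSet ↔ ∃ s t, t < W.weight s ∧ e = W.unitEdge s t := by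
  induction e using Sym2.ind with
  | _ u v =>
    refine ⟨fun h => h.2, fun ⟨s, t, ht, h⟩ => ⟨?_, s, t, ht, h⟩⟩
    intro huv
    change u = v at huv
    subst huv
    have := vertex_node_lt ht
    rw [unitEdge, Sym2.eq_iff] at h
    rcases h with ⟨h1, h2⟩ | ⟨h1, h2⟩ <;> rw [← h1, ← h2] at this <;> omega

/-- Transporting a property of grid points that respects the completely used edges to the vertices
of the subdivided grid. -/
theorem exists_extension (U : Set (Sym2 (Fin W.card))) (P : ℕ → ℕ → Prop)
    (hP : ∀ d x y, W.w d x y ≠ 0 → (∀ t < W.w d x y, W.unitEdge (d, x, y) t ∈ U) →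
      (P x y ↔ P (dst d x y).1 (dst d x y).2)) :
    ∃ Q : Fin W.card → Prop,
      (∀ x y, x < W.X → y < W.Y → (Q (W.vertex (W.vid x y 0)) ↔ P x y)) ∧
      ∀ s t, t < W.weight s → W.unitEdge s t ∈ U →
        (Q (W.vertex (W.node s.1 s.2.1 s.2.2 t)) ↔ Q (W.vertex (W.node s.1 s.2.1 s.2.2 (t + 1)))) := by
  classical
  let R : Bool → ℕ → ℕ → ℕ → Prop := fun d x y t =>
    if ∀ t' < t, W.unitEdge (d, x, y) t' ∈ U then P x y else P (dst d x y).1 (dst d x y).2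
  let Q' : ℕ × ℕ × ℕ → Prop := fun a =>
    if a.2.2 = 0 then P a.1 a.2.1 else
      if a.2.2 ≤ W.N then R false a.1 a.2.1 a.2.2 else R true a.1 a.2.1 (a.2.2 - W.N)
  have hQ : ∀ a, W.Valid a →
      ((∃ b, W.Valid b ∧ W.vidOf b = (W.vertex (W.vidOf a) : ℕ) ∧ Q' b) ↔ Q' a) := by
    intro a ha
    rw [vertex_val (vidOf_lt ha)]
    exact ⟨fun ⟨b, hb, h, h'⟩ => vidOf_inj hb ha h ▸ h', fun h => ⟨a, ha, rfl, h⟩⟩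
  have hR : ∀ d x y t, t ≤ W.w d x y → W.w d x y ≠ 0 → (Q' (W.place d x y t) ↔ R d x y t) := by
    intro d x y t ht hw
    have hle := W.w_le d x y
    rcases Nat.eq_zero_or_pos t with rfl | h0
    · simp [place, Q', R]
    · rcases eq_or_ne t (W.w d x y) with h1 | h1
      · have : Q' (W.place d x y t) ↔ P (dst d x y).1 (dst d x y).2 := by
          simp [place, Q', h1, hw]
        rw [this]
        simp only [R]
        split_ifs with h
        · rw [h1] at h
          exact (hP d x y hw h).symm
        · rfl
      · cases d
        · have : t ≤ W.N := by omega
          simp [place, Q', h1, h0.ne', off, this]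
        · simp [place, Q', h1, h0.ne', off]
  refine ⟨fun v => ∃ b, W.Valid b ∧ W.vidOf b = (v : ℕ) ∧ Q' b, ?_, ?_⟩
  · intro x y hx hy
    refine (hQ (x, y, 0) ⟨hx, hy, by simp⟩).trans ?_
    simp [Q']
  · rintro ⟨d, x, y⟩ t ht hU
    have ht' : t < W.w d x y := ht
    refine ((hQ _ (place_valid ht'.le (by omega))).trans (hR d x y t ht'.le (by omega))).trans
      (Iff.trans ?_ ((hQ _ (place_valid ht' (by omega))).trans (hR d x y (t + 1) ht' (by omega))).symm)
    simp only [R, Nat.lt_succ_iff_lt_or_eq]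
    by_cases h : ∀ t' < t, W.unitEdge (d, x, y) t' ∈ U
    · rw [if_pos h, if_pos]
      rintro t' (h' | rfl)
      exacts [h _ h', hU]
    · rw [if_neg h, if_neg]
      exact fun h' => h fun t' ht' => h' t' (Or.inl ht')

/-- A Steiner tree of the subdivided grid uses completely a set of edges of the grid that has at
most the same weight and that is not separated from the terminals by any cut. -/
theorem exists_slots {term : ℕ → ℕ → Prop} {k : ℤ}
    (h : (W.toInstance term k).HasTreeWithinBudget) :
    ∃ F : Finset (Bool × ℕ × ℕ), (∀ s ∈ F, W.weight s ≠ 0) ∧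
      ((∑ s ∈ F, W.weight s : ℕ) : ℤ) ≤ k ∧
      ∀ P : ℕ → ℕ → Prop,
        (∀ d x y, (d, x, y) ∈ F → (P x y ↔ P (dst d x y).1 (dst d x y).2)) →
        ∀ x y x' y', x < W.X → y < W.Y → term x y → x' < W.X → y' < W.Y → term x' y' →
          (P x y ↔ P x' y') := by
  classical
  obtain ⟨H, ⟨htree, hterm⟩, hk⟩ := h
  change W.subdivision.Subgraph at H
  let F : Finset (Bool × ℕ × ℕ) :=
    (Finset.univ ×ˢ Finset.range W.X ×ˢ Finset.range W.Y).filter fun s =>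
      W.weight s ≠ 0 ∧ ∀ t < W.weight s, W.unitEdge s t ∈ H.edgeSet
  have hF : ∀ s, s ∈ F ↔ W.weight s ≠ 0 ∧ ∀ t < W.weight s, W.unitEdge s t ∈ H.edgeSet := by
    rintro ⟨d, x, y⟩
    simp only [F, Finset.mem_filter, Finset.mem_product, Finset.mem_univ, true_and,
      Finset.mem_range, and_iff_right_iff_imp]
    rintro ⟨hw, -⟩
    cases d
    · have := W.w_horizontal x y hw
      omega
    · have := W.w_vertical x y hw
      omega
  refine ⟨F, fun s hs => ((hF s).1 hs).1, ?_, ?_⟩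
  · refine le_trans ?_ hk
    norm_cast
    have h1 : (∑ s ∈ F, W.weight s) = (F.sigma fun s => Finset.range (W.weight s)).card := by simp
    have h2 : Set.InjOn (fun p : (Σ _ : Bool × ℕ × ℕ, ℕ) => W.unitEdge p.1 p.2)
        (F.sigma fun s => Finset.range (W.weight s)) := by
      rintro ⟨s, t⟩ hs ⟨s', t'⟩ hs' he
      simp only [Finset.coe_sigma, Set.mem_sigma_iff, Finset.mem_coe, Finset.mem_range] at hs hs'
      obtain ⟨rfl, rfl⟩ := unitEdge_inj hs.2 hs'.2 he
      rfl
    rw [h1, ← Finset.card_image_of_injOn h2, ← Set.ncard_coe_finset]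
    refine Set.ncard_le_ncard ?_ (Set.toFinite _)
    intro e he
    simp only [Finset.coe_image, Set.mem_image, Finset.coe_sigma, Set.mem_sigma_iff,
      Finset.mem_coe, Finset.mem_range] at he
    obtain ⟨⟨s, t⟩, ⟨hs, ht⟩, rfl⟩ := he
    exact ((hF s).1 hs).2 t ht
  · intro P hP
    obtain ⟨Q, hQ, hQ'⟩ := exists_extension H.edgeSet P
      (fun d x y hw h => hP d x y ((hF _).2 ⟨hw, h⟩))
    have hadj : ∀ u v, H.Adj u v → (Q u ↔ Q v) := by
      intro u v huv
      obtain ⟨-, s, t, ht, he⟩ := H.adj_sub huv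
      have hmem : W.unitEdge s t ∈ H.edgeSet := he ▸ huv
      have := hQ' s t ht hmem
      rw [unitEdge, Sym2.eq_iff] at he
      rcases he with ⟨rfl, rfl⟩ | ⟨rfl, rfl⟩
      exacts [this, this.symm]
    have hverts : ∀ x y, x < W.X → y < W.Y → term x y → W.vertex (W.vid x y 0) ∈ H.verts := by
      intro x y hx hy ht
      refine hterm _ ?_
      refine mem_terminals.2 ?_
      exact ⟨x, y, hx, hy, ht, vertex_val (vidOf_lt (p := (x, y, 0)) ⟨hx, hy, by simp⟩)⟩
    intro x y x' y' hx hy ht hx' hy' ht'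
    rw [← hQ x y hx hy, ← hQ x' y' hx' hy']
    exact SimpleGraph.Subgraph.iff_of_connected htree.1 hadj (hverts x y hx hy ht)
      (hverts x' y' hx' hy' ht')

/-- A set of edges of the grid that is not separated from the terminals by any cut gives a Steiner
tree of at most the same weight. -/
theorem hasTree_of_slots {term : ℕ → ℕ → Prop} {k : ℤ} (F : Finset (Bool × ℕ × ℕ))
    (hF : ∀ s ∈ F, W.weight s ≠ 0) (hk : ((∑ s ∈ F, W.weight s : ℕ) : ℤ) ≤ k)
    (hconn : ∀ P : ℕ → ℕ → Prop,
      (∀ d x y, (d, x, y) ∈ F → (P x y ↔ P (dst d x y).1 (dst d x y).2)) →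
      ∀ x y x' y', x < W.X → y < W.Y → term x y → x' < W.X → y' < W.Y → term x' y' →
        (P x y ↔ P x' y')) :
    (W.toInstance term k).HasTreeWithinBudget := by
  classical
  let E : Finset (Sym2 (Fin W.card)) :=
    (F.sigma fun s => Finset.range (W.weight s)).image fun p => W.unitEdge p.1 p.2
  have hE : ∀ e, e ∈ E ↔ ∃ s t, s ∈ F ∧ t < W.weight s ∧ W.unitEdge s t = e := by
    intro e
    simp only [E, Finset.mem_image, Finset.mem_sigma, Finset.mem_range, Sigma.exists, and_assoc]
  let G' : SimpleGraph (Fin W.card) := SimpleGraph.fromEdgeSet E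
  have hle : G' ≤ W.subdivision := by
    intro u v huv
    rw [SimpleGraph.fromEdgeSet_adj] at huv
    obtain ⟨s, t, _, ht, he⟩ := (hE _).1 huv.1
    exact ⟨huv.2, s, t, ht, he.symm⟩
  have hstep : ∀ s ∈ F, ∀ t < W.weight s, G'.Adj (W.vertex (W.node s.1 s.2.1 s.2.2 t))
      (W.vertex (W.node s.1 s.2.1 s.2.2 (t + 1))) := by
    intro s hs t ht
    rw [SimpleGraph.fromEdgeSet_adj]
    refine ⟨(hE _).2 ⟨s, t, hs, ht, rfl⟩, fun h => ?_⟩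
    have := vertex_node_lt ht
    rw [h] at this
    omega
  have hreach : ∀ s ∈ F, ∀ t ≤ W.weight s, G'.Reachable (W.vertex (W.node s.1 s.2.1 s.2.2 0))
      (W.vertex (W.node s.1 s.2.1 s.2.2 t)) := by
    intro s hs t
    induction t with
    | zero => exact fun _ => SimpleGraph.Reachable.refl _
    | succ t ih => exact fun ht => (ih (by omega)).trans (hstep s hs t ht).reachable
  obtain ⟨rx, ry, hr⟩ : ∃ rx ry, ∀ x y, x < W.X → y < W.Y → term x y →
      G'.Reachable (W.vertex (W.vid rx ry 0)) (W.vertex (W.vid x y 0)) := by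
    by_cases hne : ∃ rx ry, rx < W.X ∧ ry < W.Y ∧ term rx ry
    · obtain ⟨rx, ry, hrx, hry, hr⟩ := hne
      refine ⟨rx, ry, fun x y hx hy hxy => ?_⟩
      refine (hconn (fun x y => G'.Reachable (W.vertex (W.vid rx ry 0)) (W.vertex (W.vid x y 0)))
        ?_ rx ry x y hrx hry hr hx hy hxy).1 (SimpleGraph.Reachable.refl _)
      intro d x y hs
      have := hreach _ hs _ le_rfl
      have hw : W.w d x y ≠ 0 := hF _ hs
      simp only [weight, node_zero, node_end hw] at this
      exact ⟨fun h => h.trans this, fun h => h.trans this.symm⟩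
    · push Not at hne
      exact ⟨0, 0, fun x y hx hy hxy => absurd hxy (hne x y hx hy)⟩
  obtain ⟨H, htree, hverts, hedges⟩ :=
    SimpleGraph.exists_subtree hle (W.vertex (W.vid rx ry 0))
  refine ⟨H, ⟨htree, ?_⟩, ?_⟩
  · intro v hv
    obtain ⟨x, y, hx, hy, ht, hxy⟩ := mem_terminals.1 hv
    have : v = W.vertex (W.vid x y 0) := by
      rw [← hxy]
      exact (vertex_coe v).symm
    rw [this, hverts]
    exact hr x y hx hy ht
  · refine le_trans ?_ hk
    norm_cast
    calc H.edgeSet.ncard ≤ (E : Set (Sym2 (Fin W.card))).ncard := by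
          refine Set.ncard_le_ncard (fun e he => ?_) (Set.toFinite _)
          have := hedges he
          rw [SimpleGraph.edgeSet_fromEdgeSet] at this
          exact this.1
      _ = E.card := Set.ncard_coe_finset _
      _ ≤ _ := Finset.card_image_le
      _ = _ := by simp

end WeightedGrid


/-- A graph is planar if it can be drawn with straight edges. -/
theorem SimpleGraph.isPlanar_of_segments {V : Type*} {G : SimpleGraph V} (pos : V → ℝ × ℝ)
    (hinj : Function.Injective pos)
    (hvert : ∀ u v, G.Adj u v → ∀ z, pos z ∈ segment ℝ (pos u) (pos v) → z = u ∨ z = v)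
    (hedge : ∀ u v u' v', G.Adj u v → G.Adj u' v' → s(u, v) ≠ s(u', v') →
      ∀ p, p ∈ segment ℝ (pos u) (pos v) → p ∈ segment ℝ (pos u') (pos v') →
        ∃ z, (z = u ∨ z = v) ∧ (z = u' ∨ z = v') ∧ p = pos z) :
    G.IsPlanar := by
  have hout : ∀ e : Sym2 V, s(e.out.1, e.out.2) = e := fun e => Quot.out_eq e
  have hadj : ∀ e ∈ G.edgeSet, G.Adj e.out.1 e.out.2 := fun e he => by
    rw [← SimpleGraph.mem_edgeSet, hout]
    exact he
  have hmem : ∀ (e : Sym2 V) (z : V), (z = e.out.1 ∨ z = e.out.2) → z ∈ e := fun e z hz => by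
    rw [← hout e, Sym2.mem_iff]
    exact hz
  have hseg : ∀ (e : Sym2 V) (t : unitInterval),
      AffineMap.lineMap (pos e.out.1) (pos e.out.2) (t : ℝ) ∈
        segment ℝ (pos e.out.1) (pos e.out.2) := fun e t => by
    rw [segment_eq_image_lineMap]
    exact ⟨t, t.2, rfl⟩
  refine ⟨pos, fun e t => AffineMap.lineMap (pos e.out.1) (pos e.out.2) (t : ℝ), hinj, ?_, ?_, ?_⟩
  · intro e he
    refine ⟨?_, ?_, e.out.1, e.out.2, (hout e).symm, by simp, by simp⟩
    · exact (AffineMap.lineMap_continuous).comp continuous_subtype_val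
    · exact (AffineMap.lineMap_injective ℝ fun h => (hadj e he).ne (hinj h)).comp
        Subtype.val_injective
  · intro e he t v hv
    exact hmem e v (hvert _ _ (hadj e he) v (hv ▸ hseg e t))
  · intro e he f hf hef s t hst
    beta_reduce at hst
    obtain ⟨z, h1, h2, h3⟩ := hedge _ _ _ _ (hadj e he) (hadj f hf)
      (by rw [hout, hout]; exact hef) _ (hseg e s) (by rw [hst]; exact hseg f t)
    exact ⟨z, hmem e z h1, hmem f z h2, h3⟩

namespace WeightedGrid

variable (W : WeightedGrid)

/-- The position of a vertex relative to its grid point. Vertices that no edge uses are put into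
the interior of the faces. -/
noncomputable def shift (a : ℕ × ℕ × ℕ) : ℝ × ℝ :=
  if a.2.2 = 0 then (0, 0)
  else if a.2.2 ≤ W.N then
    if a.2.2 < W.w false a.1 a.2.1 then ((a.2.2 : ℝ) / W.w false a.1 a.2.1, 0)
    else ((a.2.2 : ℝ) / (W.N + 1), 1 / 2)
  else if a.2.2 - W.N < W.w true a.1 a.2.1 then (0, ((a.2.2 - W.N : ℕ) : ℝ) / W.w true a.1 a.2.1)
    else (((a.2.2 - W.N : ℕ) : ℝ) / (W.N + 1), 1 / 3)

noncomputable def position (a : ℕ × ℕ × ℕ) : ℝ × ℝ :=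
  (a.1 + (W.shift a).1, a.2.1 + (W.shift a).2)

/-- The position of the `t`-th vertex on an edge of the grid. -/
noncomputable def positionOn (d : Bool) (x y t : ℕ) : ℝ × ℝ :=
  if d then ((x : ℝ), y + (t : ℝ) / W.w d x y) else (x + (t : ℝ) / W.w d x y, (y : ℝ))

variable {W}

theorem div_mem_Ioo {t w : ℕ} (h0 : t ≠ 0) (h : t < w) : (0 : ℝ) < t / w ∧ (t : ℝ) / w < 1 := by
  have h1 : (0 : ℝ) < t := by exact_mod_cast Nat.pos_of_ne_zero h0
  have h2 : (t : ℝ) < w := by exact_mod_cast h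
  exact ⟨div_pos h1 (h1.trans h2), by rw [div_lt_one (by linarith)]; exact h2⟩

theorem div_succ_mem_Ioo {t N : ℕ} (h0 : t ≠ 0) (h : t ≤ N) :
    (0 : ℝ) < t / (N + 1) ∧ (t : ℝ) / (N + 1) < 1 := by
  have := div_mem_Ioo h0 (Nat.lt_succ_of_le h)
  push_cast at this
  exact this

theorem shift_cases {a : ℕ × ℕ × ℕ} (ha : W.Valid a) :
    (a.2.2 = 0 ∧ W.shift a = (0, 0)) ∨
    (∃ t, t ≠ 0 ∧ t < W.w false a.1 a.2.1 ∧ a.2.2 = t ∧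
      W.shift a = ((t : ℝ) / W.w false a.1 a.2.1, 0)) ∨
    (∃ t, t ≠ 0 ∧ t < W.w true a.1 a.2.1 ∧ a.2.2 = W.N + t ∧
      W.shift a = (0, (t : ℝ) / W.w true a.1 a.2.1)) ∨
    (∃ t, t ≠ 0 ∧ t ≤ W.N ∧ a.2.2 = t ∧ W.shift a = ((t : ℝ) / (W.N + 1), 1 / 2)) ∨
    (∃ t, t ≠ 0 ∧ t ≤ W.N ∧ a.2.2 = W.N + t ∧ W.shift a = ((t : ℝ) / (W.N + 1), 1 / 3)) := by
  obtain ⟨_, _, ho⟩ := ha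
  unfold shift
  split_ifs with h1 h2 h3 h3
  · exact Or.inl ⟨h1, rfl⟩
  · exact Or.inr (Or.inl ⟨_, h1, h3, rfl, rfl⟩)
  · exact Or.inr (Or.inr (Or.inr (Or.inl ⟨_, h1, h2, rfl, rfl⟩)))
  · exact Or.inr (Or.inr (Or.inl ⟨_, by omega, h3, by omega, rfl⟩))
  · exact Or.inr (Or.inr (Or.inr (Or.inr ⟨_, by omega, by omega, by omega, rfl⟩)))

theorem shift_mem {a : ℕ × ℕ × ℕ} (ha : W.Valid a) :
    (0 ≤ (W.shift a).1 ∧ (W.shift a).1 < 1) ∧ 0 ≤ (W.shift a).2 ∧ (W.shift a).2 < 1 := by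
  rcases shift_cases ha with ⟨-, h⟩ | ⟨t, h0, h1, -, h⟩ | ⟨t, h0, h1, -, h⟩ | ⟨t, h0, h1, -, h⟩ |
    ⟨t, h0, h1, -, h⟩ <;> rw [h]
  · norm_num
  · have := div_mem_Ioo h0 h1
    exact ⟨⟨this.1.le, this.2⟩, by norm_num⟩
  · have := div_mem_Ioo h0 h1
    exact ⟨by norm_num, this.1.le, this.2⟩
  · have := div_succ_mem_Ioo h0 h1
    exact ⟨⟨this.1.le, this.2⟩, by norm_num⟩
  · have := div_succ_mem_Ioo h0 h1
    exact ⟨⟨this.1.le, this.2⟩, by norm_num⟩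

theorem nat_eq_of_add_eq {m n : ℕ} {f g : ℝ} (hf : 0 ≤ f ∧ f < 1) (hg : 0 ≤ g ∧ g < 1)
    (h : (m : ℝ) + f = n + g) : m = n := by
  have h1 : (m : ℝ) < n + 1 := by linarith
  have h2 : (n : ℝ) < m + 1 := by linarith
  have h1 : m < n + 1 := by exact_mod_cast h1
  have h2 : n < m + 1 := by exact_mod_cast h2
  omega

theorem position_inj {a b : ℕ × ℕ × ℕ} (ha : W.Valid a) (hb : W.Valid b)
    (h : W.position a = W.position b) : a = b := by
  have ha' := shift_mem ha
  have hb' := shift_mem hb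
  obtain ⟨e1, e2⟩ := Prod.ext_iff.1 h
  simp only [position] at e1 e2
  have hx := nat_eq_of_add_eq ha'.1 hb'.1 e1
  have hy := nat_eq_of_add_eq ha'.2 hb'.2 e2
  rw [hx, add_right_inj] at e1
  rw [hy, add_right_inj] at e2
  suffices a.2.2 = b.2.2 from Prod.ext hx (Prod.ext hy this)
  have ca := shift_cases ha
  have cb := shift_cases hb
  rw [hx, hy] at ca
  have quot : ∀ {t t' : ℕ} {r : ℝ}, 0 < r → (t : ℝ) / r = t' / r → t = t' := by
    intro t t' r hr h
    rw [div_left_inj' hr.ne'] at h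
    exact_mod_cast h
  have hN : (0 : ℝ) < W.N + 1 := by positivity
  rcases ca with ⟨ho, h1⟩ | ⟨t, h0, ht, ho, h1⟩ | ⟨t, h0, ht, ho, h1⟩ | ⟨t, h0, ht, ho, h1⟩ |
      ⟨t, h0, ht, ho, h1⟩ <;>
    rcases cb with ⟨ho', h1'⟩ | ⟨t', h0', ht', ho', h1'⟩ | ⟨t', h0', ht', ho', h1'⟩ |
      ⟨t', h0', ht', ho', h1'⟩ | ⟨t', h0', ht', ho', h1'⟩ <;>
    rw [h1, h1'] at e1 e2 <;> simp only at e1 e2 <;>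
    first
    | (rw [ho, ho']; done)
    | (exfalso; norm_num at e2; done)
    | (exfalso
       first
       | linarith [(div_mem_Ioo h0 ht).1]
       | linarith [(div_mem_Ioo h0' ht').1]
       | linarith [(div_succ_mem_Ioo h0 ht).1]
       | linarith [(div_succ_mem_Ioo h0' ht').1])
    | (rw [ho, ho']
       rw [quot (by exact_mod_cast (by omega : 0 < W.w false b.1 b.2.1)) e1])
    | (rw [ho, ho']
       rw [quot (by exact_mod_cast (by omega : 0 < W.w true b.1 b.2.1)) e2])
    | (rw [ho, ho', quot hN e1])

theorem position_place {d : Bool} {x y t : ℕ} (ht : t ≤ W.w d x y) (hw : W.w d x y ≠ 0) :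
    W.position (W.place d x y t) = W.positionOn d x y t := by
  have hle := W.w_le d x y
  have hw' : (W.w d x y : ℝ) ≠ 0 := by exact_mod_cast hw
  rcases Nat.eq_zero_or_pos t with rfl | h0
  · cases d <;> simp [place, position, positionOn, shift]
  · rcases eq_or_ne t (W.w d x y) with h1 | h1
    · cases d <;> simp [place, position, positionOn, shift, dst, h1, hw, hw']
    · cases d
      · have h2 : t ≤ W.N := by omega
        have h3 : t < W.w false x y := by omega
        simp [place, position, positionOn, shift, off, h0.ne', h1, h2, h3]
      · have h3 : t < W.w true x y := by omega
        simp [place, position, positionOn, shift, off, h0.ne', h1, h3]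

/-- Membership in the straight segment that draws an edge of the subdivided grid. -/
def OnEdge (W : WeightedGrid) (d : Bool) (x y t : ℕ) (p : ℝ × ℝ) : Prop :=
  if d then p.1 = x ∧ (y : ℝ) + (t : ℝ) / W.w d x y ≤ p.2 ∧ p.2 ≤ y + ((t : ℝ) + 1) / W.w d x y
  else p.2 = y ∧ (x : ℝ) + (t : ℝ) / W.w d x y ≤ p.1 ∧ p.1 ≤ x + ((t : ℝ) + 1) / W.w d x y

theorem onEdge_of_mem_segment {d : Bool} {x y t : ℕ} {p : ℝ × ℝ}
    (h : p ∈ segment ℝ (W.positionOn d x y t) (W.positionOn d x y (t + 1))) : W.OnEdge d x y t p := by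
  obtain ⟨a, b, ha, hb, hab, rfl⟩ := h
  have hle : (t : ℝ) / W.w d x y ≤ ((t : ℝ) + 1) / W.w d x y := by gcongr; linarith
  obtain rfl : a = 1 - b := by linarith
  cases d <;> simp only [OnEdge, positionOn, if_true, if_false, Bool.false_eq_true, Prod.fst_add,
    Prod.snd_add, Prod.smul_fst, Prod.smul_snd, smul_eq_mul, Nat.cast_add, Nat.cast_one] <;>
  refine ⟨by ring, ?_, ?_⟩ <;> nlinarith

theorem div_le_one_of_lt {t w : ℕ} (h : t < w) :
    0 ≤ (t : ℝ) / w ∧ ((t : ℝ) + 1) / w ≤ 1 := by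
  have h2 : (t : ℝ) + 1 ≤ w := by exact_mod_cast h
  exact ⟨by positivity, div_le_one_of_le₀ h2 (by positivity)⟩

/-- On a line divided into pieces, two pieces meet at most in their ends. -/
theorem interval_meet {x x' t t' w w' : ℕ} {p : ℝ} (ht : t < w) (ht' : t' < w')
    (hw : x = x' → w = w') (hne : x = x' → t ≠ t')
    (h1 : (x : ℝ) + (t : ℝ) / w ≤ p) (h2 : p ≤ x + ((t : ℝ) + 1) / w)
    (h1' : (x' : ℝ) + (t' : ℝ) / w' ≤ p) (h2' : p ≤ x' + ((t' : ℝ) + 1) / w') :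
    p = x + (t : ℝ) / w ∨ p = x + ((t : ℝ) + 1) / w := by
  have hb := div_le_one_of_lt ht
  have hb' := div_le_one_of_lt ht'
  rcases lt_trichotomy x x' with h | h | h
  · have : (x : ℝ) + 1 ≤ x' := by exact_mod_cast h
    right; linarith
  · subst h
    obtain rfl := hw rfl
    rcases lt_or_gt_of_ne (hne rfl) with h3 | h3
    · have : ((t : ℝ) + 1) / w ≤ t' / w := by
        gcongr
        exact_mod_cast h3
      right; linarith
    · have : ((t' : ℝ) + 1) / w ≤ t / w := by
        gcongr
        exact_mod_cast h3
      left; linarith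
  · have : (x' : ℝ) + 1 ≤ x := by exact_mod_cast h
    left; linarith

theorem interval_nat {x z t w : ℕ} {p : ℝ} (ht : t < w) (hp : p = z)
    (h1 : (x : ℝ) + (t : ℝ) / w ≤ p) (h2 : p ≤ x + ((t : ℝ) + 1) / w) :
    p = x + (t : ℝ) / w ∨ p = x + ((t : ℝ) + 1) / w := by
  have hb := div_le_one_of_lt ht
  rcases Nat.lt_or_ge x z with h | h
  · have : (x : ℝ) + 1 ≤ z := by exact_mod_cast h
    right; linarith
  · have : (z : ℝ) ≤ x := by exact_mod_cast h
    left; linarith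

theorem onEdge_meet {d d' : Bool} {x y t x' y' t' : ℕ} {p : ℝ × ℝ} (ht : t < W.w d x y)
    (ht' : t' < W.w d' x' y') (hne : ¬ (d = d' ∧ x = x' ∧ y = y' ∧ t = t'))
    (h : W.OnEdge d x y t p) (h' : W.OnEdge d' x' y' t' p) :
    p = W.positionOn d x y t ∨ p = W.positionOn d x y (t + 1) := by
  cases d <;> cases d' <;> simp only [OnEdge, positionOn, if_true, if_false, Bool.false_eq_true,
    Prod.ext_iff, Nat.cast_add, Nat.cast_one] at * <;>
    obtain ⟨h1, h2, h3⟩ := h <;> obtain ⟨h1', h2', h3'⟩ := h'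
  · have hy : y = y' := by rw [h1] at h1'; exact_mod_cast h1'
    subst hy
    have := interval_meet ht ht' (fun h => by rw [h]) (fun h h4 => hne ⟨trivial, h, rfl, h4⟩)
      h2 h3 h2' h3'
    tauto
  · have := interval_nat ht h1' h2 h3
    tauto
  · have := interval_nat ht h1' h2 h3
    tauto
  · have hx : x = x' := by rw [h1] at h1'; exact_mod_cast h1'
    subst hx
    have := interval_meet ht ht' (fun h => by rw [h]) (fun h h4 => hne ⟨trivial, rfl, h, h4⟩)
      h2 h3 h2' h3'
    tauto

theorem position_onEdge {a : ℕ × ℕ × ℕ} (ha : W.Valid a) {d : Bool} {x y t : ℕ}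
    (ht : t < W.w d x y) (h : W.OnEdge d x y t (W.position a)) :
    W.position a = W.positionOn d x y t ∨ W.position a = W.positionOn d x y (t + 1) := by
  have key : ∀ d' t', t' ≠ 0 → t' < W.w d' a.1 a.2.1 →
      W.position a = W.positionOn d' a.1 a.2.1 t' →
      W.position a = W.positionOn d x y t ∨ W.position a = W.positionOn d x y (t + 1) := by
    intro d' t' _ ht' he
    by_cases hcase : d = d' ∧ x = a.1 ∧ y = a.2.1 ∧ t = t'
    · obtain ⟨rfl, rfl, rfl, rfl⟩ := hcase
      exact Or.inl he
    · refine onEdge_meet ht ht' hcase h ?_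
      have hle : (t' : ℝ) / W.w d' a.1 a.2.1 ≤ ((t' : ℝ) + 1) / W.w d' a.1 a.2.1 := by
        gcongr; linarith
      rw [he]
      cases d' <;> simp [OnEdge, positionOn, hle]
  have frac : ∀ (m n : ℕ) (f : ℝ), 0 < f → f < 1 → ((m : ℝ) + f = n) → False := by
    intro m n f h0 h1 he
    have := nat_eq_of_add_eq (m := m) (n := n) (g := 0) ⟨h0.le, h1⟩ (by norm_num) (by linarith)
    subst this
    linarith
  rcases shift_cases ha with ⟨h0, hs⟩ | ⟨t', h0, ht', -, hs⟩ | ⟨t', h0, ht', -, hs⟩ |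
    ⟨t', h0, ht', -, hs⟩ | ⟨t', h0, ht', -, hs⟩
  · cases d <;> simp only [OnEdge, positionOn, if_true, if_false, Bool.false_eq_true,
      Prod.ext_iff, Nat.cast_add, Nat.cast_one, position, hs, add_zero] at *
    · have := interval_nat ht rfl h.2.1 h.2.2
      tauto
    · have := interval_nat ht rfl h.2.1 h.2.2
      tauto
  · exact key false t' h0 ht' (by simp [position, positionOn, hs])
  · exact key true t' h0 ht' (by simp [position, positionOn, hs])
  · exfalso
    have hf := div_succ_mem_Ioo h0 ht'
    cases d <;> simp only [OnEdge, if_true, if_false, Bool.false_eq_true, position, hs] at h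
    · exact frac _ _ _ (by norm_num) (by norm_num) h.1
    · exact frac _ _ _ hf.1 hf.2 h.1
  · exfalso
    have hf := div_succ_mem_Ioo h0 ht'
    cases d <;> simp only [OnEdge, if_true, if_false, Bool.false_eq_true, position, hs] at h
    · exact frac _ _ _ (by norm_num) (by norm_num) h.1
    · exact frac _ _ _ hf.1 hf.2 h.1

theorem subdivision_isPlanar (W : WeightedGrid) : W.subdivision.IsPlanar := by
  choose pl hpl using fun v : Fin W.card => exists_place_of_valid v.2
  have pl_node : ∀ {d x y t}, t ≤ W.w d x y → W.w d x y ≠ 0 →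
      W.position (pl (W.vertex (W.node d x y t))) = W.positionOn d x y t := by
    intro d x y t ht hw
    rw [← position_place ht hw]
    congr 1
    refine vidOf_inj (hpl _).1 (place_valid ht hw) ?_
    rw [(hpl _).2, vertex_val (node_lt ht hw), node]
  have hinj : Function.Injective fun v => W.position (pl v) := by
    intro u v h
    have := position_inj (hpl u).1 (hpl v).1 h
    exact Fin.ext ((hpl u).2 ▸ (hpl v).2 ▸ congrArg _ this)
  have hadj : ∀ u v, W.subdivision.Adj u v → ∃ d x y t, t < W.w d x y ∧
      s(u, v) = W.unitEdge (d, x, y) t ∧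
      (∀ p, p ∈ segment ℝ (W.position (pl u)) (W.position (pl v)) → W.OnEdge d x y t p) ∧
      ∀ z, W.position (pl z) = W.positionOn d x y t ∨ W.position (pl z) = W.positionOn d x y (t + 1) →
        z = u ∨ z = v := by
    rintro u v ⟨-, ⟨d, x, y⟩, t, ht, he⟩
    have ht : t < W.w d x y := ht
    refine ⟨d, x, y, t, ht, he, ?_⟩
    rw [← pl_node ht.le (by omega), ← pl_node ht (by omega)]
    have hz : ∀ z z', W.position (pl z) = W.position (pl z') ↔ z = z' := fun z z' => hinj.eq_iff
    simp only [hz]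
    rw [unitEdge, Sym2.eq_iff] at he
    rcases he with ⟨rfl, rfl⟩ | ⟨rfl, rfl⟩
    · refine ⟨fun p hp => onEdge_of_mem_segment ?_, fun z h => h⟩
      rwa [pl_node ht.le (by omega), pl_node ht (by omega)] at hp
    · refine ⟨fun p hp => onEdge_of_mem_segment ?_, fun z h => h.symm⟩
      rwa [segment_symm, pl_node ht.le (by omega), pl_node ht (by omega)] at hp
  refine SimpleGraph.isPlanar_of_segments (fun v => W.position (pl v)) hinj ?_ ?_
  · intro u v huv z hz
    obtain ⟨d, x, y, t, ht, -, h1, h2⟩ := hadj u v huv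
    exact h2 z (position_onEdge (hpl z).1 ht (h1 _ hz))
  · intro u v u' v' huv huv' hne p hp hp'
    obtain ⟨d, x, y, t, ht, he, h1, h2⟩ := hadj u v huv
    obtain ⟨d', x', y', t', ht', he', h1', h2'⟩ := hadj u' v' huv'
    have hcase : ¬ (d = d' ∧ x = x' ∧ y = y' ∧ t = t') := by
      rintro ⟨rfl, rfl, rfl, rfl⟩
      exact hne (he.trans he'.symm)
    have m := onEdge_meet ht ht' hcase (h1 p hp) (h1' p hp')
    have m' := onEdge_meet ht' ht (fun h => hcase ⟨h.1.symm, h.2.1.symm, h.2.2.1.symm, h.2.2.2.symm⟩)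
      (h1' p hp') (h1 p hp)
    obtain ⟨z, hz⟩ : ∃ z, p = W.position (pl z) := by
      rcases m with m | m
      · exact ⟨_, m.trans (pl_node ht.le (by omega)).symm⟩
      · exact ⟨_, m.trans (pl_node ht (by omega)).symm⟩
    rw [hz] at m m'
    exact ⟨z, h2 z m, h2' z m', hz⟩

end WeightedGrid


theorem List.nodup_flatMap_of_proj {α β : Type*} {l : List α} {f : α → List β} (g : β → α)
    (hl : l.Nodup) (hf : ∀ a ∈ l, (f a).Nodup) (hg : ∀ a ∈ l, ∀ b ∈ f a, g b = a) :
    (l.flatMap f).Nodup := by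
  rw [List.nodup_flatMap]
  refine ⟨hf, ?_⟩
  refine List.Pairwise.imp_of_mem ?_ hl
  intro a a' ha ha' hne
  rw [Function.onFun, List.disjoint_left]
  intro b hb hb'
  exact hne ((hg a ha b hb).symm.trans (hg a' ha' b hb'))

theorem List.range_mul_map {β : Type*} (a b : ℕ) (f : ℕ → β) :
    (List.range (a * b)).map f =
      (List.range a).flatMap fun i => (List.range b).map fun j => f (i * b + j) := by
  induction a with
  | zero => simp
  | succ a ih =>
    rw [List.range_succ, List.flatMap_append, ← ih, Nat.succ_mul, List.range_add]
    simp

theorem List.range_mul_flatMap {β : Type*} (a b : ℕ) (f : ℕ → List β) :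
    (List.range (a * b)).flatMap f =
      (List.range a).flatMap fun i => (List.range b).flatMap fun j => f (i * b + j) := by
  simp only [List.flatMap_def, List.range_mul_map]
  rw [List.flatten_flatten, List.map_map]
  rfl

theorem List.map_finRange_eq {β : Type*} (n : ℕ) (f : ℕ → β) :
    (List.finRange n).map (fun i : Fin n => f i) = (List.range n).map f := by
  rw [← List.map_coe_finRange_eq_range, List.map_map]
  rfl

namespace WeightedGrid

variable (W : WeightedGrid)

/-- All pairs of an edge of the grid and a position on it. -/
def slots : List ((Bool × ℕ × ℕ) × ℕ) :=
  (List.range W.Y).flatMap fun y => (List.range W.X).flatMap fun x =>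
    [false, true].flatMap fun d => (List.range (W.w d x y)).map fun t => ((d, x, y), t)

/-- The written form of the path that replaces an edge. -/
def chain (d : Bool) (x y : ℕ) : List ℕ :=
  (List.range (W.w d x y)).flatMap fun t => [W.node d x y t, W.node d x y (t + 1)]

/-- The written form of the instance whose terminals are marked by `mark`. -/
def written (mark : ℕ → ℕ → ℕ) (k : ℤ) : List ℕ :=
  W.card :: k.toNat :: (-k).toNat ::
    (((List.range W.Y).flatMap fun y => (List.range W.X).flatMap fun x =>
        mark x y :: List.replicate (2 * W.N) 0) ++
      (List.range W.Y).flatMap fun y => (List.range W.X).flatMap fun x =>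
        W.chain false x y ++ W.chain true x y)

variable {W}

theorem mem_slots {p : (Bool × ℕ × ℕ) × ℕ} : p ∈ W.slots ↔ p.2 < W.weight p.1 := by
  obtain ⟨⟨d, x, y⟩, t⟩ := p
  simp only [slots, List.mem_flatMap, List.mem_range, List.mem_map, weight, Prod.mk.injEq]
  constructor
  · rintro ⟨y', hy, x', hx, d', -, t', ht, ⟨rfl, rfl, rfl⟩, rfl⟩
    exact ht
  · intro h
    have h1 : y < W.Y ∧ x < W.X := by
      cases d
      · have := W.w_horizontal x y (by omega)
        omega
      · have := W.w_vertical x y (by omega)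
        omega
    exact ⟨y, h1.1, x, h1.2, d, by cases d <;> simp, t, h, ⟨rfl, rfl, rfl⟩, rfl⟩

theorem nodup_slots : W.slots.Nodup := by
  refine List.nodup_flatMap_of_proj (fun p => p.1.2.2) List.nodup_range (fun y _ => ?_) ?_
  · refine List.nodup_flatMap_of_proj (fun p => p.1.2.1) List.nodup_range (fun x _ => ?_) ?_
    · refine List.nodup_flatMap_of_proj (fun p => p.1.1) (by simp) (fun d _ => ?_) ?_
      · exact List.nodup_range.map fun t t' h => (Prod.ext_iff.1 h).2
      · intro d _ p hp
        obtain ⟨t, -, rfl⟩ := List.mem_map.1 hp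
        rfl
    · intro x _ p hp
      obtain ⟨d, -, hp⟩ := List.mem_flatMap.1 hp
      obtain ⟨t, -, rfl⟩ := List.mem_map.1 hp
      rfl
  · intro y _ p hp
    obtain ⟨x, -, hp⟩ := List.mem_flatMap.1 hp
    obtain ⟨d, -, hp⟩ := List.mem_flatMap.1 hp
    obtain ⟨t, -, rfl⟩ := List.mem_map.1 hp
    rfl

theorem slots_flatMap_node :
    (W.slots.map fun p => (W.vertex (W.node p.1.1 p.1.2.1 p.1.2.2 p.2),
        W.vertex (W.node p.1.1 p.1.2.1 p.1.2.2 (p.2 + 1)))).flatMap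
        (fun e => [(e.1 : ℕ), (e.2 : ℕ)]) =
      (List.range W.Y).flatMap fun y => (List.range W.X).flatMap fun x =>
        W.chain false x y ++ W.chain true x y := by
  have h : ∀ p ∈ W.slots, [(W.vertex (W.node p.1.1 p.1.2.1 p.1.2.2 p.2) : ℕ),
      (W.vertex (W.node p.1.1 p.1.2.1 p.1.2.2 (p.2 + 1)) : ℕ)] =
      [W.node p.1.1 p.1.2.1 p.1.2.2 p.2, W.node p.1.1 p.1.2.1 p.1.2.2 (p.2 + 1)] := by
    intro p hp
    have ht : p.2 < W.w p.1.1 p.1.2.1 p.1.2.2 := mem_slots.1 hp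
    rw [vertex_val (node_lt ht.le (by omega)), vertex_val (node_lt ht (by omega))]
  rw [List.flatMap_map, List.flatMap_congr h]
  simp only [slots, List.flatMap_assoc, List.flatMap_map, List.flatMap_cons, List.flatMap_nil,
    List.append_nil, chain, List.flatMap_append]

theorem isEncoding_written {term : ℕ → ℕ → Prop} {mark : ℕ → ℕ → ℕ} {k : ℤ}
    (hmark : ∀ x y, x < W.X → y < W.Y → (term x y ∧ mark x y = 1 ∨ ¬ term x y ∧ mark x y = 0)) :
    (W.toInstance term k).IsEncoding (W.written mark k) := by
  classical
  refine ⟨W.slots.map fun p => (W.vertex (W.node p.1.1 p.1.2.1 p.1.2.2 p.2),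
    W.vertex (W.node p.1.1 p.1.2.1 p.1.2.2 (p.2 + 1))), ?_, ?_, ?_⟩
  · rw [List.map_map]
    exact nodup_slots.map_on fun p hp p' hp' h => by
      obtain ⟨h1, h2⟩ := unitEdge_inj (mem_slots.1 hp) (mem_slots.1 hp') h
      exact Prod.ext h1 h2
  · intro e
    rw [List.map_map, List.mem_map]
    refine mem_edgeSet.trans ⟨?_, ?_⟩
    · rintro ⟨s, t, ht, rfl⟩
      exact ⟨(s, t), mem_slots.2 ht, rfl⟩
    · rintro ⟨p, hp, rfl⟩
      exact ⟨p.1, p.2, mem_slots.1 hp, rfl⟩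
  · refine congrArg (W.card :: k.toNat :: (-k).toNat :: ·) ?_
    refine congrArg₂ (· ++ ·) ?_ slots_flatMap_node.symm
    let f : ℕ → ℕ := fun i => if i % (2 * W.N + 1) = 0 then
      mark (i / (2 * W.N + 1) % W.X) (i / (2 * W.N + 1) / W.X) else 0
    have hf : ∀ v : Fin W.card, (W.toInstance term k).flag v = f v := by
      intro v
      obtain ⟨⟨x, y, o⟩, ⟨hx, hy, ho⟩, hv⟩ := exists_place_of_valid v.2
      have h1 : (v : ℕ) % (2 * W.N + 1) = o := by
        rw [← hv, vidOf, vid, mul_comm, Nat.mul_add_mod, Nat.mod_eq_of_lt ho]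
      have h2 : (v : ℕ) / (2 * W.N + 1) = y * W.X + x := by
        rw [← hv, vidOf, vid, mul_comm, Nat.mul_add_div (by omega), Nat.div_eq_of_lt ho, add_zero]
      have h3 : (y * W.X + x) % W.X = x := by
        rw [mul_comm, Nat.mul_add_mod, Nat.mod_eq_of_lt hx]
      have h4 : (y * W.X + x) / W.X = y := by
        rw [mul_comm, Nat.mul_add_div W.X_pos, Nat.div_eq_of_lt hx, add_zero]
      have hmem : v ∈ (W.toInstance term k).terminals ↔ o = 0 ∧ term x y := by
        refine mem_terminals.trans ⟨?_, ?_⟩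
        · rintro ⟨x', y', hx', hy', ht, he⟩
          rw [← hv] at he
          have := vidOf_inj (p := (x, y, o)) (p' := (x', y', 0)) ⟨hx, hy, ho⟩
            ⟨hx', hy', by simp⟩ he
          simp only [Prod.mk.injEq] at this
          obtain ⟨rfl, rfl, rfl⟩ := this
          exact ⟨rfl, ht⟩
        · rintro ⟨rfl, ht⟩
          exact ⟨x, y, hx, hy, ht, hv.symm⟩
      simp only [f, h1, h2, h3, h4]
      rcases hmark x y hx hy with ⟨h, h'⟩ | ⟨h, h'⟩
      · by_cases h0 : o = 0
        · rw [if_pos h0, h']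
          exact if_pos (hmem.2 ⟨h0, h⟩)
        · rw [if_neg h0]
          exact if_neg fun hm => h0 (hmem.1 hm).1
      · rw [h', ite_self]
        exact if_neg fun hm => h (hmem.1 hm).2
    have h1 : (List.finRange W.card).map (W.toInstance term k).flag = (List.range W.card).map f := by
      rw [← List.map_finRange_eq]
      exact List.map_congr_left fun (v : Fin W.card) _ => hf v
    refine Eq.trans ?_ h1.symm
    rw [card, mul_comm W.X, List.range_mul_map, List.range_mul_flatMap]
    refine List.flatMap_congr fun y _ => List.flatMap_congr fun x hx => ?_
    have hx : x < W.X := List.mem_range.1 hx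
    rw [List.range_succ_eq_map, List.map_cons, List.map_map]
    have e0 : ∀ j < 2 * W.N + 1, f ((y * W.X + x) * (2 * W.N + 1) + j) =
        if j = 0 then mark x y else 0 := by
      intro j hj
      have h1 : ((y * W.X + x) * (2 * W.N + 1) + j) % (2 * W.N + 1) = j := by
        rw [mul_comm, Nat.mul_add_mod, Nat.mod_eq_of_lt hj]
      have h2 : ((y * W.X + x) * (2 * W.N + 1) + j) / (2 * W.N + 1) = y * W.X + x := by
        rw [mul_comm, Nat.mul_add_div (by omega), Nat.div_eq_of_lt hj, add_zero]
      have h3 : (y * W.X + x) % W.X = x := by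
        rw [mul_comm, Nat.mul_add_mod, Nat.mod_eq_of_lt hx]
      have h4 : (y * W.X + x) / W.X = y := by
        rw [mul_comm, Nat.mul_add_div W.X_pos, Nat.div_eq_of_lt hx, add_zero]
      simp only [f, h1, h2, h3, h4]
    refine congrArg₂ List.cons ?_ ?_
    · rw [e0 0 (by omega), if_pos rfl]
    · rw [eq_comm, List.eq_replicate_iff]
      refine ⟨by simp, fun b hb => ?_⟩
      obtain ⟨j, hj, rfl⟩ := List.mem_map.1 hb
      rw [List.mem_range] at hj
      simp only [Function.comp]
      rw [e0 _ (by omega), if_neg (by omega)]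

theorem card_le_length_written (mark : ℕ → ℕ → ℕ) (k : ℤ) :
    W.card + 3 ≤ (W.written mark k).length := by
  have : W.card = W.Y * (W.X * (2 * W.N + 1)) := by rw [card]; ring
  simp [written, List.length_flatMap]
  omega

end WeightedGrid


theorem Finset.sum_range_mul_eq {β : Type*} [AddCommMonoid β] (a b : ℕ) (f : ℕ → β) :
    ∑ y ∈ Finset.range (a * b), f y =
      ∑ i ∈ Finset.range a, ∑ j ∈ Finset.range b, f (i * b + j) := by
  induction a with
  | zero => simp
  | succ a ih => rw [Nat.succ_mul, Finset.sum_range_add, ih, Finset.sum_range_succ]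

/-- `q` groups of variables with `M` assignments each, `m` clauses, and the information whether the
assignment `a` to the variables of the group `i` satisfies the clause `j`. -/
structure StripData where
  q : ℕ
  M : ℕ
  m : ℕ
  sat : ℕ → ℕ → ℕ → Bool

namespace StripData

variable (S : StripData)

/-- The distance of two consecutive gap rows. -/
def period : ℕ := 3 * S.M + 1

def scale : ℕ := 8 * S.q * (S.m + 1)

/-- The weight of the horizontal edges inside the strips. -/
def rowWeight : ℕ := S.scale * S.period

/-- The weight of the horizontal edges in the gap rows. -/
def gapWeight : ℕ := S.scale * S.rowWeight

/-- The weight of a vertical edge in the column `x` that starts `r` rows above a gap row. -/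
def vert (x r : ℕ) : ℕ :=
  if x = 0 then 1
  else if x % 7 = 1 ∨ x % 7 = 3 then (if r = 0 then 0 else 2)
  else if x % 7 = 5 ∨ x % 7 = 0 then (if r + 1 = S.period then 0 else 2)
  else 0

/-- The weight of a horizontal edge that starts in the column `x`, `r` rows above the `i`-th gap
row. -/
def horiz (x i r : ℕ) : ℕ :=
  if r = 0 then (if x % 7 = 0 then 0 else S.gapWeight)
  else if r % 3 = 2 then
    (if x % 7 = 0 then S.rowWeight + (if x = 0 ∨ x = 7 * S.m then r else 0)
    else if S.sat i (r / 3) (x / 7) then S.rowWeight + (if x % 7 = 1 then 2 else 0) else 0)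
  else if x % 7 = 0 then 0 else S.rowWeight

/-- The weights of the edges of the grid. -/
def w (d : Bool) (x y : ℕ) : ℕ :=
  if d then (if x < 7 * S.m + 2 ∧ y < S.q * S.period then S.vert x (y % S.period) else 0)
  else if x < 7 * S.m + 1 ∧ y < S.q * S.period + 1 then
    S.horiz x (y / S.period) (y % S.period)
  else 0

theorem period_pos : 0 < S.period := Nat.succ_pos _

theorem w_le (d : Bool) (x y : ℕ) : S.w d x y ≤ S.gapWeight + S.rowWeight + S.period + 2 := by
  have := Nat.mod_lt y S.period_pos
  unfold w vert horiz
  split_ifs <;> omega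

theorem of_w_horizontal {x y : ℕ} (h : S.w false x y ≠ 0) :
    x < 7 * S.m + 1 ∧ y < S.q * S.period + 1 := by
  by_contra hn
  exact h ((if_neg Bool.false_ne_true).trans (if_neg hn))

theorem of_w_vertical {x y : ℕ} (h : S.w true x y ≠ 0) :
    x < 7 * S.m + 2 ∧ y < S.q * S.period := by
  by_contra hn
  exact h ((if_pos rfl).trans (if_neg hn))

def grid : WeightedGrid where
  X := 7 * S.m + 2
  Y := S.q * S.period + 1
  N := S.gapWeight + S.rowWeight + S.period + 2
  w := S.w
  X_pos := by omega
  Y_pos := by omega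
  w_le := S.w_le
  w_horizontal _ _ h := ⟨by have := (S.of_w_horizontal h).1; omega, (S.of_w_horizontal h).2⟩
  w_vertical _ _ h := ⟨(S.of_w_vertical h).1, by have := (S.of_w_vertical h).2; omega⟩

/-- The terminals. -/
def term (x y : ℕ) : Prop :=
  S.m ≠ 0 ∧ ((x = 0 ∧ (y = 0 ∨ y = S.q * S.period)) ∨
    y % S.period = 0 ∧ (x = 7 * S.m + 1 ∧ y ≠ 0 ∨ x % 7 = 2 ∧ y ≠ 0 ∨ x % 7 = 4 ∨
      x % 7 = 6 ∧ y ≠ S.q * S.period))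

def budget : ℕ :=
  S.gapWeight * (S.m * (3 * S.q + 1)) + S.rowWeight * (S.q * (7 * S.m + 1)) + S.q * S.period +
    S.q * (2 * S.period * (S.m + 1) + 2 * S.m)

variable {S}

theorem div_add {i r : ℕ} (hr : r < S.period) : (i * S.period + r) / S.period = i := by
  rw [mul_comm, Nat.mul_add_div S.period_pos, Nat.div_eq_of_lt hr, add_zero]

theorem mod_add {i r : ℕ} (hr : r < S.period) : (i * S.period + r) % S.period = r := by
  rw [mul_comm, Nat.mul_add_mod, Nat.mod_eq_of_lt hr]

theorem mul_add_lt {i r : ℕ} (hi : i < S.q) (hr : r < S.period) :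
    i * S.period + r < S.q * S.period := by
  have : (i + 1) * S.period ≤ S.q * S.period := Nat.mul_le_mul_right _ hi
  rw [add_mul] at this
  omega

theorem w_vertical_strip {x i r : ℕ} (hx : x < 7 * S.m + 2) (hi : i < S.q) (hr : r < S.period) :
    S.w true x (i * S.period + r) = S.vert x r := by
  simp [w, hx, mul_add_lt hi hr, mod_add hr]

theorem w_spine {y : ℕ} (hy : y < S.q * S.period) : S.w true 0 y = 1 := by
  simp [w, hy, vert]

theorem w_horizontal_strip {x i r : ℕ} (hx : x < 7 * S.m + 1) (hi : i < S.q)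
    (hr : r < S.period) : S.w false x (i * S.period + r) = S.horiz x i r := by
  have := mul_add_lt hi hr
  simp only [w, Bool.false_eq_true, if_false, hx, mod_add hr, div_add hr, true_and]
  rw [if_pos (by omega)]

theorem w_horizontal_gap {x g : ℕ} (hx : x < 7 * S.m + 1) (hg : g < S.q + 1) :
    S.w false x (g * S.period) = if x % 7 = 0 then 0 else S.gapWeight := by
  have : g * S.period ≤ S.q * S.period := Nat.mul_le_mul_right _ (by omega)
  simp only [w, Bool.false_eq_true, if_false, hx, Nat.mul_mod_left, true_and, horiz, if_true]
  rw [if_pos (by omega)]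

open Classical in
/-- The weight that an edge contributes to a set of edges. -/
noncomputable def contribution (S : StripData) (F : Finset (Bool × ℕ × ℕ)) (d : Bool)
    (x y : ℕ) : ℕ :=
  if (d, x, y) ∈ F then S.w d x y else 0

noncomputable def slabSum (S : StripData) (F : Finset (Bool × ℕ × ℕ)) (i x : ℕ) : ℕ :=
  ∑ r ∈ Finset.range (3 * S.M), S.contribution F false x (i * S.period + (r + 1))

noncomputable def columnSum (S : StripData) (F : Finset (Bool × ℕ × ℕ)) (i x : ℕ) : ℕ :=
  ∑ r ∈ Finset.range S.period, S.contribution F true x (i * S.period + r)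

theorem contribution_le (F : Finset (Bool × ℕ × ℕ)) (d : Bool) (x y : ℕ) :
    S.contribution F d x y ≤ S.w d x y := by
  unfold contribution
  split_ifs <;> omega

theorem sum_eq {F : Finset (Bool × ℕ × ℕ)} (hF : ∀ s ∈ F, S.grid.weight s ≠ 0) :
    ∑ s ∈ F, S.grid.weight s =
      ∑ x ∈ Finset.range (7 * S.m + 1), ∑ g ∈ Finset.range (S.q + 1),
          S.contribution F false x (g * S.period) +
        ∑ i ∈ Finset.range S.q, ∑ x ∈ Finset.range (7 * S.m + 1), S.slabSum F i x +
        ∑ y ∈ Finset.range (S.q * S.period), S.contribution F true 0 y +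
        ∑ i ∈ Finset.range S.q, ∑ x ∈ Finset.range (7 * S.m + 1), S.columnSum F i (x + 1) := by
  classical
  have hzero : ∀ d x y, S.w d x y = 0 → S.contribution F d x y = 0 := fun d x y h =>
    Nat.eq_zero_of_le_zero (h ▸ contribution_le F d x y)
  have hsub : F ⊆ Finset.univ ×ˢ Finset.range (7 * S.m + 2) ×ˢ Finset.range (S.q * S.period + 1) := by
    rintro ⟨d, x, y⟩ hs
    have := hF _ hs
    simp only [Finset.mem_product, Finset.mem_univ, Finset.mem_range, true_and]
    cases d
    · have := S.grid.w_horizontal x y this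
      simp only [grid] at this
      omega
    · have := S.grid.w_vertical x y this
      simp only [grid] at this
      omega
  have h1 : ∑ s ∈ F, S.grid.weight s =
      ∑ s ∈ Finset.univ ×ˢ Finset.range (7 * S.m + 2) ×ˢ Finset.range (S.q * S.period + 1),
        S.contribution F s.1 s.2.1 s.2.2 := by
    rw [← Finset.sum_subset hsub]
    · refine Finset.sum_congr rfl fun s hs => ?_
      exact (if_pos hs).symm
    · intro s _ hs
      exact if_neg hs
  have hV : ∑ x ∈ Finset.range (7 * S.m + 2), ∑ y ∈ Finset.range (S.q * S.period + 1),
      S.contribution F true x y = ∑ y ∈ Finset.range (S.q * S.period), S.contribution F true 0 y +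
        ∑ i ∈ Finset.range S.q, ∑ x ∈ Finset.range (7 * S.m + 1), S.columnSum F i (x + 1) := by
    rw [Finset.sum_comm (s := Finset.range S.q), Finset.sum_range_succ', add_comm]
    refine congrArg₂ (· + ·) ?_ (Finset.sum_congr rfl fun x _ => ?_)
    · rw [Finset.sum_range_succ, hzero, add_zero]
      simp [w]
    · rw [Finset.sum_range_succ, hzero, add_zero, Finset.sum_range_mul_eq]
      · rfl
      · simp [w]
  have hH : ∑ x ∈ Finset.range (7 * S.m + 2), ∑ y ∈ Finset.range (S.q * S.period + 1),
      S.contribution F false x y =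
      ∑ x ∈ Finset.range (7 * S.m + 1), ∑ g ∈ Finset.range (S.q + 1),
          S.contribution F false x (g * S.period) +
        ∑ i ∈ Finset.range S.q, ∑ x ∈ Finset.range (7 * S.m + 1), S.slabSum F i x := by
    rw [Finset.sum_comm (s := Finset.range S.q), ← Finset.sum_add_distrib, Finset.sum_range_succ,
      Finset.sum_eq_zero (s := Finset.range (S.q * S.period + 1)), add_zero]
    · refine Finset.sum_congr rfl fun x _ => ?_
      rw [Finset.sum_range_succ, Finset.sum_range_mul_eq, Finset.sum_range_succ, add_right_comm,
        ← Finset.sum_add_distrib]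
      refine congrArg₂ (· + ·) (Finset.sum_congr rfl fun i _ => ?_) rfl
      rw [period, Finset.sum_range_succ', add_comm]
      rfl
    · intro y _
      exact hzero _ _ _ (by simp [w])
  rw [h1, Finset.sum_product, Fintype.sum_bool, Finset.sum_product, Finset.sum_product, hV, hH]
  ring

theorem budget_lt_gapWeight (hq : S.q ≠ 0) :
    S.rowWeight * (S.q * (7 * S.m + 1)) + S.q * S.period +
      S.q * (2 * S.period * (S.m + 1) + 2 * S.m) < S.gapWeight := by
  have hp := S.period_pos
  have hq : 1 ≤ S.q := Nat.pos_of_ne_zero hq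
  have h1 : S.q * S.period + S.q * (2 * S.period * (S.m + 1) + 2 * S.m) < S.rowWeight := by
    have : S.q * S.m ≤ S.q * S.m * S.period := Nat.le_mul_of_pos_right _ hp
    have : 1 ≤ S.q * S.period := Nat.mul_pos hq hp
    unfold rowWeight scale
    nlinarith
  have h2 : S.rowWeight * (S.q * (7 * S.m + 1)) + S.rowWeight ≤ S.gapWeight := by
    rw [gapWeight, mul_comm S.scale, ← Nat.mul_succ]
    refine Nat.mul_le_mul_left _ ?_
    unfold scale
    nlinarith [Nat.zero_le (S.q * S.m)]
  omega

theorem budget_lt_rowWeight (hq : S.q ≠ 0) :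
    S.q * S.period + S.q * (2 * S.period * (S.m + 1) + 2 * S.m) < S.rowWeight := by
  have hp := S.period_pos
  have hq : 1 ≤ S.q := Nat.pos_of_ne_zero hq
  have : S.q * S.m ≤ S.q * S.m * S.period := Nat.le_mul_of_pos_right _ hp
  have : 1 ≤ S.q * S.period := Nat.mul_pos hq hp
  unfold rowWeight scale
  nlinarith

end StripData
/-- The cost of one cell of a strip. -/
theorem cell_bound {p hin hA hB hC hout k1 k2 k3 k4 e : ℕ} {U2 U1 D2 D1 : Prop} {sat : ℕ → Prop}
    (hin1 : hin % 3 = 2) (hout1 : hout % 3 = 2)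
    (hpA : hA < p) (hpB : hB < p) (hpC : hC < p) (hpo : hout < p)
    (satA : hA % 3 = 2 → sat (hA / 3) ∧ 2 ≤ e) (satB : hB % 3 = 2 → sat (hB / 3))
    (satC : hC % 3 = 2 → sat (hC / 3))
    (a1 : 2 * hin ≤ k1 + 2 * hA) (a2 : 2 * hA ≤ k1 + 2 * hin)
    (b1 : 2 * hA ≤ k2 + 2 * hB) (b2 : 2 * hB ≤ k2 + 2 * hA)
    (c1 : 2 * hB ≤ k3 + 2 * hC) (c2 : 2 * hC ≤ k3 + 2 * hB)
    (d1 : 2 * hC ≤ k4 + 2 * hout) (d2 : 2 * hout ≤ k4 + 2 * hC)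
    (eU2 : U2 → 2 * p ≤ k1 + 2 * hin ∧ 2 * p ≤ k1 + 2 * hA)
    (eU1 : U1 → 2 * p ≤ k2 + 2 * hA ∧ 2 * p ≤ k2 + 2 * hB)
    (eD2 : D2 → 2 * hB ≤ k3 ∧ 2 * hC ≤ k3)
    (eD1 : D1 → 2 * hC ≤ k4 ∧ 2 * hout ≤ k4) (hU : U2 ∨ U1) (hD : D2 ∨ D1) :
    2 * p + 2 + hout ≤ k1 + k2 + k3 + k4 + e + hin ∧
      (k1 + k2 + k3 + k4 + e + hin = 2 * p + 2 + hout →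
        hin = hout ∧ (U1 → D2 → sat (hin / 3))) := by
  have hsat : sat (hin / 3) ∨ (hA ≠ hin ∧ hB ≠ hin ∧ hC ≠ hin) := by
    by_contra hn
    push Not at hn
    obtain ⟨h1, h2⟩ := hn
    by_cases hA' : hA = hin
    · exact h1 (hA' ▸ (satA (by omega)).1)
    · by_cases hB' : hB = hin
      · exact h1 (hB' ▸ satB (by omega))
      · have hC' := h2 hA' hB'
        exact h1 (hC' ▸ satC (by omega))
  have he : hA % 3 = 2 → 2 ≤ e := fun h => (satA h).2
  clear satA satB satC
  have cost : hA % 3 ≠ 2 ∨ 2 ≤ e := by omega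
  clear he
  rcases hU with hU | hU <;> rcases hD with hD | hD
  · obtain ⟨u1, u2⟩ := eU2 hU
    obtain ⟨v1, v2⟩ := eD2 hD
    have hmain : 2 * p + 2 + hout ≤ k1 + k2 + k3 + k4 + e + hin ∧
      (k1 + k2 + k3 + k4 + e + hin = 2 * p + 2 + hout → hin = hout) := by omega
    refine ⟨hmain.1, fun h => ⟨hmain.2 h, ?_⟩⟩
    intro h'
    have := eU1 h'
    omega
  · obtain ⟨u1, u2⟩ := eU2 hU
    obtain ⟨v1, v2⟩ := eD1 hD
    have hmain : 2 * p + 2 + hout ≤ k1 + k2 + k3 + k4 + e + hin ∧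
      (k1 + k2 + k3 + k4 + e + hin = 2 * p + 2 + hout → hin = hout) := by omega
    refine ⟨hmain.1, fun h => ⟨hmain.2 h, ?_⟩⟩
    intro h'
    have := eU1 h'
    omega
  · obtain ⟨u1, u2⟩ := eU1 hU
    obtain ⟨v1, v2⟩ := eD2 hD
    have hmain : 2 * p + 2 + hout ≤ k1 + k2 + k3 + k4 + e + hin ∧
      (k1 + k2 + k3 + k4 + e + hin = 2 * p + 2 + hout → hin = hout) := by omega
    refine ⟨hmain.1, fun h => ⟨hmain.2 h, ?_⟩⟩
    intro _ _
    refine hsat.resolve_right ?_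
    omega
  · obtain ⟨u1, u2⟩ := eU1 hU
    obtain ⟨v1, v2⟩ := eD1 hD
    have hmain : 2 * p + 2 + hout ≤ k1 + k2 + k3 + k4 + e + hin ∧
      (k1 + k2 + k3 + k4 + e + hin = 2 * p + 2 + hout → hin = hout) := by omega
    refine ⟨hmain.1, fun h => ⟨hmain.2 h, ?_⟩⟩
    intro _ h'
    have := eD2 h'
    omega


theorem Finset.sum_add_le_sum_of_mem {ι : Type*} {s : Finset ι} {f g : ι → ℕ} {δ : ℕ} {a : ι}
    (h : ∀ i ∈ s, g i ≤ f i) (ha : a ∈ s) (hδ : g a + δ ≤ f a) :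
    ∑ i ∈ s, g i + δ ≤ ∑ i ∈ s, f i := by
  classical
  rw [← Finset.add_sum_erase s f ha, ← Finset.add_sum_erase s g ha]
  have := Finset.sum_le_sum fun i (hi : i ∈ s.erase a) => h i (Finset.mem_of_mem_erase hi)
  omega

theorem Finset.sum_range_seven_mul_add_one {β : Type*} [AddCommMonoid β] (m : ℕ) (f : ℕ → β) :
    ∑ x ∈ Finset.range (7 * m + 1), f x =
      ∑ j ∈ Finset.range m, ∑ c ∈ Finset.range 7, f (7 * j + (c + 1)) + f 0 := by
  rw [Finset.sum_range_succ', mul_comm, Finset.sum_range_mul_eq]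
  simp only [mul_comm, add_assoc]

namespace StripData

variable {S : StripData} {F : Finset (Bool × ℕ × ℕ)}

/-- A set of edges within the budget that connects the terminals. -/
structure Solution (S : StripData) (F : Finset (Bool × ℕ × ℕ)) : Prop where
  valid : ∀ s ∈ F, S.grid.weight s ≠ 0
  cost : ∑ s ∈ F, S.grid.weight s ≤ S.budget
  conn : ∀ P : ℕ → ℕ → Prop, (∀ x y, (true, x, y) ∈ F → (P x y ↔ P x (y + 1))) →
    (∀ x y, (false, x, y) ∈ F → (P x y ↔ P (x + 1) y)) →
    ∀ x y x' y', x < 7 * S.m + 2 → y < S.q * S.period + 1 → S.term x y →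
      x' < 7 * S.m + 2 → y' < S.q * S.period + 1 → S.term x' y' → (P x y ↔ P x' y')

theorem contribution_of_mem {d : Bool} {x y : ℕ} (h : (d, x, y) ∈ F) :
    S.contribution F d x y = S.w d x y := if_pos h

/-- The weight of the used edges at a terminal in a gap row. -/
noncomputable def leafSum (S : StripData) (F : Finset (Bool × ℕ × ℕ)) (p : ℕ × ℕ × ℕ) : ℕ :=
  S.contribution F false (7 * p.1 + (2 * p.2.2 + 1)) (p.2.1 * S.period) +
    S.contribution F false (7 * p.1 + (2 * p.2.2 + 2)) (p.2.1 * S.period)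

/-- The number of terminals at a possible place for a terminal in a gap row. -/
def leafCount (S : StripData) (g t : ℕ) : ℕ :=
  if t = 0 then (if g = 0 then 0 else 1) else if t = 1 then 1 else if g = S.q then 0 else 1

theorem leafCount_le (g t : ℕ) : S.leafCount g t ≤ 1 := by
  unfold leafCount
  split_ifs <;> omega

/-- The index set of the possible places for terminals in gap rows. -/
def leafIndex (S : StripData) : Finset (ℕ × ℕ × ℕ) :=
  Finset.range S.m ×ˢ Finset.range (S.q + 1) ×ˢ Finset.range 3

theorem sum_leafCount :
    ∑ p ∈ S.leafIndex, S.gapWeight * S.leafCount p.2.1 p.2.2 =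
      S.gapWeight * (S.m * (3 * S.q + 1)) := by
  have h0 : ∑ g ∈ Finset.range (S.q + 1), (if g = 0 then 0 else 1) = S.q := by
    rw [Finset.sum_range_succ']
    simp
  have h2 : ∑ g ∈ Finset.range (S.q + 1), (if g = S.q then 0 else 1) = S.q := by
    rw [Finset.sum_range_succ, if_pos rfl, add_zero,
      Finset.sum_congr rfl fun g hg => if_neg (Finset.mem_range.1 hg).ne]
    simp
  rw [← Finset.mul_sum, leafIndex, Finset.sum_product]
  simp only [Finset.sum_product, Finset.sum_const, Finset.card_range]
  simp only [Finset.sum_range_succ (n := 2), Finset.sum_range_succ (n := 1),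
    Finset.sum_range_succ (n := 0), Finset.sum_range_zero, leafCount, if_true,
    Finset.sum_add_distrib, zero_add, one_ne_zero, OfNat.ofNat_ne_zero, if_false,
    OfNat.ofNat_ne_one, h0, h2, Finset.sum_const, Finset.card_range, smul_eq_mul, mul_one]
  ring

theorem sum_gap :
    ∑ x ∈ Finset.range (7 * S.m + 1), ∑ g ∈ Finset.range (S.q + 1),
      S.contribution F false x (g * S.period) = ∑ p ∈ S.leafIndex, S.leafSum F p := by
  have hzero : ∀ x, x < 7 * S.m + 1 → x % 7 = 0 → ∀ g ∈ Finset.range (S.q + 1),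
      S.contribution F false x (g * S.period) = 0 := by
    intro x hx h g hg
    refine Nat.eq_zero_of_le_zero ((contribution_le F false x _).trans ?_)
    rw [w_horizontal_gap hx (Finset.mem_range.1 hg), if_pos h]
  rw [Finset.sum_range_seven_mul_add_one, Finset.sum_eq_zero (hzero 0 (by omega) rfl), add_zero,
    leafIndex, Finset.sum_product]
  refine Finset.sum_congr rfl fun j hj => ?_
  rw [Finset.mem_range] at hj
  rw [Finset.sum_comm, Finset.sum_product]
  refine Finset.sum_congr rfl fun g hg => ?_
  have := hzero (7 * j + (6 + 1)) (by omega) (by omega) g hg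
  simp only [Finset.sum_range_succ, Finset.sum_range_zero, leafSum]
  rw [this]
  ring_nf

theorem period_mul_lt {g : ℕ} (hg : g < S.q + 1) : g * S.period < S.q * S.period + 1 :=
  Nat.lt_succ_of_le (Nat.mul_le_mul_right _ (by omega))

theorem term_zero (hm : S.m ≠ 0) : S.term 0 0 := ⟨hm, Or.inl ⟨rfl, Or.inl rfl⟩⟩

theorem term_leaf {j g t : ℕ} (hm : S.m ≠ 0) (ht : t < 3) (h : S.leafCount g t = 1) :
    S.term (7 * j + (2 * t + 2)) (g * S.period) := by
  have hp := S.period_pos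
  refine ⟨hm, Or.inr ⟨Nat.mul_mod_left _ _, ?_⟩⟩
  unfold leafCount at h
  split_ifs at h with h1 h2 h3 h4
  · subst h1
    exact Or.inr (Or.inl ⟨by omega, Nat.mul_ne_zero h2 hp.ne'⟩)
  · subst h3
    exact Or.inr (Or.inr (Or.inl (by omega)))
  · have : t = 2 := by omega
    subst this
    refine Or.inr (Or.inr (Or.inr ⟨by omega, fun h5 => h4 (Nat.eq_of_mul_eq_mul_right hp h5)⟩))

theorem leaf_mod (j : ℕ) {t : ℕ} (ht : t < 3) : (7 * j + (2 * t + 2)) % 7 = 2 ∨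
    (7 * j + (2 * t + 2)) % 7 = 4 ∨ (7 * j + (2 * t + 2)) % 7 = 6 := by
  interval_cases t <;> omega

namespace Solution

variable (hS : S.Solution F)
include hS

theorem eq_of_vertical {x y : ℕ} (h : (true, x, y) ∈ F) :
    x < 7 * S.m + 2 ∧ ∃ i r, i < S.q ∧ r < S.period ∧ y = i * S.period + r ∧ S.vert x r ≠ 0 := by
  have hw : S.w true x y ≠ 0 := hS.valid _ h
  have h1 := S.of_w_vertical hw
  have hr := Nat.mod_lt y S.period_pos
  have hi : y / S.period < S.q := by
    rw [Nat.div_lt_iff_lt_mul S.period_pos]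
    exact h1.2
  have hy : y = y / S.period * S.period + y % S.period := by
    rw [mul_comm, Nat.div_add_mod]
  refine ⟨h1.1, _, _, hi, hr, hy, ?_⟩
  rw [← w_vertical_strip h1.1 hi hr, ← hy]
  exact hw

theorem eq_of_horizontal {x y : ℕ} (h : (false, x, y) ∈ F) :
    x < 7 * S.m + 1 ∧ ((∃ g, g < S.q + 1 ∧ y = g * S.period ∧ x % 7 ≠ 0) ∨
      ∃ i r, i < S.q ∧ 0 < r ∧ r < S.period ∧ y = i * S.period + r ∧ S.horiz x i r ≠ 0) := by
  have hw : S.w false x y ≠ 0 := hS.valid _ h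
  have h1 := S.of_w_horizontal hw
  have hr := Nat.mod_lt y S.period_pos
  have hy : y = y / S.period * S.period + y % S.period := by
    rw [mul_comm, Nat.div_add_mod]
  refine ⟨h1.1, ?_⟩
  rcases Nat.eq_zero_or_pos (y % S.period) with h0 | h0
  · left
    have hg : y / S.period < S.q + 1 := by
      rw [Nat.div_lt_iff_lt_mul S.period_pos, add_mul]
      have := S.period_pos
      omega
    rw [h0, add_zero] at hy
    refine ⟨_, hg, hy, fun h7 => hw ?_⟩
    rw [hy, w_horizontal_gap h1.1 hg, if_pos h7]
  · right
    have hi : y / S.period < S.q := by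
      rw [Nat.div_lt_iff_lt_mul S.period_pos]
      have h3 := h1.2
      rcases Nat.lt_or_ge y (S.q * S.period) with h2 | h2
      · exact h2
      · exfalso
        have h4 : y = S.q * S.period := by omega
        rw [h4, Nat.mul_mod_left] at h0
        omega
    refine ⟨_, _, hi, h0, hr, hy, ?_⟩
    rw [← w_horizontal_strip h1.1 hi hr, ← hy]
    exact hw

theorem leaf_edge {j g t : ℕ} (hm : S.m ≠ 0) (hj : j < S.m) (hg : g < S.q + 1) (ht : t < 3)
    (h : S.leafCount g t = 1) :
    (false, 7 * j + (2 * t + 1), g * S.period) ∈ F ∨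
      (false, 7 * j + (2 * t + 2), g * S.period) ∈ F := by
  by_contra hn
  push Not at hn
  have := hS.conn (fun x y => x = 7 * j + (2 * t + 2) ∧ y = g * S.period) ?_ ?_ 0 0
    (7 * j + (2 * t + 2)) (g * S.period) (by omega) (by omega) (term_zero hm) (by omega)
    (period_mul_lt hg) (term_leaf hm ht h)
  · simp at this
  · intro x y hxy
    obtain ⟨_, i, r, _, _, _, hv⟩ := hS.eq_of_vertical hxy
    have : x ≠ 7 * j + (2 * t + 2) := by
      intro hx
      apply hv
      unfold vert
      rw [if_neg (by omega), if_neg (by omega), if_neg (by omega)]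
    tauto
  · intro x y hxy
    constructor
    · rintro ⟨rfl, rfl⟩
      exact absurd hxy hn.2
    · rintro ⟨hx, rfl⟩
      obtain rfl : x = 7 * j + (2 * t + 1) := by omega
      exact absurd hxy hn.1

theorem le_leafSum (hm : S.m ≠ 0) : ∀ p ∈ S.leafIndex,
    S.gapWeight * S.leafCount p.2.1 p.2.2 ≤ S.leafSum F p := by
  rintro ⟨j, g, t⟩ hp
  simp only [leafIndex, Finset.mem_product, Finset.mem_range] at hp
  obtain ⟨hj, hg, ht⟩ := hp
  rcases Nat.le_one_iff_eq_zero_or_eq_one.1 (S.leafCount_le g t) with h | h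
  · simp [h]
  · simp only [h, mul_one, leafSum]
    rcases hS.leaf_edge hm hj hg ht h with he | he
    · rw [contribution_of_mem he, w_horizontal_gap (by omega) hg, if_neg (by omega)]
      omega
    · rw [contribution_of_mem he, w_horizontal_gap (by omega) hg, if_neg (by omega)]
      omega

theorem not_both {j g t : ℕ} (hq : S.q ≠ 0) (hm : S.m ≠ 0) (hj : j < S.m) (hg : g < S.q + 1)
    (ht : t < 3) : ¬ ((false, 7 * j + (2 * t + 1), g * S.period) ∈ F ∧
      (false, 7 * j + (2 * t + 2), g * S.period) ∈ F) := by
  rintro ⟨h1, h2⟩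
  have hmem : (j, g, t) ∈ S.leafIndex := by
    simp only [leafIndex, Finset.mem_product, Finset.mem_range]
    exact ⟨hj, hg, ht⟩
  have hle := Finset.sum_add_le_sum_of_mem (δ := S.gapWeight) (hS.le_leafSum hm) hmem (by
    have := S.leafCount_le g t
    have := Nat.mul_le_mul_left S.gapWeight this
    simp only [leafSum]
    rw [contribution_of_mem h1, contribution_of_mem h2, w_horizontal_gap (by omega) hg,
      w_horizontal_gap (by omega) hg, if_neg (by omega), if_neg (by omega)]
    omega)
  rw [sum_leafCount, ← sum_gap] at hle
  have h3 := hS.cost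
  rw [sum_eq hS.valid] at h3
  have h4 := S.budget_lt_gapWeight hq
  unfold budget at h3
  omega

end Solution

/-- The edges outside the gap rows respect the cut `P`. -/
def Respects (S : StripData) (F : Finset (Bool × ℕ × ℕ)) (P : ℕ → ℕ → Prop) : Prop :=
  (∀ x y, (true, x, y) ∈ F → (P x y ↔ P x (y + 1))) ∧
    ∀ x i r, x < 7 * S.m + 1 → i < S.q → 0 < r → r < S.period →
      (false, x, i * S.period + r) ∈ F → (P x (i * S.period + r) ↔ P (x + 1) (i * S.period + r))

/-- The grid point `(x, y)` is connected with the origin outside the gap rows. -/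
def Linked (S : StripData) (F : Finset (Bool × ℕ × ℕ)) (x y : ℕ) : Prop :=
  ∀ P, S.Respects F P → (P x y ↔ P 0 0)

namespace Solution

variable (hS : S.Solution F)
include hS

theorem exists_extension (hq : S.q ≠ 0) (hm : S.m ≠ 0) {P : ℕ → ℕ → Prop} (hP : S.Respects F P) :
    ∃ P' : ℕ → ℕ → Prop,
      (∀ x y, (y % S.period = 0 → x % 7 = 0 ∨ x % 7 = 1 ∨ x % 7 = 3 ∨ x % 7 = 5) →
        (P' x y ↔ P x y)) ∧
      (∀ x y, y % S.period = 0 → x % 7 = 2 ∨ x % 7 = 4 ∨ x % 7 = 6 →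
        ((false, x - 1, y) ∈ F → (P' x y ↔ P (x - 1) y)) ∧
        ((false, x - 1, y) ∉ F → (P' x y ↔ P (x + 1) y))) ∧
      ∀ x y x' y', x < 7 * S.m + 2 → y < S.q * S.period + 1 → S.term x y →
        x' < 7 * S.m + 2 → y' < S.q * S.period + 1 → S.term x' y' → (P' x y ↔ P' x' y') := by
  classical
  obtain ⟨P', hP'⟩ : ∃ P' : ℕ → ℕ → Prop, ∀ x y, P' x y =
      if y % S.period = 0 ∧ (x % 7 = 2 ∨ x % 7 = 4 ∨ x % 7 = 6) then
        (if (false, x - 1, y) ∈ F then P (x - 1) y else P (x + 1) y) else P x y :=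
    ⟨_, fun _ _ => rfl⟩
  have h1 : ∀ x y, (y % S.period = 0 → x % 7 = 0 ∨ x % 7 = 1 ∨ x % 7 = 3 ∨ x % 7 = 5) →
      (P' x y ↔ P x y) := by
    intro x y h
    rw [hP', if_neg (by omega)]
  have h2 : ∀ x y, y % S.period = 0 → x % 7 = 2 ∨ x % 7 = 4 ∨ x % 7 = 6 →
      ((false, x - 1, y) ∈ F → (P' x y ↔ P (x - 1) y)) ∧
      ((false, x - 1, y) ∉ F → (P' x y ↔ P (x + 1) y)) := by
    intro x y hy hx
    rw [hP', if_pos ⟨hy, hx⟩]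
    exact ⟨fun h => by rw [if_pos h], fun h => by rw [if_neg h]⟩
  refine ⟨P', h1, h2, hS.conn P' ?_ ?_⟩
  · intro x y hxy
    obtain ⟨_, i, r, _, _, _, hv⟩ := hS.eq_of_vertical hxy
    have : x % 7 = 0 ∨ x % 7 = 1 ∨ x % 7 = 3 ∨ x % 7 = 5 := by
      unfold vert at hv
      split_ifs at hv <;> omega
    rw [h1 _ _ fun _ => this, h1 _ _ fun _ => this]
    exact hP.1 x y hxy
  · intro x y hxy
    obtain ⟨hx, ⟨g, hg, rfl, h7⟩ | ⟨i, r, hi, h0, hr, rfl, hv⟩⟩ := hS.eq_of_horizontal hxy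
    · have hmod : g * S.period % S.period = 0 := Nat.mul_mod_left _ _
      by_cases hodd : x % 7 = 1 ∨ x % 7 = 3 ∨ x % 7 = 5
      · rw [h1 x _ (by omega)]
        have := (h2 (x + 1) _ hmod (by omega)).1
        rw [Nat.add_sub_cancel] at this
        exact (this hxy).symm
      · rw [h1 (x + 1) _ (by omega)]
        refine (h2 x _ hmod (by omega)).2 fun h => ?_
        refine hS.not_both (j := x / 7) (t := (x % 7 - 2) / 2) hq hm (by omega) hg (by omega) ⟨?_, ?_⟩
        · rwa [show 7 * (x / 7) + (2 * ((x % 7 - 2) / 2) + 1) = x - 1 by omega]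
        · rwa [show 7 * (x / 7) + (2 * ((x % 7 - 2) / 2) + 2) = x by omega]
    · have hmod := mod_add (S := S) (i := i) hr
      rw [h1 _ _ (by omega), h1 _ _ (by omega)]
      exact hP.2 x i r hx hi h0 hr hxy

theorem linked_of_term (hq : S.q ≠ 0) (hm : S.m ≠ 0) {x y : ℕ} (hx : x < 7 * S.m + 2)
    (hy : y < S.q * S.period + 1) (h7 : x % 7 = 0 ∨ x % 7 = 1) (h : S.term x y) :
    S.Linked F x y := by
  intro P hP
  obtain ⟨P', h1, -, h3⟩ := hS.exists_extension hq hm hP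
  rw [← h1 x y (by omega), ← h1 0 0 (by simp)]
  exact h3 x y 0 0 hx hy h (by omega) (by omega) (term_zero hm)

theorem linked_leaf (hq : S.q ≠ 0) (hm : S.m ≠ 0) {j g t : ℕ} (hj : j < S.m) (hg : g < S.q + 1)
    (ht : t < 3) (h : S.leafCount g t = 1) :
    S.Linked F (7 * j + (2 * t + 1)) (g * S.period) ∨
      S.Linked F (7 * j + (2 * t + 3)) (g * S.period) := by
  have hmod : g * S.period % S.period = 0 := Nat.mul_mod_left _ _
  by_cases hmem : (false, 7 * j + (2 * t + 2) - 1, g * S.period) ∈ F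
  · left
    intro P hP
    obtain ⟨P', h1, h2, h3⟩ := hS.exists_extension hq hm hP
    have := (h2 (7 * j + (2 * t + 2)) _ hmod (leaf_mod j ht)).1 hmem
    rw [show 7 * j + (2 * t + 1) = 7 * j + (2 * t + 2) - 1 by omega, ← this, ← h1 0 0 (by simp)]
    exact h3 _ _ 0 0 (by omega) (period_mul_lt hg) (term_leaf hm ht h) (by omega) (by omega)
      (term_zero hm)
  · right
    intro P hP
    obtain ⟨P', h1, h2, h3⟩ := hS.exists_extension hq hm hP
    have := (h2 (7 * j + (2 * t + 2)) _ hmod (leaf_mod j ht)).2 hmem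
    rw [show 7 * j + (2 * t + 3) = 7 * j + (2 * t + 2) + 1 by omega, ← this, ← h1 0 0 (by simp)]
    exact h3 _ _ 0 0 (by omega) (period_mul_lt hg) (term_leaf hm ht h) (by omega) (by omega)
      (term_zero hm)

end Solution

end StripData


namespace StripData

variable {S : StripData} {F : Finset (Bool × ℕ × ℕ)}

/-- The strip to which a grid point belongs; the columns `1` and `3` modulo `7` belong to the strip
below a gap row, the others to the strip above it. -/
def stripIndex (S : StripData) (x y : ℕ) : ℕ :=
  (y - if x % 7 = 1 ∨ x % 7 = 3 then 1 else 0) / S.period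

theorem stripIndex_mid {x i r : ℕ} (h0 : 0 < r) (hr : r < S.period) :
    S.stripIndex x (i * S.period + r) = i := by
  unfold stripIndex
  split_ifs
  · rw [Nat.add_sub_assoc h0]
    exact div_add (by omega)
  · exact div_add hr

theorem stripIndex_top {x i : ℕ} (h : x % 7 = 1 ∨ x % 7 = 3) :
    S.stripIndex x ((i + 1) * S.period) = i := by
  have := S.period_pos
  unfold stripIndex
  rw [if_pos h, add_mul, one_mul, Nat.add_sub_assoc (by omega)]
  exact div_add (by omega)

theorem stripIndex_bottom {x i : ℕ} (h : x % 7 = 5 ∨ x % 7 = 0) :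
    S.stripIndex x (i * S.period) = i := by
  unfold stripIndex
  rw [if_neg (by omega)]
  exact Nat.mul_div_cancel _ S.period_pos

theorem stripIndex_vertical {x i r : ℕ} (hx : x ≠ 0) (hr : r < S.period) (hv : S.vert x r ≠ 0) :
    S.stripIndex x (i * S.period + r) = i ∧ S.stripIndex x (i * S.period + r + 1) = i := by
  have h : (x % 7 = 1 ∨ x % 7 = 3) ∧ r ≠ 0 ∨ (x % 7 = 5 ∨ x % 7 = 0) ∧ r + 1 ≠ S.period := by
    unfold vert at hv
    rw [if_neg hx] at hv
    split_ifs at hv <;> tauto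
  rcases h with ⟨h1, h2⟩ | ⟨h1, h2⟩
  · refine ⟨stripIndex_mid (by omega) hr, ?_⟩
    rcases Nat.lt_or_ge (r + 1) S.period with h | h
    · exact stripIndex_mid (r := r + 1) (by omega) h
    · rw [show i * S.period + r + 1 = (i + 1) * S.period by rw [add_mul]; omega]
      exact stripIndex_top h1
  · refine ⟨?_, stripIndex_mid (r := r + 1) (by omega) (by omega)⟩
    rcases Nat.eq_zero_or_pos r with rfl | h
    · exact stripIndex_bottom h1
    · exact stripIndex_mid h hr

theorem rowWeight_le_horiz {x i r : ℕ} (h0 : 0 < r) (h : S.horiz x i r ≠ 0) :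
    S.rowWeight ≤ S.horiz x i r := by
  unfold horiz at *
  rw [if_neg h0.ne'] at *
  split_ifs at * <;> omega

/-- The numbers `h i x` are the heights at which the rows of the strip `i` are used right of the
column `x`. -/
def IsRow (S : StripData) (F : Finset (Bool × ℕ × ℕ)) (h : ℕ → ℕ → ℕ) : Prop :=
  ∀ i x, i < S.q → x < 7 * S.m + 1 → 0 < h i x ∧ h i x < S.period ∧
    (false, x, i * S.period + h i x) ∈ F ∧
    ∀ r, 0 < r → r < S.period → (false, x, i * S.period + r) ∈ F → r = h i x

theorem term_right {i : ℕ} (hm : S.m ≠ 0) : S.term (7 * S.m + 1) ((i + 1) * S.period) :=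
  ⟨hm, Or.inr ⟨Nat.mul_mod_left _ _, Or.inl ⟨rfl, Nat.mul_ne_zero (by omega) S.period_pos.ne'⟩⟩⟩

theorem term_top (hm : S.m ≠ 0) : S.term 0 (S.q * S.period) := ⟨hm, Or.inl ⟨rfl, Or.inr rfl⟩⟩

theorem contribution_row {i x r : ℕ} (hi : i < S.q) (hx : x < 7 * S.m + 1) (hr : r < S.period)
    (h : (false, x, i * S.period + r) ∈ F) :
    S.contribution F false x (i * S.period + r) = S.horiz x i r := by
  rw [contribution_of_mem h, w_horizontal_strip hx hi hr]

theorem horiz_le_slabSum {i x r : ℕ} (hi : i < S.q) (hx : x < 7 * S.m + 1) (h0 : 0 < r)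
    (hr : r < S.period) (h : (false, x, i * S.period + r) ∈ F) :
    S.horiz x i r ≤ S.slabSum F i x := by
  rw [← contribution_row hi hx hr h]
  have := Finset.single_le_sum (s := Finset.range (3 * S.M))
    (f := fun r => S.contribution F false x (i * S.period + (r + 1))) (fun _ _ => Nat.zero_le _)
    (Finset.mem_range.2 (show r - 1 < 3 * S.M by unfold period at hr; omega))
  simpa only [slabSum, Nat.sub_add_cancel h0] using this

namespace Solution

variable (hS : S.Solution F)
include hS

theorem respects_of {Z : ℕ → Prop} {T : ℕ → ℕ → ℕ → Prop}
    (hZ : ∀ y, (true, 0, y) ∈ F → (Z y ↔ Z (y + 1)))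
    (hV : ∀ i x r, i < S.q → r < S.period → x ≠ 0 → (true, x, i * S.period + r) ∈ F →
      (T i x (i * S.period + r) ↔ T i x (i * S.period + r + 1)))
    (h0 : ∀ i r, i < S.q → 0 < r → r < S.period → (false, 0, i * S.period + r) ∈ F →
      (Z (i * S.period + r) ↔ T i 1 (i * S.period + r)))
    (hH : ∀ i x r, i < S.q → 0 < r → r < S.period → x ≠ 0 → x < 7 * S.m + 1 →
      (false, x, i * S.period + r) ∈ F →
      (T i x (i * S.period + r) ↔ T i (x + 1) (i * S.period + r))) :
    S.Respects F fun x y => if x = 0 then Z y else T (S.stripIndex x y) x y := by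
  refine ⟨fun x y hxy => ?_, fun x i r hx hi h0r hr hxy => ?_⟩
  · rcases eq_or_ne x 0 with rfl | hx
    · simpa using hZ y hxy
    · obtain ⟨_, i, r, hi, hr, rfl, hv⟩ := hS.eq_of_vertical hxy
      obtain ⟨e1, e2⟩ := S.stripIndex_vertical (i := i) hx hr hv
      simpa only [if_neg hx, e1, e2] using hV i x r hi hr hx hxy
  · rcases eq_or_ne x 0 with rfl | hx0
    · simpa [stripIndex_mid h0r hr] using h0 i r hi h0r hr hxy
    · simpa [hx0, stripIndex_mid h0r hr] using hH i x r hi h0r hr hx0 hx hxy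

theorem linked_right (hq : S.q ≠ 0) (hm : S.m ≠ 0) {i : ℕ} (hi : i < S.q) :
    S.Linked F (7 * S.m + 1) ((i + 1) * S.period) :=
  hS.linked_of_term hq hm (by omega) (period_mul_lt (by omega)) (by omega) (term_right hm)

theorem exists_row (hq : S.q ≠ 0) (hm : S.m ≠ 0) {i x : ℕ} (hi : i < S.q) (hx : x < 7 * S.m + 1) :
    ∃ r, 0 < r ∧ r < S.period ∧ (false, x, i * S.period + r) ∈ F := by
  by_contra hn
  push Not at hn
  have hR := hS.respects_of (Z := fun _ => False) (T := fun i' x' _ => i' = i ∧ x < x')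
    (by simp) (by simp)
    (by
      intro i' r _ h0 hr hmem
      refine iff_of_false id ?_
      rintro ⟨rfl, h⟩
      obtain rfl : x = 0 := by omega
      exact hn r h0 hr hmem)
    (by
      intro i' x' r _ h0 hr _ _ hmem
      by_cases hc : i' = i ∧ x = x'
      · obtain ⟨rfl, rfl⟩ := hc
        exact absurd hmem (hn r h0 hr)
      · constructor <;> rintro ⟨rfl, h⟩ <;> exact ⟨rfl, by omega⟩)
  have := hS.linked_right hq hm hi _ hR
  simp [stripIndex_top (S := S) (x := 7 * S.m + 1) (i := i) (by omega)] at this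
  omega

theorem horiz_ne_zero {i x r : ℕ} (hi : i < S.q) (hr : r < S.period)
    (h : (false, x, i * S.period + r) ∈ F) : S.horiz x i r ≠ 0 := by
  have hw : S.w false x (i * S.period + r) ≠ 0 := hS.valid _ h
  rwa [w_horizontal_strip (S.of_w_horizontal hw).1 hi hr] at hw

theorem rowWeight_le_slabSum (hq : S.q ≠ 0) (hm : S.m ≠ 0) {i x : ℕ} (hi : i < S.q)
    (hx : x < 7 * S.m + 1) : S.rowWeight ≤ S.slabSum F i x := by
  obtain ⟨r, h0, hr, h⟩ := hS.exists_row hq hm hi hx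
  exact (S.rowWeight_le_horiz h0 (hS.horiz_ne_zero hi hr h)).trans
    (horiz_le_slabSum hi hx h0 hr h)

theorem le_gapSum (hm : S.m ≠ 0) : S.gapWeight * (S.m * (3 * S.q + 1)) ≤
    ∑ x ∈ Finset.range (7 * S.m + 1), ∑ g ∈ Finset.range (S.q + 1),
      S.contribution F false x (g * S.period) := by
  rw [sum_gap, ← sum_leafCount]
  exact Finset.sum_le_sum (hS.le_leafSum hm)

theorem row_unique (hq : S.q ≠ 0) (hm : S.m ≠ 0) {i x r r' : ℕ} (hi : i < S.q)
    (hx : x < 7 * S.m + 1) (h0 : 0 < r) (hr : r < S.period) (h0' : 0 < r') (hr' : r' < S.period)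
    (h : (false, x, i * S.period + r) ∈ F) (h' : (false, x, i * S.period + r') ∈ F) : r = r' := by
  by_contra hne
  have h2 : S.rowWeight + S.rowWeight ≤ S.slabSum F i x := by
    have e1 := S.rowWeight_le_horiz h0 (hS.horiz_ne_zero hi hr h)
    have e2 := S.rowWeight_le_horiz h0' (hS.horiz_ne_zero hi hr' h')
    rw [← contribution_row hi hx hr h] at e1
    rw [← contribution_row hi hx hr' h'] at e2
    refine (add_le_add e1 e2).trans ?_
    have hsub : ({r - 1, r' - 1} : Finset ℕ) ⊆ Finset.range (3 * S.M) := by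
      intro a ha
      simp only [Finset.mem_insert, Finset.mem_singleton] at ha
      rw [Finset.mem_range]
      unfold period at hr hr'
      omega
    have := Finset.sum_le_sum_of_subset
      (f := fun r => S.contribution F false x (i * S.period + (r + 1))) hsub
    rw [Finset.sum_pair (by omega)] at this
    simpa only [slabSum, Nat.sub_add_cancel h0, Nat.sub_add_cancel h0'] using this
  have hle := Finset.sum_add_le_sum_of_mem (s := Finset.range S.q ×ˢ Finset.range (7 * S.m + 1))
    (g := fun _ => S.rowWeight) (f := fun p => S.slabSum F p.1 p.2) (δ := S.rowWeight) (a := (i, x))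
    (by
      rintro ⟨i', x'⟩ hp
      simp only [Finset.mem_product, Finset.mem_range] at hp
      exact hS.rowWeight_le_slabSum hq hm hp.1 hp.2)
    (by simp only [Finset.mem_product, Finset.mem_range]; exact ⟨hi, hx⟩) h2
  rw [Finset.sum_const, Finset.card_product, Finset.card_range, Finset.card_range, smul_eq_mul,
    mul_comm _ S.rowWeight, Finset.sum_product] at hle
  dsimp only at hle
  have h3 := hS.cost
  rw [sum_eq hS.valid] at h3
  have h4 := S.budget_lt_rowWeight hq
  have h5 := hS.le_gapSum hm
  unfold budget at h3
  omega

theorem exists_isRow (hq : S.q ≠ 0) (hm : S.m ≠ 0) : ∃ h, S.IsRow F h := by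
  classical
  refine ⟨fun i x => if hx : i < S.q ∧ x < 7 * S.m + 1 then
    (hS.exists_row hq hm hx.1 hx.2).choose else 0, fun i x hi hx => ?_⟩
  simp only [hi, hx, and_self, dif_pos]
  obtain ⟨h1, h2, h3⟩ := (hS.exists_row hq hm hi hx).choose_spec
  exact ⟨h1, h2, h3, fun r h0 hr hmem => hS.row_unique hq hm hi hx h0 hr h1 h2 hmem h3⟩

theorem vert_eq_two {x i r : ℕ} (hx : x ≠ 0) (hi : i < S.q) (hr : r < S.period)
    (hmem : (true, x, i * S.period + r) ∈ F) : S.contribution F true x (i * S.period + r) = 2 := by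
  have hw : S.w true x (i * S.period + r) ≠ 0 := hS.valid _ hmem
  have hx' := (S.of_w_vertical hw).1
  rw [contribution_of_mem hmem]
  rw [w_vertical_strip hx' hi hr] at hw ⊢
  unfold vert at *
  split_ifs at * <;> simp_all

theorem le_columnSum {x i a b : ℕ} (hx : x ≠ 0) (hi : i < S.q) (hb : b ≤ S.period)
    (hmem : ∀ r, a ≤ r → r < b → (true, x, i * S.period + r) ∈ F) :
    2 * b ≤ S.columnSum F i x + 2 * a := by
  have hsub : Finset.Ico a b ⊆ Finset.range S.period := by
    intro r hr
    rw [Finset.mem_Ico] at hr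
    rw [Finset.mem_range]
    omega
  have h1 := Finset.sum_le_sum_of_subset
    (f := fun r => S.contribution F true x (i * S.period + r)) hsub
  have h2 : ∑ r ∈ Finset.Ico a b, S.contribution F true x (i * S.period + r) =
      ∑ r ∈ Finset.Ico a b, 2 := by
    refine Finset.sum_congr rfl fun r hr => ?_
    rw [Finset.mem_Ico] at hr
    exact hS.vert_eq_two hx hi (by omega) (hmem r hr.1 hr.2)
  rw [h2, Finset.sum_const, Nat.card_Ico, smul_eq_mul] at h1
  unfold columnSum
  omega

variable {h : ℕ → ℕ → ℕ} (hh : S.IsRow F h)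
include hh

/-- A missing vertical edge separates its column, and everything that is connected lies on one
side. -/
theorem column_cut {i x r : ℕ} (hi : i < S.q) (hr : r < S.period)
    (hmem : (true, x + 1, i * S.period + r) ∉ F) {x' y' : ℕ} (hx' : x < x')
    (hidx : S.stripIndex x' y' = i) (hlink : S.Linked F x' y') :
    (if x' = x + 1 then y' ≤ i * S.period + r else h i (x + 1) ≤ r) ↔ h i x ≤ r := by
  have hR := hS.respects_of (Z := fun _ => h i x ≤ r)
    (T := fun i' x' y' => if i' = i ∧ x < x' then
      (if x' = x + 1 then y' ≤ i * S.period + r else h i (x + 1) ≤ r) else h i x ≤ r)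
    (fun _ _ => Iff.rfl)
    (by
      intro i' x' r' _ hr' _ hmem'
      by_cases hc : i' = i ∧ x < x'
      · rw [if_pos hc, if_pos hc]
        split_ifs with hx
        · have : r' ≠ r := by
            rintro rfl
            rw [hc.1, hx] at hmem'
            exact hmem hmem'
          rw [hc.1]
          omega
        · rfl
      · rw [if_neg hc, if_neg hc])
    (by
      intro i' r' hi' h0 hr' hmem'
      split_ifs with hc h1
      · obtain ⟨rfl, hx⟩ := hc
        obtain rfl : x = 0 := by omega
        rw [(hh i' 0 hi' (by omega)).2.2.2 r' h0 hr' hmem']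
        omega
      · omega
      · rfl)
    (by
      intro i' x' r' hi' h0 hr' hx0 hx' hmem'
      by_cases hc : i' = i
      · subst hc
        have hrow := (hh i' x' hi' hx').2.2.2 r' h0 hr' hmem'
        rcases lt_trichotomy x x' with hlt | heq | hgt
        · simp only [hlt, show x < x' + 1 by omega, show x' + 1 ≠ x + 1 by omega, and_self, if_true,
            if_false]
          split_ifs with h1
          · subst h1
            rw [hrow]
            omega
          · rfl
        · subst heq
          rw [if_neg (by omega), if_pos ⟨rfl, by omega⟩, if_pos rfl, hrow]
          omega
        · rw [if_neg (by omega), if_neg (by omega)]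
      · rw [if_neg (by omega), if_neg (by omega)])
  have := hlink _ hR
  rwa [if_neg (by omega), if_pos rfl, hidx, if_pos ⟨rfl, hx'⟩] at this

theorem cut_right (hq : S.q ≠ 0) (hm : S.m ≠ 0) {i x r : ℕ} (hi : i < S.q)
    (hx : x + 1 < 7 * S.m + 1) (hr : r < S.period)
    (hmem : (true, x + 1, i * S.period + r) ∉ F) : h i (x + 1) ≤ r ↔ h i x ≤ r := by
  have := hS.column_cut hh hi hr hmem (x' := 7 * S.m + 1) (by omega)
    (stripIndex_top (by omega)) (hS.linked_right hq hm hi)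
  rwa [if_neg (by omega)] at this

theorem cut_top {i x r : ℕ} (hi : i < S.q) (hr : r < S.period)
    (hmem : (true, x + 1, i * S.period + r) ∉ F) (hc : (x + 1) % 7 = 1 ∨ (x + 1) % 7 = 3)
    (hlink : S.Linked F (x + 1) ((i + 1) * S.period)) : r < h i x := by
  have := hS.column_cut hh hi hr hmem (by omega) (stripIndex_top hc) hlink
  rw [if_pos rfl, add_mul] at this
  omega

theorem cut_bottom {i x r : ℕ} (hi : i < S.q) (hr : r < S.period)
    (hmem : (true, x + 1, i * S.period + r) ∉ F) (hc : (x + 1) % 7 = 5 ∨ (x + 1) % 7 = 0)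
    (hlink : S.Linked F (x + 1) (i * S.period)) : h i x ≤ r := by
  have := hS.column_cut hh hi hr hmem (by omega) (stripIndex_bottom hc) hlink
  rw [if_pos rfl] at this
  omega

theorem columnSum_move (hq : S.q ≠ 0) (hm : S.m ≠ 0) {i x : ℕ} (hi : i < S.q)
    (hx : x + 1 < 7 * S.m + 1) :
    2 * h i x ≤ S.columnSum F i (x + 1) + 2 * h i (x + 1) ∧
      2 * h i (x + 1) ≤ S.columnSum F i (x + 1) + 2 * h i x := by
  have b1 := (hh i x hi (by omega)).2.1
  have b2 := (hh i (x + 1) hi hx).2.1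
  constructor <;>
  · refine hS.le_columnSum (by omega) hi (by omega) fun r h1 h2 => ?_
    by_contra hn
    have := hS.cut_right hh hq hm hi hx (by omega) hn
    omega

theorem columnSum_top (hq : S.q ≠ 0) (hm : S.m ≠ 0) {i x : ℕ} (hi : i < S.q)
    (hc : (x + 1) % 7 = 1 ∨ (x + 1) % 7 = 3)
    (hlink : S.Linked F (x + 1) ((i + 1) * S.period)) :
    2 * S.period ≤ S.columnSum F i (x + 1) + 2 * h i x ∧
      (x + 1 < 7 * S.m + 1 → 2 * S.period ≤ S.columnSum F i (x + 1) + 2 * h i (x + 1)) := by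
  refine ⟨?_, fun hx => ?_⟩ <;>
  · refine hS.le_columnSum (by omega) hi le_rfl fun r h1 h2 => ?_
    by_contra hn
    have := hS.cut_top hh hi h2 hn hc hlink
    try have := hS.cut_right hh hq hm hi hx h2 hn
    omega

theorem columnSum_bottom (hq : S.q ≠ 0) (hm : S.m ≠ 0) {i x : ℕ} (hi : i < S.q)
    (hx : x + 1 < 7 * S.m + 1) (hc : (x + 1) % 7 = 5 ∨ (x + 1) % 7 = 0)
    (hlink : S.Linked F (x + 1) (i * S.period)) :
    2 * h i x ≤ S.columnSum F i (x + 1) ∧ 2 * h i (x + 1) ≤ S.columnSum F i (x + 1) := by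
  have b1 := (hh i x hi (by omega)).2.1
  have b2 := (hh i (x + 1) hi hx).2.1
  have key : ∀ b ≤ S.period, b ≤ h i x ∨ b ≤ h i (x + 1) → 2 * b ≤ S.columnSum F i (x + 1) := by
    intro b hb hle
    have := hS.le_columnSum (a := 0) (x := x + 1) (by omega) hi hb fun r h1 h2 => by
      by_contra hn
      have := hS.cut_bottom hh hi (by omega) hn hc hlink
      have := hS.cut_right hh hq hm hi hx (by omega) hn
      omega
    omega
  exact ⟨key _ b1.le (Or.inl le_rfl), key _ b2.le (Or.inr le_rfl)⟩

theorem row_eq (hq : S.q ≠ 0) (hm : S.m ≠ 0) {i x : ℕ} (hi : i < S.q) (hx : x + 1 < 7 * S.m + 1)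
    (hc : (x + 1) % 7 = 2 ∨ (x + 1) % 7 = 4 ∨ (x + 1) % 7 = 6) : h i (x + 1) = h i x := by
  have hn : ∀ r, r < S.period → (true, x + 1, i * S.period + r) ∉ F := by
    intro r hr hmem
    have hw : S.w true (x + 1) (i * S.period + r) ≠ 0 := hS.valid _ hmem
    rw [w_vertical_strip (by omega) hi hr] at hw
    unfold vert at hw
    rw [if_neg (by omega), if_neg (by omega), if_neg (by omega)] at hw
    exact hw rfl
  have b1 := (hh i x hi (by omega)).2.1
  have b2 := (hh i (x + 1) hi hx).2.1
  have h1 := hS.cut_right hh hq hm hi hx b1 (hn _ b1)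
  have h2 := hS.cut_right hh hq hm hi hx b2 (hn _ b2)
  omega

theorem spine_mem (hq : S.q ≠ 0) (hm : S.m ≠ 0) {y : ℕ} (hy : y < S.q * S.period) :
    (true, 0, y) ∈ F := by
  by_contra hn
  have hR := hS.respects_of (Z := fun y' => y' ≤ y) (T := fun i _ _ => i * S.period + h i 0 ≤ y)
    (by
      intro y' hmem
      have : y' ≠ y := by
        rintro rfl
        exact hn hmem
      omega)
    (fun _ _ _ _ _ _ _ => Iff.rfl)
    (by
      intro i r hi h0 hr hmem
      rw [(hh i 0 hi (by omega)).2.2.2 r h0 hr hmem])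
    (fun _ _ _ _ _ _ _ _ _ => Iff.rfl)
  have := hS.linked_of_term hq hm (by omega) (by omega) (by omega) (term_top hm) _ hR
  simp at this
  omega

end Solution

end StripData


namespace StripData

variable {S : StripData} {F : Finset (Bool × ℕ × ℕ)}

theorem horiz_outer {x i r : ℕ} (h0 : 0 < r) (hx : x % 7 = 0) (h : S.horiz x i r ≠ 0) :
    r % 3 = 2 ∧ S.horiz x i r = S.rowWeight + if x = 0 ∨ x = 7 * S.m then r else 0 := by
  unfold horiz at *
  rw [if_neg h0.ne'] at *
  split_ifs at * <;> simp_all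

theorem horiz_inner {x i r : ℕ} (h0 : 0 < r) (hx : x % 7 ≠ 0) (h : S.horiz x i r ≠ 0)
    (hr : r % 3 = 2) : S.sat i (r / 3) (x / 7) = true ∧
      S.horiz x i r = S.rowWeight + if x % 7 = 1 then 2 else 0 := by
  unfold horiz at *
  rw [if_neg h0.ne', if_pos hr, if_neg hx] at *
  split_ifs at * <;> simp_all

namespace Solution

variable (hS : S.Solution F)
include hS

theorem not_linked_bottom {j : ℕ} : ¬ S.Linked F (7 * j + 3) 0 := by
  intro hl
  have := hl (fun x y => x = 7 * j + 3 ∧ y = 0) ⟨?_, ?_⟩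
  · simp at this
  · intro x y hxy
    refine iff_of_false ?_ (by simp)
    rintro ⟨rfl, rfl⟩
    obtain ⟨_, i, r, _, _, hy, hv⟩ := hS.eq_of_vertical hxy
    obtain rfl : r = 0 := by omega
    apply hv
    unfold vert
    rw [if_neg (by omega), if_pos (by omega), if_pos rfl]
  · intro x i r _ _ h0 _ _
    exact iff_of_false (by omega) (by omega)

theorem not_linked_top (hq : S.q ≠ 0) {j : ℕ} : ¬ S.Linked F (7 * j + 5) (S.q * S.period) := by
  intro hl
  have hpos : 0 < S.q * S.period := Nat.mul_pos (Nat.pos_of_ne_zero hq) S.period_pos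
  have := hl (fun x y => x = 7 * j + 5 ∧ y = S.q * S.period) ⟨?_, ?_⟩
  · simp at this
  · intro x y hxy
    obtain ⟨_, i, r, hi, hr, rfl, hv⟩ := hS.eq_of_vertical hxy
    have hlt := mul_add_lt hi hr
    refine iff_of_false (by omega) ?_
    rintro ⟨rfl, hy⟩
    have hir : (i * S.period + r + 1) % S.period = 0 := by rw [hy, Nat.mul_mod_left]
    have : r + 1 = S.period := by
      by_contra hne
      rw [add_assoc, mod_add (by omega)] at hir
      omega
    apply hv
    unfold vert
    rw [if_neg (by omega), if_neg (by omega), if_pos (by omega), if_pos this]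
  · intro x i r _ hi h0 hr _
    have hlt := mul_add_lt hi hr
    exact iff_of_false (by omega) (by omega)

theorem exists_crossing (hq : S.q ≠ 0) (hm : S.m ≠ 0) {j : ℕ} (hj : j < S.m) :
    ∃ i < S.q, S.Linked F (7 * j + 5) (i * S.period) ∧
      S.Linked F (7 * j + 3) ((i + 1) * S.period) := by
  by_contra hn
  push Not at hn
  have key : ∀ g < S.q + 1, S.Linked F (7 * j + 5) (g * S.period) := by
    intro g
    induction g with
    | zero =>
      intro hg
      refine (hS.linked_leaf (t := 1) hq hm hj hg (by omega) (by simp [leafCount])).resolve_left ?_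
      rw [zero_mul]
      exact hS.not_linked_bottom
    | succ g ih =>
      intro hg
      refine (hS.linked_leaf (t := 1) hq hm hj hg (by omega) (by simp [leafCount])).resolve_left ?_
      exact hn g (by omega) (ih (by omega))
  exact hS.not_linked_top hq (key S.q (by omega))

variable {h : ℕ → ℕ → ℕ} (hh : S.IsRow F h)
include hh

theorem cell {i j : ℕ} (hq : S.q ≠ 0) (hm : S.m ≠ 0) (hi : i < S.q) (hj : j < S.m) :
    7 * S.rowWeight + 2 * S.period + 2 + h i (7 * (j + 1)) +
        (if j + 1 = S.m then h i (7 * (j + 1)) else 0) ≤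
      ∑ c ∈ Finset.range 7, S.slabSum F i (7 * j + (c + 1)) +
        ∑ c ∈ Finset.range 7, S.columnSum F i (7 * j + (c + 1)) + h i (7 * j) ∧
    (∑ c ∈ Finset.range 7, S.slabSum F i (7 * j + (c + 1)) +
        ∑ c ∈ Finset.range 7, S.columnSum F i (7 * j + (c + 1)) + h i (7 * j) =
      7 * S.rowWeight + 2 * S.period + 2 + h i (7 * (j + 1)) +
        (if j + 1 = S.m then h i (7 * (j + 1)) else 0) →
      h i (7 * j) = h i (7 * (j + 1)) ∧
        (S.Linked F (7 * j + 5) (i * S.period) → S.Linked F (7 * j + 3) ((i + 1) * S.period) →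
          S.sat i (h i (7 * j) / 3) j = true)) := by
  have slab : ∀ c, c < 8 → S.horiz (7 * j + c) i (h i (7 * j + c)) ≠ 0 ∧
      S.horiz (7 * j + c) i (h i (7 * j + c)) ≤ S.slabSum F i (7 * j + c) ∧
      0 < h i (7 * j + c) ∧ h i (7 * j + c) < S.period := by
    intro c hc
    obtain ⟨h1, h2, h3, -⟩ := hh i (7 * j + c) hi (by omega)
    exact ⟨hS.horiz_ne_zero hi h2 h3, horiz_le_slabSum hi (by omega) h1 h2 h3, h1, h2⟩
  have row : ∀ c, c < 8 → S.rowWeight ≤ S.slabSum F i (7 * j + c) := fun c hc =>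
    (S.rowWeight_le_horiz (slab c hc).2.2.1 (slab c hc).1).trans (slab c hc).2.1
  have sat : ∀ c, 0 < c → c < 7 → h i (7 * j + c) % 3 = 2 →
      S.sat i (h i (7 * j + c) / 3) j = true ∧
        S.horiz (7 * j + c) i (h i (7 * j + c)) = S.rowWeight + if c = 1 then 2 else 0 := by
    intro c h0 h7 h3
    obtain ⟨h4, -, h5, -⟩ := slab c (by omega)
    have := horiz_inner h5 (by omega) h4 h3
    rw [show (7 * j + c) / 7 = j by omega, show (7 * j + c) % 7 = c by omega] at this
    exact this
  have e2 : h i (7 * j + 2) = h i (7 * j + 1) := hS.row_eq hh hq hm hi (by omega) (by omega)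
  have e4 : h i (7 * j + 4) = h i (7 * j + 3) := hS.row_eq hh hq hm hi (by omega) (by omega)
  have e6 : h i (7 * j + 6) = h i (7 * j + 5) := hS.row_eq hh hq hm hi (by omega) (by omega)
  have m1 := hS.columnSum_move hh hq hm hi (x := 7 * j) (by omega)
  have m3 := hS.columnSum_move hh hq hm hi (x := 7 * j + 2) (by omega)
  have m5 := hS.columnSum_move hh hq hm hi (x := 7 * j + 4) (by omega)
  have m7 := hS.columnSum_move hh hq hm hi (x := 7 * j + 6) (by omega)
  have hin := (horiz_outer (slab 0 (by omega)).2.2.1 (by omega) (slab 0 (by omega)).1).1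
  have hout := horiz_outer (slab 7 (by omega)).2.2.1 (by omega) (slab 7 (by omega)).1
  have hlast : (if 7 * j + 7 = 0 ∨ 7 * j + 7 = 7 * S.m then h i (7 * j + 7) else 0) =
      if j + 1 = S.m then h i (7 * j + 7) else 0 := if_congr (by omega) rfl rfl
  rw [hlast] at hout
  have U := hS.linked_leaf (t := 0) (g := i + 1) hq hm hj (by omega) (by omega) (by simp [leafCount])
  have D := hS.linked_leaf (t := 2) (g := i) hq hm hj (by omega) (by omega)
    (by simp [leafCount, hi.ne])
  have s1 := slab 1 (by omega)
  have bound := cell_bound (p := S.period) (hin := h i (7 * j)) (hA := h i (7 * j + 1))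
    (hB := h i (7 * j + 3)) (hC := h i (7 * j + 5)) (hout := h i (7 * j + 7))
    (k1 := S.columnSum F i (7 * j + 1)) (k2 := S.columnSum F i (7 * j + 3))
    (k3 := S.columnSum F i (7 * j + 5)) (k4 := S.columnSum F i (7 * j + 7))
    (e := S.slabSum F i (7 * j + 1) - S.rowWeight)
    (sat := fun a => S.sat i a j = true) hin hout.1 s1.2.2.2
    (slab 3 (by omega)).2.2.2 (slab 5 (by omega)).2.2.2 (slab 7 (by omega)).2.2.2
    (fun h3 => ⟨(sat 1 (by omega) (by omega) h3).1, by
      have := (sat 1 (by omega) (by omega) h3).2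
      rw [if_pos rfl] at this
      omega⟩)
    (fun h3 => (sat 3 (by omega) (by omega) h3).1) (fun h3 => (sat 5 (by omega) (by omega) h3).1)
    m1.1 m1.2 (e2 ▸ m3.1) (e2 ▸ m3.2) (e4 ▸ m5.1) (e4 ▸ m5.2) (e6 ▸ m7.1) (e6 ▸ m7.2)
    (fun hl => by
      have := hS.columnSum_top hh hq hm hi (x := 7 * j) (by omega) hl
      exact ⟨this.1, this.2 (by omega)⟩)
    (fun hl => by
      have := hS.columnSum_top hh hq hm hi (x := 7 * j + 2) (by omega) hl
      rw [e2] at this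
      exact ⟨this.1, this.2 (by omega)⟩)
    (fun hl => by
      have := hS.columnSum_bottom hh hq hm hi (x := 7 * j + 4) (by omega) (by omega) hl
      rw [e4] at this
      exact this)
    (fun hl => by
      have := hS.columnSum_bottom hh hq hm hi (x := 7 * j + 6) (by omega) (by omega) hl
      rw [e6] at this
      exact this)
    U D
  have r1 := row 1 (by omega)
  have r2 := row 2 (by omega)
  have r3 := row 3 (by omega)
  have r4 := row 4 (by omega)
  have r5 := row 5 (by omega)
  have r6 := row 6 (by omega)
  have r7 := (slab 7 (by omega)).2.1
  rw [hout.2] at r7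
  simp only [Finset.sum_range_succ, Finset.sum_range_zero, Nat.reduceAdd,
    show 7 * (j + 1) = 7 * j + 7 by ring]
  obtain ⟨b1, b2⟩ := bound
  refine ⟨by omega, fun heq => ?_⟩
  obtain ⟨c1, c2⟩ := b2 (by omega)
  exact ⟨c1, fun hD hU => c2 hU hD⟩

theorem exists_assignment (hq : S.q ≠ 0) (hm : S.m ≠ 0) :
    (∀ i < S.q, h i 0 / 3 < S.M) ∧ ∀ j < S.m, ∃ i < S.q, S.sat i (h i 0 / 3) j = true := by
  let T : ℕ → ℕ → ℕ := fun i j => ∑ c ∈ Finset.range 7, S.slabSum F i (7 * j + (c + 1)) +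
    ∑ c ∈ Finset.range 7, S.columnSum F i (7 * j + (c + 1))
  let last : ℕ → ℕ → ℕ := fun i j => if j + 1 = S.m then h i (7 * (j + 1)) else 0
  let slack : ℕ → ℕ → ℕ := fun i j => T i j + h i (7 * j) -
    (7 * S.rowWeight + 2 * S.period + 2 + h i (7 * (j + 1)) + last i j)
  have hslack : ∀ i < S.q, ∀ j < S.m, T i j + h i (7 * j) =
      7 * S.rowWeight + 2 * S.period + 2 + h i (7 * (j + 1)) + last i j + slack i j := by
    intro i hi j hj
    have := (hS.cell hh hq hm hi hj).1
    simp only [slack, T, last]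
    omega
  have hsum : ∀ i < S.q, ∀ n ≤ S.m, ∑ j ∈ Finset.range n, T i j + h i 0 =
      n * (7 * S.rowWeight + 2 * S.period + 2) + h i (7 * n) + ∑ j ∈ Finset.range n, last i j +
        ∑ j ∈ Finset.range n, slack i j := by
    intro i hi n
    induction n with
    | zero => simp
    | succ n ih =>
      intro hn
      have h1 := ih (by omega)
      have h2 := hslack i hi n (by omega)
      rw [Finset.sum_range_succ, Finset.sum_range_succ, Finset.sum_range_succ, add_mul, one_mul]
      omega
  have hlast : ∀ i, ∑ j ∈ Finset.range S.m, last i j = h i (7 * S.m) := by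
    intro i
    rw [Finset.sum_eq_single_of_mem (S.m - 1) (Finset.mem_range.2 (by omega))]
    · simp only [last]
      rw [Nat.sub_add_cancel (by omega), if_pos rfl]
    · intro j _ hj
      exact if_neg (by omega)
  have hstrip : ∀ i ∈ Finset.range S.q, S.rowWeight * (7 * S.m + 1) +
      (2 * S.period * (S.m + 1) + 2 * S.m) + ∑ j ∈ Finset.range S.m, slack i j ≤
      ∑ x ∈ Finset.range (7 * S.m + 1), S.slabSum F i x +
        ∑ x ∈ Finset.range (7 * S.m + 1), S.columnSum F i (x + 1) := by
    intro i hi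
    rw [Finset.mem_range] at hi
    have h1 : ∑ x ∈ Finset.range (7 * S.m + 1), S.columnSum F i (x + 1) =
        ∑ j ∈ Finset.range S.m, ∑ c ∈ Finset.range 7, S.columnSum F i (7 * j + (c + 1)) +
          S.columnSum F i (7 * S.m + 1) := by
      rw [Finset.sum_range_succ, mul_comm, Finset.sum_range_mul_eq]
      simp only [mul_comm, add_assoc]
    rw [Finset.sum_range_seven_mul_add_one, h1]
    have h2 := hsum i hi S.m le_rfl
    rw [hlast, Finset.sum_add_distrib] at h2
    have h3 := (hS.columnSum_top hh hq hm hi (x := 7 * S.m) (by omega)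
      (hS.linked_right hq hm hi)).1
    obtain ⟨g1, g2, g3, -⟩ := hh i 0 hi (by omega)
    have h4 := hS.horiz_ne_zero hi g2 g3
    have h5 := (horiz_outer g1 (by omega) h4).2
    rw [if_pos (Or.inl rfl)] at h5
    have h6 := horiz_le_slabSum hi (by omega) g1 g2 g3
    have h7 : S.rowWeight * (7 * S.m + 1) + (2 * S.period * (S.m + 1) + 2 * S.m) =
      S.m * (7 * S.rowWeight + 2 * S.period + 2) + S.rowWeight + 2 * S.period := by ring
    omega
  have htotal := Finset.sum_le_sum hstrip
  simp only [Finset.sum_add_distrib (f := fun i => S.rowWeight * (7 * S.m + 1) +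
    (2 * S.period * (S.m + 1) + 2 * S.m)), Finset.sum_const, Finset.card_range, smul_eq_mul]
    at htotal
  rw [Finset.sum_add_distrib] at htotal
  have hspine : ∑ y ∈ Finset.range (S.q * S.period), S.contribution F true 0 y =
      S.q * S.period := by
    rw [Finset.sum_congr rfl (g := fun _ => 1), Finset.sum_const, Finset.card_range, smul_eq_mul,
      mul_one]
    intro y hy
    rw [Finset.mem_range] at hy
    rw [contribution_of_mem (hS.spine_mem hh hq hm hy), w_spine hy]
  have hcost := hS.cost
  rw [sum_eq hS.valid, hspine] at hcost
  have hgap := hS.le_gapSum hm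
  have hzero : ∑ i ∈ Finset.range S.q, ∑ j ∈ Finset.range S.m, slack i j = 0 := by
    unfold budget at hcost
    have : S.q * (S.rowWeight * (7 * S.m + 1) + (2 * S.period * (S.m + 1) + 2 * S.m)) =
      S.rowWeight * (S.q * (7 * S.m + 1)) + S.q * (2 * S.period * (S.m + 1) + 2 * S.m) := by ring
    omega
  have hgood : ∀ i < S.q, ∀ j < S.m, h i (7 * j) = h i (7 * (j + 1)) ∧
        (S.Linked F (7 * j + 5) (i * S.period) → S.Linked F (7 * j + 3) ((i + 1) * S.period) →
          S.sat i (h i (7 * j) / 3) j = true) := by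
    intro i hi j hj
    have h1 := Finset.sum_eq_zero_iff.1 (Finset.sum_eq_zero_iff.1 hzero i (Finset.mem_range.2 hi)) j
      (Finset.mem_range.2 hj)
    have h2 := hslack i hi j hj
    rw [h1, add_zero] at h2
    exact (hS.cell hh hq hm hi hj).2 h2
  have hconst : ∀ i < S.q, ∀ j ≤ S.m, h i (7 * j) = h i 0 := by
    intro i hi j
    induction j with
    | zero => simp
    | succ j ih => exact fun hj => (hgood i hi j hj).1.symm.trans (ih (by omega))
  refine ⟨fun i hi => ?_, fun j hj => ?_⟩
  · obtain ⟨g1, g2, g3, -⟩ := hh i 0 hi (by omega)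
    have := (horiz_outer g1 (by omega) (hS.horiz_ne_zero hi g2 g3)).1
    unfold period at g2
    omega
  · obtain ⟨i, hi, hD, hU⟩ := hS.exists_crossing hq hm hj
    refine ⟨i, hi, ?_⟩
    rw [← hconst i hi j hj.le]
    exact (hgood i hi j hj).2 hD hU

end Solution

end StripData


namespace StripData

/-- Partial assignments `a` to the groups, and for every clause a group whose partial assignment
satisfies it. -/
structure Selection (S : StripData) (a σ : ℕ → ℕ) : Prop where
  lt_M : ∀ i < S.q, a i < S.M
  lt_q : ∀ j < S.m, σ j < S.q
  sat : ∀ j < S.m, S.sat (σ j) (a (σ j)) j = true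

variable {S : StripData} {a σ : ℕ → ℕ}

/-- The row in which the strip `i` crosses the cell `j`. -/
def level (a σ : ℕ → ℕ) (i j : ℕ) : ℕ :=
  3 * a i + (if i < σ j then 1 else if i = σ j then 2 else 3)

def rowOf (a σ : ℕ → ℕ) (i x : ℕ) : ℕ :=
  if x % 7 = 0 then 3 * a i + 2 else level a σ i (x / 7)

/-- The lower end of the used part of the column `x` in the strip `i`. -/
def lower (S : StripData) (a σ : ℕ → ℕ) (i x : ℕ) : ℕ :=
  if x % 7 = 1 then (if x = 7 * S.m + 1 then 3 * a i + 2 else min (level a σ i (x / 7)) (3 * a i + 2))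
  else if x % 7 = 3 then level a σ i (x / 7)
  else if x % 7 = 5 then (if i ≤ σ (x / 7) then 0 else level a σ i (x / 7))
  else if x % 7 = 0 then (if σ (x / 7 - 1) < i then 0 else level a σ i (x / 7 - 1))
  else 0

/-- The upper end of the used part of the column `x` in the strip `i`. -/
def upper (S : StripData) (a σ : ℕ → ℕ) (i x : ℕ) : ℕ :=
  if x % 7 = 1 then (if x = 7 * S.m + 1 ∨ i < σ (x / 7) then S.period else level a σ i (x / 7))
  else if x % 7 = 3 then (if i < σ (x / 7) then level a σ i (x / 7) else S.period)
  else if x % 7 = 5 then level a σ i (x / 7)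
  else if x % 7 = 0 then max (level a σ i (x / 7 - 1)) (3 * a i + 2)
  else 0

/-- Whether the edge of the gap row `g` that starts in the column `x` is used. -/
def usesLeaf (S : StripData) (σ : ℕ → ℕ) (g x : ℕ) : Prop :=
  (x % 7 = 1 ∧ g ≠ 0 ∨ x % 7 = 4 ∨ x % 7 = 5) ∧ g ≤ σ (x / 7) ∨
    (x % 7 = 2 ∨ x % 7 = 3 ∨ x % 7 = 6 ∧ g < S.q) ∧ σ (x / 7) < g

def Uses (S : StripData) (a σ : ℕ → ℕ) (d : Bool) (x i r : ℕ) : Prop :=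
  if d then x = 0 ∨ S.lower a σ i x ≤ r ∧ r < S.upper a σ i x
  else if r = 0 then S.usesLeaf σ i x else r = rowOf a σ i x

open Classical in
noncomputable def edges (S : StripData) (a σ : ℕ → ℕ) : Finset (Bool × ℕ × ℕ) :=
  (Finset.univ ×ˢ Finset.range (7 * S.m + 2) ×ˢ Finset.range (S.q * S.period + 1)).filter fun s =>
    S.w s.1 s.2.1 s.2.2 ≠ 0 ∧ S.Uses a σ s.1 s.2.1 (s.2.2 / S.period) (s.2.2 % S.period)

theorem mem_edges {d : Bool} {x y : ℕ} : (d, x, y) ∈ S.edges a σ ↔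
    S.w d x y ≠ 0 ∧ S.Uses a σ d x (y / S.period) (y % S.period) := by
  simp only [edges, Finset.mem_filter, Finset.mem_product, Finset.mem_univ, true_and,
    Finset.mem_range, and_iff_right_iff_imp]
  rintro ⟨h, -⟩
  cases d
  · have := S.of_w_horizontal h
    omega
  · have := S.of_w_vertical h
    omega

theorem mem_edges_vertical {x i r : ℕ} (hx : x < 7 * S.m + 2) (hi : i < S.q) (hr : r < S.period) :
    (true, x, i * S.period + r) ∈ S.edges a σ ↔
      S.vert x r ≠ 0 ∧ (x = 0 ∨ S.lower a σ i x ≤ r ∧ r < S.upper a σ i x) := by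
  rw [mem_edges, w_vertical_strip hx hi hr, div_add hr, mod_add hr]
  rfl

theorem mem_edges_row {x i r : ℕ} (hx : x < 7 * S.m + 1) (hi : i < S.q) (h0 : r ≠ 0)
    (hr : r < S.period) : (false, x, i * S.period + r) ∈ S.edges a σ ↔
      S.horiz x i r ≠ 0 ∧ r = rowOf a σ i x := by
  rw [mem_edges, w_horizontal_strip hx hi hr, div_add hr, mod_add hr]
  simp [Uses, h0]

theorem mem_edges_gap {x g : ℕ} (hx : x < 7 * S.m + 1) (hg : g < S.q + 1) :
    (false, x, g * S.period) ∈ S.edges a σ ↔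
      (if x % 7 = 0 then 0 else S.gapWeight) ≠ 0 ∧ S.usesLeaf σ g x := by
  rw [mem_edges, w_horizontal_gap hx hg, Nat.mul_div_cancel _ S.period_pos, Nat.mul_mod_left]
  simp [Uses]

theorem contribution_le_of_mem {F : Finset (Bool × ℕ × ℕ)} {d : Bool} {x y b : ℕ}
    (h : (d, x, y) ∈ F → S.w d x y ≤ b) : S.contribution F d x y ≤ b := by
  unfold contribution
  split_ifs with h'
  · exact h h'
  · exact Nat.zero_le _

theorem columnSum_edges_le {i x : ℕ} (hx : x ≠ 0) (hx' : x < 7 * S.m + 2) (hi : i < S.q) :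
    S.columnSum (S.edges a σ) i x ≤ 2 * (S.upper a σ i x - S.lower a σ i x) := by
  have h : ∀ r ∈ Finset.range S.period, S.contribution (S.edges a σ) true x (i * S.period + r) ≤
      if S.lower a σ i x ≤ r ∧ r < S.upper a σ i x then 2 else 0 := by
    intro r hr
    rw [Finset.mem_range] at hr
    refine contribution_le_of_mem fun h => ?_
    rw [mem_edges_vertical hx' hi hr] at h
    rw [w_vertical_strip hx' hi hr, if_pos (h.2.resolve_left hx)]
    unfold vert
    split_ifs <;> omega
  refine (Finset.sum_le_sum h).trans ?_
  rw [← Finset.sum_filter, Finset.sum_const, smul_eq_mul, mul_comm, ← Nat.card_Ico]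
  refine Nat.mul_le_mul_left _ (Finset.card_le_card fun r hr => ?_)
  rw [Finset.mem_filter] at hr
  exact Finset.mem_Ico.2 hr.2

theorem slabSum_edges_le {i x : ℕ} (hx : x < 7 * S.m + 1) (hi : i < S.q) :
    S.slabSum (S.edges a σ) i x ≤ S.horiz x i (rowOf a σ i x) := by
  have h : ∀ r ∈ Finset.range (3 * S.M),
      S.contribution (S.edges a σ) false x (i * S.period + (r + 1)) ≤
        if r = rowOf a σ i x - 1 then S.horiz x i (rowOf a σ i x) else 0 := by
    intro r hr
    rw [Finset.mem_range] at hr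
    have hr' : r + 1 < S.period := by unfold period; omega
    refine contribution_le_of_mem fun h => ?_
    rw [mem_edges_row hx hi (by omega) hr'] at h
    rw [w_horizontal_strip hx hi hr', if_pos (by omega), h.2]
  refine (Finset.sum_le_sum h).trans ?_
  rw [Finset.sum_ite_eq']
  split_ifs <;> omega

theorem leafSum_edges_le {j g t : ℕ} (hσ : σ j < S.q) (hj : j < S.m) (hg : g < S.q + 1)
    (ht : t < 3) : S.leafSum (S.edges a σ) (j, g, t) ≤ S.gapWeight * S.leafCount g t := by
  have h : ∀ c, 0 < c → c < 7 → S.contribution (S.edges a σ) false (7 * j + c) (g * S.period) ≤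
      S.gapWeight * (if (c = 1 ∧ g ≠ 0 ∨ c = 4 ∨ c = 5) ∧ g ≤ σ j ∨
        (c = 2 ∨ c = 3 ∨ c = 6 ∧ g < S.q) ∧ σ j < g then 1 else 0) := by
    intro c h0 h7
    refine contribution_le_of_mem fun h => ?_
    have h1 : (7 * j + c) % 7 = c := by omega
    have h2 : (7 * j + c) / 7 = j := by omega
    rw [mem_edges_gap (by omega) hg, usesLeaf, h1, h2] at h
    rw [w_horizontal_gap (by omega) hg, h1, if_neg h0.ne', if_pos h.2, mul_one]
  refine (Nat.add_le_add (h (2 * t + 1) (by omega) (by omega))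
    (h (2 * t + 2) (by omega) (by omega))).trans ?_
  rw [← mul_add]
  refine Nat.mul_le_mul_left _ ?_
  unfold leafCount
  interval_cases t <;> simp only [Nat.mul_zero, Nat.zero_add, Nat.mul_one, Nat.reduceMul,
    Nat.reduceAdd, Nat.reduceEqDiff, false_and, or_false, false_or, true_and, if_true, if_false] <;>
    split_ifs <;> omega

theorem rowWeight_pos (hq : S.q ≠ 0) : 0 < S.rowWeight :=
  (Nat.zero_le _).trans_lt (budget_lt_rowWeight hq)

namespace Selection

variable (hs : S.Selection a σ)
include hs

theorem level_lt {i : ℕ} (hi : i < S.q) (j : ℕ) : level a σ i j < S.period := by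
  have := hs.lt_M i hi
  unfold level period
  split_ifs <;> omega

theorem rowOf_lt {i : ℕ} (hi : i < S.q) (x : ℕ) : 0 < rowOf a σ i x ∧ rowOf a σ i x < S.period := by
  have := hs.lt_M i hi
  unfold rowOf level period
  split_ifs <;> omega

theorem horiz_rowOf {i x : ℕ} (hi : i < S.q) (hx : x < 7 * S.m + 1) :
    S.horiz x i (rowOf a σ i x) = S.rowWeight +
      (if x % 7 = 0 then (if x = 0 ∨ x = 7 * S.m then 3 * a i + 2 else 0)
        else if x % 7 = 1 ∧ i = σ (x / 7) then 2 else 0) := by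
  unfold horiz
  rw [if_neg (hs.rowOf_lt hi x).1.ne']
  by_cases h : x % 7 = 0
  · have h2 : (3 * a i + 2) % 3 = 2 := by omega
    simp only [rowOf, h, if_true, h2]
  · simp only [rowOf, h, if_false, level]
    by_cases h1 : i < σ (x / 7)
    · rw [if_pos h1, if_neg (by omega), if_neg (by omega), add_zero]
    · rw [if_neg h1]
      by_cases h2 : i = σ (x / 7)
      · rw [if_pos h2, if_pos (by omega), if_pos]
        · simp [h2]
        · have h3 : (3 * a i + 2) / 3 = a i := by omega
          rw [h3, h2]
          exact hs.sat _ (by omega)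
      · rw [if_neg h2, if_neg (by omega), if_neg (by omega), add_zero]

theorem strip_le (hm : S.m ≠ 0) {i : ℕ} (hi : i < S.q) :
    ∑ x ∈ Finset.range (7 * S.m + 1), S.slabSum (S.edges a σ) i x +
      ∑ x ∈ Finset.range (7 * S.m + 1), S.columnSum (S.edges a σ) i (x + 1) ≤
    S.rowWeight * (7 * S.m + 1) + (2 * S.period * (S.m + 1) + 2 * S.m) := by
  have hp : S.period = 3 * S.M + 1 := rfl
  have ha := hs.lt_M i hi
  have hcell : ∀ j ∈ Finset.range S.m,
      ∑ c ∈ Finset.range 7, S.slabSum (S.edges a σ) i (7 * j + (c + 1)) +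
        ∑ c ∈ Finset.range 7, S.columnSum (S.edges a σ) i (7 * j + (c + 1)) ≤
      7 * S.rowWeight + 2 * S.period + 2 + if j = S.m - 1 then 3 * a i + 2 else 0 := by
    intro j hj
    rw [Finset.mem_range] at hj
    have h1 : ∀ c < 7, S.slabSum (S.edges a σ) i (7 * j + (c + 1)) ≤ S.rowWeight +
        (if c = 6 then (if j = S.m - 1 then 3 * a i + 2 else 0)
          else if c = 0 ∧ i = σ j then 2 else 0) := by
      intro c hc
      refine (slabSum_edges_le (by omega) hi).trans ?_
      rw [hs.horiz_rowOf hi (by omega)]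
      refine Nat.add_le_add_left ?_ _
      by_cases h6 : c = 6
      · have h7 : (7 * j + (c + 1)) % 7 = 0 := by omega
        rw [if_pos h7, if_pos h6]
        have : (7 * j + (c + 1) = 0 ∨ 7 * j + (c + 1) = 7 * S.m) ↔ j = S.m - 1 := by omega
        simp only [this, le_refl]
      · have : (7 * j + (c + 1)) / 7 = j := by omega
        rw [if_neg (by omega), if_neg h6, this]
        split_ifs <;> omega
    have h2 : ∀ c < 7, S.columnSum (S.edges a σ) i (7 * j + (c + 1)) ≤
        2 * (S.upper a σ i (7 * j + (c + 1)) - S.lower a σ i (7 * j + (c + 1))) := fun c hc =>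
      columnSum_edges_le (by omega) (by omega) hi
    have h3 : ∀ c < 6, (7 * j + (c + 1)) % 7 = c + 1 ∧ (7 * j + (c + 1)) / 7 = j := fun c _ => by
      omega
    have h4 : (7 * j + 7) % 7 = 0 ∧ (7 * j + 7) / 7 - 1 = j := by omega
    have h5 : 7 * j + 1 ≠ 7 * S.m + 1 := by omega
    have a0 := h1 0 (by omega)
    have a1 := h1 1 (by omega)
    have a2 := h1 2 (by omega)
    have a3 := h1 3 (by omega)
    have a4 := h1 4 (by omega)
    have a5 := h1 5 (by omega)
    have a6 := h1 6 (by omega)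
    have b0 := h2 0 (by omega)
    have b1 := h2 1 (by omega)
    have b2 := h2 2 (by omega)
    have b3 := h2 3 (by omega)
    have b4 := h2 4 (by omega)
    have b5 := h2 5 (by omega)
    have b6 := h2 6 (by omega)
    have c0 := h3 0 (by omega)
    have c1 := h3 1 (by omega)
    have c2 := h3 2 (by omega)
    have c3 := h3 3 (by omega)
    have c4 := h3 4 (by omega)
    have c5 := h3 5 (by omega)
    clear h1 h2 h3
    simp only [Nat.reduceAdd, Nat.zero_add] at *
    simp only [upper, lower, c0, c1, c2, c3, c4, c5, h4, h5, Nat.reduceEqDiff, if_true, if_false,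
      false_or, OfNat.ofNat_ne_one, zero_ne_one, OfNat.zero_ne_ofNat, one_ne_zero] at b0 b1 b2 b3 b4 b5 b6
    simp only [Finset.sum_range_succ, Finset.sum_range_zero, Nat.reduceAdd, Nat.zero_add]
    simp only [Nat.reduceEqDiff, if_true, if_false, false_and, OfNat.zero_ne_ofNat,
      true_and, one_ne_zero, OfNat.ofNat_ne_zero, OfNat.one_ne_ofNat]
      at a0 a1 a2 a3 a4 a5 a6
    rcases lt_trichotomy i (σ j) with h | h | h
    · have hl : level a σ i j = 3 * a i + 1 := by simp [level, h]
      simp only [hl, h, h.le, h.ne, h.not_gt, if_true, if_false] at *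
      omega
    · have hl : level a σ i j = 3 * a i + 2 := by simp [level, h]
      simp only [hl, h.le, h.not_lt, h.not_gt, if_pos h, if_true, if_false] at *
      omega
    · have hl : level a σ i j = 3 * a i + 3 := by simp [level, h.not_gt, h.ne']
      simp only [hl, h, h.not_ge, h.ne', h.not_gt, if_true, if_false] at *
      omega
  have hsum := Finset.sum_le_sum hcell
  rw [Finset.sum_add_distrib, Finset.sum_add_distrib, Finset.sum_ite_eq',
    if_pos (Finset.mem_range.2 (by omega)), Finset.sum_const, Finset.card_range, smul_eq_mul] at hsum
  have h1 : ∑ x ∈ Finset.range (7 * S.m + 1), S.columnSum (S.edges a σ) i (x + 1) =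
      ∑ j ∈ Finset.range S.m, ∑ c ∈ Finset.range 7,
        S.columnSum (S.edges a σ) i (7 * j + (c + 1)) +
        S.columnSum (S.edges a σ) i (7 * S.m + 1) := by
    rw [Finset.sum_range_succ, mul_comm, Finset.sum_range_mul_eq]
    simp only [mul_comm, add_assoc]
  rw [Finset.sum_range_seven_mul_add_one, h1]
  have h2 := slabSum_edges_le (a := a) (σ := σ) (x := 0) (by omega) hi
  rw [hs.horiz_rowOf hi (by omega)] at h2
  simp only [Nat.zero_mod, if_true, true_or] at h2
  have h3 := columnSum_edges_le (a := a) (σ := σ) (x := 7 * S.m + 1) (by omega) (by omega) hi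
  have h4 : (7 * S.m + 1) % 7 = 1 := by omega
  simp only [upper, lower, h4, if_true, true_or] at h3
  have h5 : S.rowWeight * (7 * S.m + 1) + (2 * S.period * (S.m + 1) + 2 * S.m) =
    S.m * (7 * S.rowWeight + 2 * S.period + 2) + S.rowWeight + 2 * S.period := by ring
  omega

theorem sum_le_budget (hm : S.m ≠ 0) : ∑ s ∈ S.edges a σ, S.grid.weight s ≤ S.budget := by
  rw [sum_eq fun s hs => (mem_edges.1 hs).1, sum_gap]
  have h1 : ∑ p ∈ S.leafIndex, S.leafSum (S.edges a σ) p ≤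
      S.gapWeight * (S.m * (3 * S.q + 1)) := by
    rw [← sum_leafCount]
    refine Finset.sum_le_sum fun p hp => ?_
    simp only [leafIndex, Finset.mem_product, Finset.mem_range] at hp
    exact leafSum_edges_le (hs.lt_q _ hp.1) hp.1 hp.2.1 hp.2.2
  have h2 := Finset.sum_le_sum fun i hi => hs.strip_le hm (Finset.mem_range.1 hi)
  rw [Finset.sum_add_distrib, Finset.sum_const, Finset.card_range, smul_eq_mul] at h2
  have h3 : ∑ y ∈ Finset.range (S.q * S.period), S.contribution (S.edges a σ) true 0 y ≤
      S.q * S.period := by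
    refine (Finset.sum_le_sum (g := fun _ => 1) fun y hy => ?_).trans (by simp)
    exact (contribution_le _ _ _ _).trans (w_spine (Finset.mem_range.1 hy)).le
  have h4 : S.q * (S.rowWeight * (7 * S.m + 1) + (2 * S.period * (S.m + 1) + 2 * S.m)) =
      S.rowWeight * (S.q * (7 * S.m + 1)) + S.q * (2 * S.period * (S.m + 1) + 2 * S.m) := by ring
  unfold budget
  omega

theorem row_edge {i x : ℕ} (hi : i < S.q) (hx : x < 7 * S.m + 1) :
    (false, x, i * S.period + rowOf a σ i x) ∈ S.edges a σ := by
  have h := hs.rowOf_lt hi x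
  refine (mem_edges_row hx hi h.1.ne' h.2).2 ⟨?_, rfl⟩
  rw [hs.horiz_rowOf hi hx]
  have := rowWeight_pos (S := S) (by omega)
  omega

theorem column_edge {i x r : ℕ} (hi : i < S.q) (hx : x < 7 * S.m + 2)
    (h : S.lower a σ i x ≤ r) (h' : r < S.upper a σ i x) :
    r < S.period ∧ (true, x, i * S.period + r) ∈ S.edges a σ := by
  have h1 : S.upper a σ i x ≤ S.period ∧
      (x % 7 = 5 ∨ x % 7 = 0 → S.upper a σ i x < S.period) := by
    have := hs.lt_M i hi
    unfold upper level period
    split_ifs <;> omega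
  have h2 : x % 7 = 1 ∨ x % 7 = 3 → 0 < S.lower a σ i x := by
    unfold lower level
    split_ifs <;> omega
  have h3 : x % 7 = 1 ∨ x % 7 = 3 ∨ x % 7 = 5 ∨ x % 7 = 0 := by
    by_contra hn
    unfold upper at h'
    split_ifs at h' <;> omega
  refine ⟨by omega, (mem_edges_vertical hx hi (by omega)).2 ⟨?_, Or.inr ⟨h, h'⟩⟩⟩
  unfold vert
  split_ifs <;> omega

section Connected

variable {P : ℕ → ℕ → Prop}
  (hv : ∀ x y, (true, x, y) ∈ S.edges a σ → (P x y ↔ P x (y + 1)))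
  (hh : ∀ x y, (false, x, y) ∈ S.edges a σ → (P x y ↔ P (x + 1) y))
include hv

omit hs in
theorem iff_spine {y : ℕ} (hy : y ≤ S.q * S.period) : P 0 y ↔ P 0 0 := by
  induction y with
  | zero => rfl
  | succ y ih =>
    rw [← ih (by omega)]
    refine (hv 0 y (mem_edges.2 ⟨?_, Or.inl rfl⟩)).symm
    rw [w_spine (by omega)]
    exact one_ne_zero

theorem iff_column {i x r r' : ℕ} (hi : i < S.q) (hx : x < 7 * S.m + 2)
    (h : S.lower a σ i x ≤ r) (hr : r ≤ r') (h' : r' ≤ S.upper a σ i x) :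
    P x (i * S.period + r) ↔ P x (i * S.period + r') := by
  induction r', hr using Nat.le_induction with
  | base => rfl
  | succ r' hr ih =>
    rw [ih (by omega)]
    exact hv _ _ (hs.column_edge hi hx (by omega) (by omega)).2

include hh

theorem iff_row {i x : ℕ} (hi : i < S.q) (hx : x < 7 * S.m + 1) :
    (P x (i * S.period + rowOf a σ i x) ↔ P 0 0) ∧
      (P (x + 1) (i * S.period + rowOf a σ i x) ↔ P 0 0) := by
  have hstep : ∀ x, x < 7 * S.m + 1 → ((P x (i * S.period + rowOf a σ i x) ↔ P 0 0) →
      (P (x + 1) (i * S.period + rowOf a σ i x) ↔ P 0 0)) := fun x hx h =>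
    (hh _ _ (hs.row_edge hi hx)).symm.trans h
  induction x with
  | zero =>
    have h := iff_spine hv (mul_add_lt hi (hs.rowOf_lt hi 0).2).le
    exact ⟨h, hstep 0 hx h⟩
  | succ x ih =>
    have h1 := (ih (by omega)).2
    have h2 : rowOf a σ i (x + 1) = rowOf a σ i x ∨
        (S.lower a σ i (x + 1) ≤ rowOf a σ i x ∧ rowOf a σ i x ≤ S.upper a σ i (x + 1)) ∧
        (S.lower a σ i (x + 1) ≤ rowOf a σ i (x + 1) ∧
          rowOf a σ i (x + 1) ≤ S.upper a σ i (x + 1)) := by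
      have ha := hs.lt_M i hi
      have hp : S.period = 3 * S.M + 1 := rfl
      have h7 : x = 7 * (x / 7) + x % 7 := by omega
      have h8 := Nat.mod_lt x (show 7 > 0 by omega)
      generalize x / 7 = j at h7
      generalize x % 7 = c at h7 h8
      subst h7
      have e0 : (7 * j + 7) % 7 = 0 := by omega
      have e1 : (7 * j + 7) / 7 = j + 1 := by omega
      have e2 : ∀ c < 7, (7 * j + c) % 7 = c ∧ (7 * j + c) / 7 = j := by omega
      have e3 : 7 * j + 1 ≠ 7 * S.m + 1 := by omega
      have e4 : 7 * j % 7 = 0 := by omega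
      interval_cases c
      all_goals
        simp only [rowOf, lower, upper, Nat.add_zero, add_assoc, Nat.reduceAdd, e0, e1, e3, e4,
          e2 1 (by omega), e2 2 (by omega), e2 3 (by omega), e2 4 (by omega), e2 5 (by omega),
          e2 6 (by omega), Nat.reduceEqDiff, if_true, if_false, false_or, add_tsub_cancel_right,
          true_or, OfNat.ofNat_ne_zero, OfNat.ofNat_ne_one, one_ne_zero, OfNat.one_ne_ofNat]
        try
          have hlt := hs.level_lt hi j
          unfold level at *
          split_ifs at * <;> omega
    have h3 : P (x + 1) (i * S.period + rowOf a σ i (x + 1)) ↔ P 0 0 := by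
      rcases h2 with h2 | ⟨⟨g1, g2⟩, g3, g4⟩
      · rw [h2, h1]
      · rcases le_total (rowOf a σ i x) (rowOf a σ i (x + 1)) with h | h
        · rw [← hs.iff_column hv hi (by omega) g1 h g4, h1]
        · rw [hs.iff_column hv hi (by omega) g3 h g2, h1]
    exact ⟨h3, hstep _ hx h3⟩

theorem iff_bottom {i x : ℕ} (hi : i < S.q) (hx : x < 7 * S.m + 1) (h : S.lower a σ i (x + 1) = 0)
    (h' : rowOf a σ i x ≤ S.upper a σ i (x + 1)) : P (x + 1) (i * S.period) ↔ P 0 0 := by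
  rw [← (hs.iff_row hv hh hi hx).2]
  exact hs.iff_column hv hi (by omega) h.le (Nat.zero_le _) h'

theorem iff_top {i x : ℕ} (hi : i < S.q) (hx : x < 7 * S.m + 1)
    (h : S.lower a σ i (x + 1) ≤ rowOf a σ i x) (h' : S.upper a σ i (x + 1) = S.period) :
    P (x + 1) ((i + 1) * S.period) ↔ P 0 0 := by
  rw [← (hs.iff_row hv hh hi hx).2, add_mul, one_mul]
  exact (hs.iff_column hv hi (by omega) h (hs.rowOf_lt hi x).2.le h'.ge).symm

omit hv in
theorem iff_gap {x g : ℕ} (hx : x < 7 * S.m + 1) (hx7 : x % 7 ≠ 0) (hg : g < S.q + 1)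
    (h : S.usesLeaf σ g x) : P x (g * S.period) ↔ P (x + 1) (g * S.period) := by
  refine hh _ _ ((mem_edges_gap hx hg).2 ⟨?_, h⟩)
  rw [if_neg hx7]
  exact Nat.ne_of_gt ((Nat.zero_le _).trans_lt (budget_lt_gapWeight
    (Nat.ne_of_gt ((Nat.zero_le _).trans_lt (hs.lt_q (x / 7) (by omega))))))

theorem iff_D2 {i j : ℕ} (hi : i < S.q) (hj : j < S.m) (h : i ≤ σ j) :
    P (7 * j + 5) (i * S.period) ↔ P 0 0 := by
  have h1 : (7 * j + 4 + 1) % 7 = 5 ∧ (7 * j + 4 + 1) / 7 = j := by omega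
  have h2 : (7 * j + 4) % 7 ≠ 0 ∧ (7 * j + 4) / 7 = j := by omega
  refine hs.iff_bottom hv hh (x := 7 * j + 4) hi (by omega) ?_ ?_
  · simp [lower, h1, h]
  · simp [upper, rowOf, h1, h2]

theorem iff_D1 {i j : ℕ} (hi : i < S.q) (hj : j < S.m) (h : σ j < i) :
    P (7 * j + 7) (i * S.period) ↔ P 0 0 := by
  have h1 : (7 * j + 6 + 1) % 7 = 0 ∧ (7 * j + 6 + 1) / 7 - 1 = j := by omega
  have h2 : (7 * j + 6) % 7 ≠ 0 ∧ (7 * j + 6) / 7 = j := by omega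
  refine hs.iff_bottom hv hh (x := 7 * j + 6) hi (by omega) ?_ ?_
  · simp [lower, h1, h]
  · simp [upper, rowOf, h1, h2]

theorem iff_U2 {i j : ℕ} (hi : i < S.q) (hj : j < S.m) (h : i < σ j) :
    P (7 * j + 1) ((i + 1) * S.period) ↔ P 0 0 := by
  have h1 : (7 * j + 1) % 7 = 1 ∧ (7 * j + 1) / 7 = j := by omega
  have h2 : (7 * j) % 7 = 0 := by omega
  have h3 : 7 * j + 1 ≠ 7 * S.m + 1 := by omega
  refine hs.iff_top hv hh (x := 7 * j) hi (by omega) ?_ ?_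
  · simp [lower, rowOf, h1, h2, hj.ne]
  · simp [upper, h1, h]

theorem iff_U1 {i j : ℕ} (hi : i < S.q) (hj : j < S.m) (h : σ j ≤ i) :
    P (7 * j + 3) ((i + 1) * S.period) ↔ P 0 0 := by
  have h1 : (7 * j + 2 + 1) % 7 = 3 ∧ (7 * j + 2 + 1) / 7 = j := by omega
  have h2 : (7 * j + 2) % 7 ≠ 0 ∧ (7 * j + 2) / 7 = j := by omega
  refine hs.iff_top hv hh (x := 7 * j + 2) hi (by omega) ?_ ?_
  · simp [lower, rowOf, h1, h2]
  · simp [upper, h1, h.not_gt]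

theorem iff_right {i : ℕ} (hi : i < S.q) :
    P (7 * S.m + 1) ((i + 1) * S.period) ↔ P 0 0 := by
  have h1 : (7 * S.m + 1) % 7 = 1 := by omega
  have h2 : (7 * S.m) % 7 = 0 := by omega
  refine hs.iff_top hv hh (x := 7 * S.m) hi (by omega) ?_ ?_
  · simp [lower, rowOf, h1, h2]
  · simp [upper, h1]

theorem iff_term {x y : ℕ} (hx : x < 7 * S.m + 2) (hy : y < S.q * S.period + 1)
    (h : S.term x y) : P x y ↔ P 0 0 := by
  have hp := S.period_pos
  obtain ⟨hm, ⟨rfl, h⟩ | ⟨hy0, h⟩⟩ := h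
  · exact iff_spine hv (by omega)
  obtain ⟨g, rfl⟩ : ∃ g, y = g * S.period := ⟨y / S.period, by rw [Nat.div_mul_cancel
    (Nat.dvd_of_mod_eq_zero hy0)]⟩
  have hg : g < S.q + 1 := Nat.lt_succ_of_le (Nat.le_of_mul_le_mul_right (by omega) hp)
  have hg0 : g * S.period ≠ 0 → ∃ i, g = i + 1 := fun h => ⟨g - 1, by
    rcases Nat.eq_zero_or_pos g with rfl | h'
    · simp at h
    · omega⟩
  by_cases hlast : x = 7 * S.m + 1
  · obtain ⟨i, rfl⟩ := hg0 (by omega)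
    subst hlast
    exact hs.iff_right hv hh (by omega)
  have h7 : x = 7 * (x / 7) + x % 7 := by omega
  generalize x / 7 = j at h7
  generalize x % 7 = c at h7 h
  have hj : j < S.m := by omega
  have hσ := hs.lt_q j hj
  have e : ∀ c < 7, (7 * j + c) % 7 = c ∧ (7 * j + c) / 7 = j := by omega
  rcases h with h | ⟨rfl, h⟩ | rfl | ⟨rfl, h⟩
  · omega
  · obtain ⟨i, rfl⟩ := hg0 h
    rcases lt_or_ge i (σ j) with h1 | h1
    · have := hs.iff_gap hh (x := 7 * j + 1) (g := i + 1) (by omega) (by omega) hg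
        (Or.inl ⟨Or.inl ⟨(e 1 (by omega)).1, by omega⟩, by rw [(e 1 (by omega)).2]; omega⟩)
      rw [h7, ← hs.iff_U2 hv hh (by omega) hj h1, this]
    · have := hs.iff_gap hh (x := 7 * j + 2) (g := i + 1) (by omega) (by omega) hg
        (Or.inr ⟨Or.inl (e 2 (by omega)).1, by rw [(e 2 (by omega)).2]; omega⟩)
      rw [h7, ← hs.iff_U1 hv hh (by omega) hj h1, this]
  · rcases le_or_gt g (σ j) with h1 | h1
    · have := hs.iff_gap hh (x := 7 * j + 4) (g := g) (by omega) (by omega) hg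
        (Or.inl ⟨Or.inr (Or.inl (e 4 (by omega)).1), by rw [(e 4 (by omega)).2]; omega⟩)
      rw [h7, ← hs.iff_D2 hv hh (by omega) hj h1, this]
    · obtain ⟨i, rfl⟩ : ∃ i, g = i + 1 := ⟨g - 1, by omega⟩
      have := hs.iff_gap hh (x := 7 * j + 3) (g := i + 1) (by omega) (by omega) hg
        (Or.inr ⟨Or.inr (Or.inl (e 3 (by omega)).1), by rw [(e 3 (by omega)).2]; omega⟩)
      rw [h7, ← hs.iff_U1 hv hh (by omega) hj (Nat.le_of_lt_succ h1), this]
  · have hgq : g ≠ S.q := fun h' => h (by rw [h'])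
    rcases le_or_gt g (σ j) with h1 | h1
    · have := hs.iff_gap hh (x := 7 * j + 5) (g := g) (by omega) (by omega) hg
        (Or.inl ⟨Or.inr (Or.inr (e 5 (by omega)).1), by rw [(e 5 (by omega)).2]; omega⟩)
      rw [h7, ← hs.iff_D2 hv hh (by omega) hj h1, this]
    · have := hs.iff_gap hh (x := 7 * j + 6) (g := g) (by omega) (by omega) hg
        (Or.inr ⟨Or.inr (Or.inr ⟨(e 6 (by omega)).1, by omega⟩), by rw [(e 6 (by omega)).2]; omega⟩)
      rw [h7, this, ← hs.iff_D1 hv hh (by omega) hj h1]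

end Connected

theorem hasTreeWithinBudget (hm : S.m ≠ 0) :
    (S.grid.toInstance S.term S.budget).HasTreeWithinBudget := by
  refine WeightedGrid.hasTree_of_slots (S.edges a σ) (fun s hs => (mem_edges.1 hs).1)
    (by exact_mod_cast hs.sum_le_budget hm) fun P hP x y x' y' hx hy h hx' hy' h' => ?_
  have hv : ∀ x y, (true, x, y) ∈ S.edges a σ → (P x y ↔ P x (y + 1)) := fun x y => hP true x y
  have hh : ∀ x y, (false, x, y) ∈ S.edges a σ → (P x y ↔ P (x + 1) y) := fun x y => hP false x y
  exact (hs.iff_term hv hh hx hy h).trans (hs.iff_term hv hh hx' hy' h').symm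

end Selection

theorem hasTreeWithinBudget_of_no_clauses (hm : S.m = 0) :
    (S.grid.toInstance S.term S.budget).HasTreeWithinBudget := by
  refine WeightedGrid.hasTree_of_slots ∅ (by simp) (by simp) fun P _ x y x' y' _ _ h => ?_
  exact absurd hm h.1

theorem hasTreeWithinBudget_iff (hq : S.q ≠ 0) (hM : S.M ≠ 0) :
    (S.grid.toInstance S.term S.budget).HasTreeWithinBudget ↔
      ∃ a : ℕ → ℕ, (∀ i < S.q, a i < S.M) ∧ ∀ j < S.m, ∃ i < S.q, S.sat i (a i) j = true := by
  by_cases hm : S.m = 0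
  · exact iff_of_true (hasTreeWithinBudget_of_no_clauses hm)
      ⟨fun _ => 0, fun _ _ => Nat.pos_of_ne_zero hM, fun j hj => absurd hj (by omega)⟩
  constructor
  · intro h
    obtain ⟨F, hF, hk, hconn⟩ := WeightedGrid.exists_slots h
    have hS : S.Solution F := ⟨hF, by exact_mod_cast hk, fun P hv hh => hconn P fun d x y h => by
      cases d
      · exact hh x y h
      · exact hv x y h⟩
    obtain ⟨h, hh⟩ := hS.exists_isRow hq hm
    exact ⟨_, hS.exists_assignment hh hq hm⟩
  · rintro ⟨a, ha, hsat⟩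
    classical
    have hs : S.Selection a fun j => if h : j < S.m then (hsat j h).choose else 0 := by
      refine ⟨ha, fun j hj => ?_, fun j hj => ?_⟩
      · simp only [hj, dif_pos]
        exact (hsat j hj).choose_spec.1
      · simp only [hj, dif_pos]
        exact (hsat j hj).choose_spec.2
    exact hs.hasTreeWithinBudget hm

end StripData


namespace WordRAM

/-- The program halts within `T` steps in the state `s'`. -/
def Reaches (W : ℕ) (p : Prog) (s s' : State) (T : ℕ) : Prop := ∃ t ≤ T, Run W p s s' t

theorem Reaches.seq {W : ℕ} {p p' : Prog} {s s' s'' : State} {T T' : ℕ} (h : Reaches W p s s' T)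
    (h' : Reaches W p' s' s'' T') : Reaches W (.seq p p') s s'' (T + T') := by
  obtain ⟨t, ht, h⟩ := h
  obtain ⟨t', ht', h'⟩ := h'
  exact ⟨t + t', by omega, h.seq h'⟩

theorem Reaches.mono {W : ℕ} {p : Prog} {s s' : State} {T T' : ℕ} (h : Reaches W p s s' T)
    (hT : T ≤ T') : Reaches W p s s' T' := by
  obtain ⟨t, ht, h⟩ := h
  exact ⟨t, by omega, h⟩

/-- A loop that counts a register down to zero. -/
theorem exists_reaches_loop {W a : ℕ} {p : Prog} (n : ℕ) (inv : ℕ → State → Prop) (cost : ℕ → ℕ)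
    (hstep : ∀ k < n, ∀ s, inv k s → s.reg a = n - k →
      ∃ s', Reaches W p s s' (cost k) ∧ inv (k + 1) s' ∧ s'.reg a = n - (k + 1))
    {s : State} (h0 : inv 0 s) (ha : s.reg a = n) :
    ∃ s', Reaches W (.loop a p) s s' (∑ k ∈ Finset.range n, (cost k + 1) + 1) ∧ inv n s' := by
  have key : ∀ r k, k + r = n → ∀ s, inv k s → s.reg a = r →
      ∃ s', Reaches W (.loop a p) s s' (∑ i ∈ Finset.range r, (cost (k + i) + 1) + 1) ∧
        inv n s' := by
    intro r
    induction r with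
    | zero =>
      intro k hk s hs hr
      obtain rfl : k = n := hk
      exact ⟨s, ⟨1, by simp, .loop_done hr⟩, hs⟩
    | succ r ih =>
      intro k hk s hs hr
      obtain ⟨s', ⟨t, ht, h1⟩, h2, h3⟩ := hstep k (by omega) s hs (by omega)
      obtain ⟨s'', ⟨t', ht', h4⟩, h5⟩ := ih (k + 1) (by omega) s' h2 (by omega)
      refine ⟨s'', ⟨t + 1 + t', ?_, .loop_again (by omega) h1 h4⟩, h5⟩
      rw [Finset.sum_range_succ', add_zero]
      simp only [add_assoc, add_comm 1] at ht' ⊢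
      omega
  obtain ⟨s', h1, h2⟩ := key n 0 (by omega) s h0 ha
  simp only [zero_add] at h1
  exact ⟨s', h1, h2⟩

/-- Arithmetic expressions over a list of variables. -/
inductive Exp
  | const (c : ℕ)
  | var (k : ℕ)
  | op (o : Op) (a b : Exp)
  | load (a : Exp)
  | ite (c a b : Exp)
  | pow (e : Exp)
  | sum (e b : Exp)

namespace Exp

/-- `a` if `c` is nonzero and `b` otherwise. -/
def select (c a b : ℕ) : ℕ := if c ≠ 0 then a else b

/-- The value of an expression. `pow e` is a power of two and `sum e b` the sum of the values of
`b` with a new variable that runs through the numbers below `e`. -/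
def eval (mem : ℕ → ℕ) : Exp → List ℕ → ℕ
  | const c, _ => c
  | var k, ρ => ρ.getD k 0
  | op o a b, ρ => o.eval (a.eval mem ρ) (b.eval mem ρ)
  | load a, ρ => mem (a.eval mem ρ)
  | ite c a b, ρ => select (c.eval mem ρ) (a.eval mem ρ) (b.eval mem ρ)
  | pow e, ρ => 2 ^ e.eval mem ρ
  | sum e b, ρ => ∑ i ∈ Finset.range (e.eval mem ρ), b.eval mem (ρ ++ [i])

/-- A bound for the number of steps of the evaluation of an expression. -/
def cost (mem : ℕ → ℕ) : Exp → List ℕ → ℕ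
  | const _, _ => 1
  | var _, _ => 2
  | op _ a b, ρ => a.cost mem ρ + b.cost mem ρ + 1
  | load a, ρ => a.cost mem ρ + 1
  | ite c a b, ρ => c.cost mem ρ + (a.cost mem ρ + b.cost mem ρ + 1)
  | pow e, ρ => e.cost mem ρ + 4 * e.eval mem ρ + 4
  | sum e b, ρ => e.cost mem ρ + ∑ i ∈ Finset.range (e.eval mem ρ), (b.cost mem (ρ ++ [i]) + 5) + 5

/-- All words in the evaluation of an expression are at most `W`. -/
def Fits (W : ℕ) (mem : ℕ → ℕ) : Exp → List ℕ → Prop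
  | const c, _ => c ≤ W
  | var k, ρ => ρ.getD k 0 ≤ W
  | op o a b, ρ => a.Fits W mem ρ ∧ b.Fits W mem ρ ∧ o.eval (a.eval mem ρ) (b.eval mem ρ) ≤ W
  | load a, ρ => a.Fits W mem ρ ∧ mem (a.eval mem ρ) ≤ W
  | ite c a b, ρ => c.Fits W mem ρ ∧ a.Fits W mem ρ ∧ b.Fits W mem ρ
  | pow e, ρ => e.Fits W mem ρ ∧ e.eval mem ρ ≤ W ∧ 2 ^ e.eval mem ρ ≤ W
  | sum e b, ρ => e.Fits W mem ρ ∧ e.eval mem ρ ≤ W ∧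
      (∀ i < e.eval mem ρ, b.Fits W mem (ρ ++ [i])) ∧
      ∑ i ∈ Finset.range (e.eval mem ρ), b.eval mem (ρ ++ [i]) ≤ W

/-- The program that evaluates an expression: the variables are in the registers `σ`, the value
goes to the register `d`, and only registers from `d` on are changed. -/
def compile : Exp → List ℕ → ℕ → Prog
  | const c, _, d => .const d c
  | var k, σ, d => match σ[k]? with
    | some r => .seq (.const d 0) (.arith .add d r d)
    | none => .const d 0
  | op o a b, σ, d => .seq (.seq (a.compile σ d) (b.compile σ (d + 1))) (.arith o d d (d + 1))
  | load a, σ, d => .seq (a.compile σ d) (.load d d)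
  | ite c a b, σ, d => .seq (c.compile σ d) (.branch d (a.compile σ d) (b.compile σ d))
  | pow e, σ, d => .seq (.seq (e.compile σ d) (.const (d + 1) 1)) (.seq
      (.loop d (.seq (.arith .add (d + 1) (d + 1) (d + 1))
        (.seq (.const (d + 2) 1) (.arith .sub d d (d + 2))))) (.seq (.const d 0)
      (.arith .add d (d + 1) d)))
  | sum e b, σ, d => .seq (.seq (e.compile σ d) (.seq (.const (d + 1) 0) (.const (d + 2) 0)))
      (.seq (.loop d (.seq (b.compile (σ ++ [d + 2]) (d + 3))
        (.seq (.arith .add (d + 1) (d + 1) (d + 3)) (.seq (.const (d + 3) 1)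
          (.seq (.arith .add (d + 2) (d + 2) (d + 3)) (.arith .sub d d (d + 3)))))))
      (.seq (.const d 0) (.arith .add d (d + 1) d)))

end Exp

/-- The second state differs from the first one only in registers from `d` on. -/
structure Keeps (d : ℕ) (s s' : State) : Prop where
  mem : s'.mem = s.mem
  reg : ∀ r < d, s'.reg r = s.reg r

namespace Keeps

variable {d : ℕ} {s s' s'' : State}

theorem trans (h : Keeps d s s') (h' : Keeps d s' s'') : Keeps d s s'' :=
  ⟨h'.mem.trans h.mem, fun r hr => (h'.reg r hr).trans (h.reg r hr)⟩

theorem le {e : ℕ} (h : Keeps d s s') (he : e ≤ d) : Keeps e s s' :=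
  ⟨h.mem, fun r hr => h.reg r (by omega)⟩

theorem map {σ : List ℕ} (h : Keeps d s s') (hσ : ∀ r ∈ σ, r < d) :
    σ.map s'.reg = σ.map s.reg := List.map_congr_left fun r hr => h.reg r (hσ r hr)

theorem update {e x : ℕ} (he : d ≤ e) :
    Keeps d s { s with reg := Function.update s.reg e x } :=
  ⟨rfl, fun r hr => Function.update_of_ne (by omega) _ _⟩

end Keeps

theorem Reaches.const {W : ℕ} (s : State) (d x : ℕ) (h : x ≤ W) :
    Reaches W (.const d x) s { s with reg := Function.update s.reg d x } 1 :=
  ⟨1, le_rfl, .const s d x h⟩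

theorem Reaches.arith {W : ℕ} (s : State) (o : Op) (d a b : ℕ)
    (h : o.eval (s.reg a) (s.reg b) ≤ W) : Reaches W (.arith o d a b) s
      { s with reg := Function.update s.reg d (o.eval (s.reg a) (s.reg b)) } 1 :=
  ⟨1, le_rfl, .arith s o d a b h⟩

theorem Exp.exists_reaches {W : ℕ} (e : Exp) : ∀ (σ : List ℕ) (d : ℕ) (s : State),
    (∀ r ∈ σ, r < d) → e.Fits W s.mem (σ.map s.reg) →
    ∃ s', Reaches W (e.compile σ d) s s' (e.cost s.mem (σ.map s.reg)) ∧
      s'.reg d = e.eval s.mem (σ.map s.reg) ∧ s'.out = s.out ∧ Keeps d s s' := by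
  induction e with
  | const c =>
    intro σ d s _ hW
    exact ⟨_, .const s d c hW, Function.update_self _ _ _, rfl, .update le_rfl⟩
  | var k =>
    intro σ d s hσ hW
    rw [Exp.Fits, List.getD_eq_getElem?_getD, List.getElem?_map] at hW
    rw [Exp.compile, Exp.eval, Exp.cost, List.getD_eq_getElem?_getD, List.getElem?_map]
    cases h : σ[k]? with
    | none => exact ⟨_, (Reaches.const s d 0 (Nat.zero_le _)).mono (by omega),
        Function.update_self _ _ _, rfl, .update le_rfl⟩
    | some r =>
      have hr : r < d := hσ r (List.mem_of_getElem? h)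
      rw [h] at hW
      have h1 := Reaches.const (W := W) s d 0 (Nat.zero_le _)
      refine ⟨_, h1.seq (Reaches.arith _ .add d r d ?_), ?_, rfl, ?_⟩
      · simpa [Op.eval, Function.update_of_ne hr.ne] using hW
      · simp [Op.eval, Function.update_of_ne hr.ne]
      · exact (Keeps.update le_rfl).trans (.update le_rfl)
  | op o a b iha ihb =>
    intro σ d s hσ hW
    obtain ⟨ha, hb, hW⟩ := hW
    obtain ⟨s1, r1, v1, o1, k1⟩ := iha σ d s hσ ha
    have hm := k1.map hσ
    obtain ⟨s2, r2, v2, o2, k2⟩ := ihb σ (d + 1) s1 (fun r hr => (hσ r hr).trans (Nat.lt_succ_self d))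
      (by rwa [k1.mem, hm])
    rw [k1.mem, hm] at r2 v2
    have v1' := (k2.reg d (Nat.lt_succ_self d)).trans v1
    refine ⟨_, (r1.seq r2).seq (Reaches.arith s2 o d d (d + 1) (by rwa [v1', v2])), ?_, o2.trans o1,
      (k1.trans (k2.le (Nat.le_succ d))).trans (.update le_rfl)⟩
    simp only [Function.update_self, v1', v2]
    rfl
  | load a ih =>
    intro σ d s hσ hW
    obtain ⟨ha, hW⟩ := hW
    obtain ⟨s1, r1, v1, o1, k1⟩ := ih σ d s hσ ha
    have h1 : s1.mem (s1.reg d) = s.mem (a.eval s.mem (σ.map s.reg)) := by rw [k1.mem, v1]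
    refine ⟨_, r1.seq ⟨1, le_rfl, .load s1 d d (by rwa [h1])⟩, ?_, o1, k1.trans (.update le_rfl)⟩
    simp only [Function.update_self, h1]
    rfl
  | ite c a b ihc iha ihb =>
    intro σ d s hσ hW
    obtain ⟨hc, ha, hb⟩ := hW
    obtain ⟨s1, r1, v1, o1, k1⟩ := ihc σ d s hσ hc
    have hm := k1.map hσ
    rw [Exp.eval, Exp.select]
    split_ifs with h
    · obtain ⟨s2, ⟨t, ht, r2⟩, v2, o2, k2⟩ := iha σ d s1 hσ (by rwa [k1.mem, hm])
      rw [k1.mem, hm] at ht v2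
      exact ⟨s2, r1.seq ⟨t + 1, by omega, .branch_true (by rwa [v1]) r2⟩, v2, o2.trans o1,
        k1.trans k2⟩
    · rw [not_ne_iff] at h
      obtain ⟨s2, ⟨t, ht, r2⟩, v2, o2, k2⟩ := ihb σ d s1 hσ (by rwa [k1.mem, hm])
      rw [k1.mem, hm] at ht v2
      exact ⟨s2, r1.seq ⟨t + 1, by omega, .branch_false (by rwa [v1]) r2⟩, v2, o2.trans o1,
        k1.trans k2⟩
  | pow e ih =>
    intro σ d s hσ hW
    obtain ⟨he, hW1, hW2⟩ := hW
    obtain ⟨s1, r1, v1, o1, k1⟩ := ih σ d s hσ he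
    have h1 : 1 ≤ W := Nat.one_le_two_pow.trans hW2
    generalize hn : e.eval s.mem (σ.map s.reg) = n at *
    obtain ⟨s2, r2, i1, i2, i3⟩ := exists_reaches_loop (W := W) (a := d)
      (p := .seq (.arith .add (d + 1) (d + 1) (d + 1))
        (.seq (.const (d + 2) 1) (.arith .sub d d (d + 2)))) n
      (fun k s' => s'.reg (d + 1) = 2 ^ k ∧ s'.out = s.out ∧ Keeps d s s') (fun _ => 3)
      (by
        rintro k hk s' ⟨j1, j2, j3⟩ j4
        have h2 : 2 ^ (k + 1) ≤ 2 ^ n := Nat.pow_le_pow_right (by omega) hk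
        rw [pow_succ] at h2
        refine ⟨_, (Reaches.arith s' .add _ _ _ ?_).seq ((Reaches.const _ _ _ h1).seq
          (Reaches.arith _ .sub _ _ _ ?_)), ⟨?_, j2, ?_⟩, ?_⟩
        · simp only [Op.eval, j1]
          omega
        · simp only [Op.eval, Function.update_self,
            Function.update_of_ne (show d ≠ d + 1 by omega),
            Function.update_of_ne (show d ≠ d + 2 by omega), j4]
          omega
        · simp only [Op.eval, Function.update_self,
            Function.update_of_ne (show d + 1 ≠ d by omega),
            Function.update_of_ne (show d + 1 ≠ d + 2 by omega), j1]
          ring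
        · exact ((j3.trans (.update (by omega))).trans (.update (by omega))).trans (.update le_rfl)
        · simp only [Op.eval, Function.update_self,
            Function.update_of_ne (show d ≠ d + 1 by omega),
            Function.update_of_ne (show d ≠ d + 2 by omega), j4]
          omega)
      (s := { s1 with reg := Function.update s1.reg (d + 1) 1 })
      ⟨Function.update_self _ _ _, o1, k1.trans (.update (by omega))⟩
      ((Function.update_of_ne (by omega) _ _).trans v1)
    refine ⟨_, Reaches.mono ((r1.seq (Reaches.const _ _ _ h1)).seq (r2.seq
      ((Reaches.const _ _ _ (Nat.zero_le _)).seq (Reaches.arith _ .add _ _ _ ?_)))) ?_, ?_, i2, ?_⟩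
    · simpa [Op.eval, i1] using hW2
    · rw [Finset.sum_const, Finset.card_range, smul_eq_mul, Exp.cost, hn]
      omega
    · simp [Op.eval, i1, Exp.eval, hn]
    · exact (i3.trans (.update le_rfl)).trans (.update le_rfl)
  | sum e b ihe ihb =>
    intro σ d s hσ hW
    obtain ⟨he, hW1, hb, hW2⟩ := hW
    obtain ⟨s1, r1, v1, o1, k1⟩ := ihe σ d s hσ he
    generalize hn : e.eval s.mem (σ.map s.reg) = n at *
    let f : ℕ → ℕ := fun i => b.eval s.mem (σ.map s.reg ++ [i])
    obtain ⟨s2, r2, ⟨i1, -⟩, i2, i3⟩ := exists_reaches_loop (W := W) (a := d)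
      (p := .seq (b.compile (σ ++ [d + 2]) (d + 3))
        (.seq (.arith .add (d + 1) (d + 1) (d + 3)) (.seq (.const (d + 3) 1)
          (.seq (.arith .add (d + 2) (d + 2) (d + 3)) (.arith .sub d d (d + 3)))))) n
      (fun k s' => (s'.reg (d + 1) = ∑ i ∈ Finset.range k, f i ∧ s'.reg (d + 2) = k) ∧
        s'.out = s.out ∧ Keeps d s s') (fun i => b.cost s.mem (σ.map s.reg ++ [i]) + 4)
      (by
        rintro k hk s' ⟨⟨j0, j1⟩, j2, j3⟩ j4
        have hmap : (σ ++ [d + 2]).map s'.reg = σ.map s.reg ++ [k] := by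
          rw [List.map_append, j3.map hσ]
          simp [j1]
        have h2 : ∑ i ∈ Finset.range k, f i + f k ≤ W := by
          rw [← Finset.sum_range_succ]
          refine le_trans ?_ hW2
          exact Finset.sum_le_sum_of_subset (Finset.range_mono hk)
        obtain ⟨s3, r3, v3, o3, k3⟩ := ihb (σ ++ [d + 2]) (d + 3) s' (by
          intro r hr
          rcases List.mem_append.1 hr with hr | hr
          · exact (hσ r hr).trans (by omega)
          · rw [List.mem_singleton] at hr
            omega) (by
          rw [j3.mem, hmap]
          exact hb k hk)
        rw [j3.mem, hmap] at r3 v3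
        change s3.reg (d + 3) = f k at v3
        have w0 := (k3.reg d (by omega)).trans j4
        have w1 := (k3.reg (d + 1) (by omega)).trans j0
        have w2 := (k3.reg (d + 2) (by omega)).trans j1
        refine ⟨_, r3.seq ((Reaches.arith s3 .add _ _ _ ?_).seq
          ((Reaches.const _ _ _ (by omega)).seq ((Reaches.arith _ .add _ _ _ ?_).seq
          (Reaches.arith _ .sub _ _ _ ?_)))), ⟨⟨?_, ?_⟩, o3.trans j2, ?_⟩, ?_⟩
        · simpa [Op.eval, w1, v3] using h2
        · simp only [Op.eval, Function.update_self,
            Function.update_of_ne (show d + 2 ≠ d + 3 by omega),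
            Function.update_of_ne (show d + 2 ≠ d + 1 by omega), w2]
          omega
        · simp only [Op.eval, Function.update_self,
            Function.update_of_ne (show d + 3 ≠ d + 2 by omega),
            Function.update_of_ne (show d ≠ d + 2 by omega),
            Function.update_of_ne (show d ≠ d + 3 by omega),
            Function.update_of_ne (show d ≠ d + 1 by omega), w0]
          omega
        · simp only [Op.eval, Function.update_self, Finset.sum_range_succ,
            Function.update_of_ne (show d + 1 ≠ d by omega),
            Function.update_of_ne (show d + 1 ≠ d + 2 by omega),
            Function.update_of_ne (show d + 1 ≠ d + 3 by omega), w1, v3]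
        · simp only [Op.eval, Function.update_self,
            Function.update_of_ne (show d + 2 ≠ d by omega),
            Function.update_of_ne (show d + 2 ≠ d + 1 by omega),
            Function.update_of_ne (show d + 2 ≠ d + 3 by omega), w2]
        · exact ((((j3.trans (k3.le (by omega))).trans (.update (by omega))).trans
            (.update (by omega))).trans (.update (by omega))).trans (.update le_rfl)
        · simp only [Op.eval, Function.update_self,
            Function.update_of_ne (show d + 3 ≠ d + 2 by omega),
            Function.update_of_ne (show d ≠ d + 2 by omega),
            Function.update_of_ne (show d ≠ d + 3 by omega),
            Function.update_of_ne (show d ≠ d + 1 by omega), w0]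
          omega)
      (s := { s1 with reg := Function.update (Function.update s1.reg (d + 1) 0) (d + 2) 0 })
      ⟨⟨by simp, Function.update_self _ _ _⟩,
        o1, ((k1.trans (.update (e := d + 1) (by omega))).trans (.update (by omega)))⟩
      (by simp [v1])
    refine ⟨_, Reaches.mono ((r1.seq ((Reaches.const _ _ _ (Nat.zero_le _)).seq
      (Reaches.const _ _ _ (Nat.zero_le _)))).seq (r2.seq
      ((Reaches.const _ _ _ (Nat.zero_le _)).seq (Reaches.arith _ .add _ _ _ ?_)))) ?_, ?_, i2, ?_⟩
    · simpa [Op.eval, i1] using hW2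
    · rw [Exp.cost, hn]
      simp only [add_assoc, Nat.reduceAdd]
      omega
    · simp [Op.eval, i1, Exp.eval, hn, f]
    · exact (i3.trans (.update le_rfl)).trans (.update le_rfl)

end WordRAM


namespace WordRAM

/-- Programs that write a list of words and bind variables to values. -/
inductive Cmd
  | emit (e : Exp)
  | seq (p q : Cmd)
  | bind (e : Exp) (p : Cmd)
  | each (e : Exp) (p : Cmd)

namespace Cmd

/-- The output. `bind e p` runs `p` with a new variable with the value of `e`, and `each e p` runs
`p` for all values below the value of `e` of a new variable. -/
def out (mem : ℕ → ℕ) : Cmd → List ℕ → List ℕ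
  | emit e, ρ => [e.eval mem ρ]
  | seq p q, ρ => p.out mem ρ ++ q.out mem ρ
  | bind e p, ρ => p.out mem (ρ ++ [e.eval mem ρ])
  | each e p, ρ => (List.range (e.eval mem ρ)).flatMap fun i => p.out mem (ρ ++ [i])

/-- A bound for the number of steps. -/
def cost (mem : ℕ → ℕ) : Cmd → List ℕ → ℕ
  | emit e, ρ => e.cost mem ρ + 1
  | seq p q, ρ => p.cost mem ρ + q.cost mem ρ
  | bind e p, ρ => e.cost mem ρ + p.cost mem (ρ ++ [e.eval mem ρ])
  | each e p, ρ => e.cost mem ρ + ∑ i ∈ Finset.range (e.eval mem ρ), (p.cost mem (ρ ++ [i]) + 4) + 2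

/-- All words in the execution of a program are at most `W`. -/
def Fits (W : ℕ) (mem : ℕ → ℕ) : Cmd → List ℕ → Prop
  | emit e, ρ => e.Fits W mem ρ
  | seq p q, ρ => p.Fits W mem ρ ∧ q.Fits W mem ρ
  | bind e p, ρ => e.Fits W mem ρ ∧ p.Fits W mem (ρ ++ [e.eval mem ρ])
  | each e p, ρ => e.Fits W mem ρ ∧ e.eval mem ρ ≤ W ∧
      ∀ i < e.eval mem ρ, p.Fits W mem (ρ ++ [i])

/-- The word RAM program with the variables in the registers `σ` that only changes registers from
`d` on. -/
def compile : Cmd → List ℕ → ℕ → Prog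
  | emit e, σ, d => .seq (e.compile σ d) (.emit d)
  | seq p q, σ, d => .seq (p.compile σ d) (q.compile σ d)
  | bind e p, σ, d => .seq (e.compile σ d) (p.compile (σ ++ [d]) (d + 1))
  | each e p, σ, d => .seq (.seq (e.compile σ d) (.const (d + 1) 0))
      (.loop d (.seq (p.compile (σ ++ [d + 1]) (d + 2)) (.seq (.const (d + 2) 1)
        (.seq (.arith .add (d + 1) (d + 1) (d + 2)) (.arith .sub d d (d + 2))))))

theorem exists_reaches {W : ℕ} (hW1 : 1 ≤ W) (p : Cmd) : ∀ (σ : List ℕ) (d : ℕ) (s : State),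
    (∀ r ∈ σ, r < d) → p.Fits W s.mem (σ.map s.reg) →
    ∃ s', Reaches W (p.compile σ d) s s' (p.cost s.mem (σ.map s.reg)) ∧
      s'.out = s.out ++ p.out s.mem (σ.map s.reg) ∧ Keeps d s s' := by
  induction p with
  | emit e =>
    intro σ d s hσ hW
    obtain ⟨s1, r1, v1, o1, k1⟩ := e.exists_reaches σ d s hσ hW
    refine ⟨_, r1.seq ⟨1, le_rfl, .emit s1 d⟩, ?_, ⟨k1.mem, k1.reg⟩⟩
    simp only [o1, v1]
    rfl
  | seq p q ihp ihq =>
    intro σ d s hσ hW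
    obtain ⟨s1, r1, o1, k1⟩ := ihp σ d s hσ hW.1
    have hm := k1.map hσ
    obtain ⟨s2, r2, o2, k2⟩ := ihq σ d s1 hσ (by
      rw [k1.mem, hm]
      exact hW.2)
    rw [k1.mem, hm] at r2 o2
    refine ⟨s2, r1.seq r2, ?_, k1.trans k2⟩
    rw [o2, o1, List.append_assoc]
    rfl
  | bind e p ih =>
    intro σ d s hσ hW
    obtain ⟨s1, r1, v1, o1, k1⟩ := e.exists_reaches σ d s hσ hW.1
    have hm : (σ ++ [d]).map s1.reg = σ.map s.reg ++ [e.eval s.mem (σ.map s.reg)] := by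
      rw [List.map_append, k1.map hσ]
      simp [v1]
    obtain ⟨s2, r2, o2, k2⟩ := ih (σ ++ [d]) (d + 1) s1 (by
      intro r hr
      rcases List.mem_append.1 hr with hr | hr
      · exact (hσ r hr).trans (by omega)
      · rw [List.mem_singleton] at hr
        omega) (by
      rw [k1.mem, hm]
      exact hW.2)
    rw [k1.mem, hm] at r2 o2
    refine ⟨s2, r1.seq r2, ?_, k1.trans (k2.le (by omega))⟩
    rw [o2, o1]
    rfl
  | each e p ih =>
    intro σ d s hσ hW
    obtain ⟨he, hW2, hp⟩ := hW
    obtain ⟨s1, r1, v1, o1, k1⟩ := e.exists_reaches σ d s hσ he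
    generalize hn : e.eval s.mem (σ.map s.reg) = n at *
    obtain ⟨s2, r2, i1, i2, i3⟩ := exists_reaches_loop (W := W) (a := d)
      (p := .seq (p.compile (σ ++ [d + 1]) (d + 2)) (.seq (.const (d + 2) 1)
        (.seq (.arith .add (d + 1) (d + 1) (d + 2)) (.arith .sub d d (d + 2))))) n
      (fun k s' => s'.reg (d + 1) = k ∧
        s'.out = s.out ++ (List.range k).flatMap (fun i => p.out s.mem (σ.map s.reg ++ [i])) ∧
        Keeps d s s') (fun i => p.cost s.mem (σ.map s.reg ++ [i]) + 3)
      (by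
        rintro k hk s' ⟨j1, j2, j3⟩ j4
        have hmap : (σ ++ [d + 1]).map s'.reg = σ.map s.reg ++ [k] := by
          rw [List.map_append, j3.map hσ]
          simp [j1]
        obtain ⟨s3, r3, o3, k3⟩ := ih (σ ++ [d + 1]) (d + 2) s' (by
          intro r hr
          rcases List.mem_append.1 hr with hr | hr
          · exact (hσ r hr).trans (by omega)
          · rw [List.mem_singleton] at hr
            omega) (by
          rw [j3.mem, hmap]
          exact hp k hk)
        rw [j3.mem, hmap] at r3 o3
        have w0 := (k3.reg d (by omega)).trans j4
        have w1 := (k3.reg (d + 1) (by omega)).trans j1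
        refine ⟨_, r3.seq ((Reaches.const _ _ _ hW1).seq ((Reaches.arith _ .add _ _ _ ?_).seq
          (Reaches.arith _ .sub _ _ _ ?_))), ⟨?_, ?_, ?_⟩, ?_⟩
        · simp only [Op.eval, Function.update_self,
            Function.update_of_ne (show d + 1 ≠ d + 2 by omega), w1]
          omega
        · simp only [Op.eval, Function.update_self,
            Function.update_of_ne (show d + 2 ≠ d + 1 by omega),
            Function.update_of_ne (show d ≠ d + 1 by omega),
            Function.update_of_ne (show d ≠ d + 2 by omega), w0]
          omega
        · simp only [Op.eval, Function.update_self,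
            Function.update_of_ne (show d + 1 ≠ d by omega),
            Function.update_of_ne (show d + 1 ≠ d + 2 by omega), w1]
        · simp only [o3, j2, List.range_succ, List.flatMap_append, List.flatMap_singleton,
            List.append_assoc]
        · exact (((j3.trans (k3.le (by omega))).trans (.update (by omega))).trans
            (.update (by omega))).trans (.update le_rfl)
        · simp only [Op.eval, Function.update_self,
            Function.update_of_ne (show d + 2 ≠ d + 1 by omega),
            Function.update_of_ne (show d ≠ d + 1 by omega),
            Function.update_of_ne (show d ≠ d + 2 by omega), w0]
          omega)
      (s := { s1 with reg := Function.update s1.reg (d + 1) 0 })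
      ⟨Function.update_self _ _ _, by simp [o1], k1.trans (.update (by omega))⟩
      (by simp [v1])
    refine ⟨_, Reaches.mono ((r1.seq (Reaches.const _ _ _ (Nat.zero_le _))).seq r2) ?_, ?_, i3⟩
    · rw [Cmd.cost, hn]
      simp only [add_assoc, Nat.reduceAdd]
      omega
    · rw [i2, Cmd.out, hn]

end Cmd

theorem Cmd.outputsWithin {W T : ℕ} {input : List ℕ} (p : Cmd) (hW : 1 ≤ W)
    (hfits : p.Fits W (fun i => input.getD i 0) [])
    (hcost : p.cost (fun i => input.getD i 0) [] ≤ T) :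
    (p.compile [] 0).OutputsWithin W input (p.out (fun i => input.getD i 0) []) T := by
  obtain ⟨s, ⟨t, ht, h⟩, h', -⟩ := p.exists_reaches hW [] 0 (init input) (by simp) hfits
  exact ⟨s, t, ht.trans hcost, h, h'⟩

/-! ### Bounds for words and time -/

theorem Op.eval_le {o : Op} {x y s a b : ℕ} (hs : 2 ≤ s) (hx : x ≤ s ^ a) (hy : y ≤ s ^ b) :
    o.eval x y ≤ s ^ (a + b + 1) := by
  have ha : s ^ a ≤ s ^ (a + b) := Nat.pow_le_pow_right (by omega) (by omega)
  have hb : s ^ b ≤ s ^ (a + b) := Nat.pow_le_pow_right (by omega) (by omega)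
  have h : 2 * s ^ (a + b) ≤ s ^ (a + b + 1) := by
    rw [pow_succ, mul_comm]
    exact Nat.mul_le_mul_left _ hs
  cases o with
  | add =>
    simp only [Op.eval]
    omega
  | sub =>
    simp only [Op.eval]
    omega
  | mul =>
    have := Nat.mul_le_mul hx hy
    rw [← pow_add] at this
    simp only [Op.eval]
    omega
  | div =>
    have := Nat.div_le_self x y
    simp only [Op.eval]
    omega

namespace Exp

/-- An exponent `k` such that all words in the evaluation are at most `s ^ k` if the `i`-th variable
is at most `s ^ δᵢ` and all words in the memory and all powers of two are at most `s`. -/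
def deg : Exp → List ℕ → ℕ
  | const c, _ => c
  | var k, δ => δ.getD k 0
  | op _ a b, δ => a.deg δ + b.deg δ + 1
  | load a, δ => a.deg δ + 1
  | ite c a b, δ => c.deg δ + a.deg δ + b.deg δ
  | pow e, δ => e.deg δ + 1
  | sum e b, δ => e.deg δ + b.deg (δ ++ [e.deg δ])

/-- All exponents in the evaluation are at most `K`. -/
def Pows (K : ℕ) (mem : ℕ → ℕ) : Exp → List ℕ → Prop
  | const _, _ => True
  | var _, _ => True
  | op _ a b, ρ => a.Pows K mem ρ ∧ b.Pows K mem ρ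
  | load a, ρ => a.Pows K mem ρ
  | ite c a b, ρ => c.Pows K mem ρ ∧ a.Pows K mem ρ ∧ b.Pows K mem ρ
  | pow e, ρ => e.Pows K mem ρ ∧ e.eval mem ρ ≤ K
  | sum e b, ρ => e.Pows K mem ρ ∧ ∀ i < e.eval mem ρ, b.Pows K mem (ρ ++ [i])

/-- The size of an expression, and `0` for sums. -/
def size : Exp → ℕ
  | const _ => 1
  | var _ => 2
  | op _ a b => a.size + b.size + 1
  | load a => a.size + 1
  | ite c a b => c.size + (a.size + b.size + 1)
  | pow e => e.size + 4
  | sum _ _ => 0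

def SumFree : Exp → Prop
  | const _ => True
  | var _ => True
  | op _ a b => a.SumFree ∧ b.SumFree
  | load a => a.SumFree
  | ite c a b => c.SumFree ∧ a.SumFree ∧ b.SumFree
  | pow e => e.SumFree
  | sum _ _ => False

theorem cost_le {K : ℕ} {mem : ℕ → ℕ} {e : Exp} : ∀ {ρ : List ℕ}, e.SumFree → e.Pows K mem ρ →
    e.cost mem ρ ≤ e.size * (K + 1) := by
  induction e with
  | const c =>
    intro ρ _ _
    simp [cost, size]
  | var k =>
    intro ρ _ _
    simp only [cost, size]
    omega
  | op o a b iha ihb =>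
    intro ρ h h'
    have := iha h.1 h'.1
    have := ihb h.2 h'.2
    simp only [cost, size, add_mul, one_mul] at *
    omega
  | load a ih =>
    intro ρ h h'
    have := ih h h'
    simp only [cost, size, add_mul, one_mul] at *
    omega
  | ite c a b ihc iha ihb =>
    intro ρ h h'
    have := ihc h.1 h'.1
    have := iha h.2.1 h'.2.1
    have := ihb h.2.2 h'.2.2
    simp only [cost, size, add_mul, one_mul] at *
    omega
  | pow e ih =>
    intro ρ h h'
    have := ih h h'.1
    have := h'.2
    simp only [cost, size, add_mul] at *
    omega
  | sum e b => exact fun h => h.elim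

end Exp

/-- The variables are bounded by powers of `s`. -/
def Bounded (s : ℕ) (ρ δ : List ℕ) : Prop := List.Forall₂ (fun v k => v ≤ s ^ k) ρ δ

theorem Bounded.append {s v k : ℕ} {ρ δ : List ℕ} (h : Bounded s ρ δ) (hv : v ≤ s ^ k) :
    Bounded s (ρ ++ [v]) (δ ++ [k]) := List.rel_append h (List.Forall₂.cons hv .nil)

theorem Bounded.getD_le {s : ℕ} {ρ δ : List ℕ} (h : Bounded s ρ δ) (k : ℕ) :
    ρ.getD k 0 ≤ s ^ δ.getD k 0 := by
  induction h generalizing k with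
  | nil => simp
  | cons h _ ih => cases k with
    | zero => simpa using h
    | succ k => simpa using ih k

theorem Exp.eval_le_and_fits {s K W : ℕ} {mem : ℕ → ℕ} (hs : 2 ≤ s) (hmem : ∀ i, mem i ≤ s)
    (hK : 2 ^ K ≤ s) (e : Exp) : ∀ {ρ δ : List ℕ}, Bounded s ρ δ → e.Pows K mem ρ →
    e.eval mem ρ ≤ s ^ e.deg δ ∧ (s ^ e.deg δ ≤ W → e.Fits W mem ρ) := by
  have hle : ∀ {a b : ℕ}, a ≤ b → s ^ b ≤ W → s ^ a ≤ W := fun h h' =>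
    (Nat.pow_le_pow_right (by omega) h).trans h'
  have hmono : ∀ {a b : ℕ}, a ≤ b → s ^ a ≤ s ^ b := Nat.pow_le_pow_right (by omega)
  induction e with
  | const c =>
    intro ρ δ _ _
    have : c ≤ s ^ c := (Nat.lt_pow_self (by omega)).le
    exact ⟨this, this.trans⟩
  | var k =>
    intro ρ δ h _
    exact ⟨h.getD_le k, (h.getD_le k).trans⟩
  | op o a b iha ihb =>
    intro ρ δ h hp
    obtain ⟨a1, a2⟩ := iha h hp.1
    obtain ⟨b1, b2⟩ := ihb h hp.2
    have := Op.eval_le (o := o) hs a1 b1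
    exact ⟨this, fun hW => ⟨a2 (hle (by simp only [deg]; omega) hW),
      b2 (hle (by simp only [deg]; omega) hW), this.trans hW⟩⟩
  | load a ih =>
    intro ρ δ h hp
    obtain ⟨a1, a2⟩ := ih h hp
    have : mem (a.eval mem ρ) ≤ s ^ (a.deg δ + 1) :=
      (hmem _).trans ((pow_one s).ge.trans (hmono (by omega)))
    exact ⟨this, fun hW => ⟨a2 (hle (by simp only [deg]; omega) hW), this.trans hW⟩⟩
  | ite c a b ihc iha ihb =>
    intro ρ δ h hp
    obtain ⟨c1, c2⟩ := ihc h hp.1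
    obtain ⟨a1, a2⟩ := iha h hp.2.1
    obtain ⟨b1, b2⟩ := ihb h hp.2.2
    refine ⟨?_, fun hW => ⟨c2 (hle (by simp only [deg]; omega) hW),
      a2 (hle (by simp only [deg]; omega) hW), b2 (hle (by simp only [deg]; omega) hW)⟩⟩
    rw [eval, select]
    split_ifs
    · exact a1.trans (hmono (by simp only [deg]; omega))
    · exact b1.trans (hmono (by simp only [deg]; omega))
  | pow e ih =>
    intro ρ δ h hp
    obtain ⟨a1, a2⟩ := ih h hp.1
    have : 2 ^ e.eval mem ρ ≤ s ^ (e.deg δ + 1) :=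
      ((Nat.pow_le_pow_right (by omega) hp.2).trans hK).trans
        ((pow_one s).ge.trans (hmono (by omega)))
    exact ⟨this, fun hW => ⟨a2 (hle (by simp only [deg]; omega) hW),
      a1.trans (hle (by simp only [deg]; omega) hW), this.trans hW⟩⟩
  | sum e b ihe ihb =>
    intro ρ δ h hp
    obtain ⟨a1, a2⟩ := ihe h hp.1
    have hb : ∀ i < e.eval mem ρ, _ := fun i hi => ihb (h.append (hi.le.trans a1)) (hp.2 i hi)
    have : ∑ i ∈ Finset.range (e.eval mem ρ), b.eval mem (ρ ++ [i]) ≤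
        s ^ (e.deg δ + b.deg (δ ++ [e.deg δ])) := by
      refine (Finset.sum_le_card_nsmul _ _ _ fun i hi =>
        (hb i (Finset.mem_range.1 hi)).1).trans ?_
      rw [Finset.card_range, smul_eq_mul, pow_add]
      exact Nat.mul_le_mul_right _ a1
    exact ⟨this, fun hW => ⟨a2 (hle (by simp only [deg]; omega) hW),
      a1.trans (hle (by simp only [deg]; omega) hW),
      fun i hi => (hb i hi).2 (hle (by simp only [deg]; omega) hW), this.trans hW⟩⟩

namespace Cmd

def deg : Cmd → List ℕ → ℕ
  | emit e, δ => e.deg δ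
  | seq p q, δ => p.deg δ + q.deg δ
  | bind e p, δ => e.deg δ + p.deg (δ ++ [e.deg δ])
  | each e p, δ => e.deg δ + p.deg (δ ++ [e.deg δ])

/-- All exponents are at most `K`. -/
def Pows (K : ℕ) (mem : ℕ → ℕ) : Cmd → List ℕ → Prop
  | emit e, ρ => e.Pows K mem ρ
  | seq p q, ρ => p.Pows K mem ρ ∧ q.Pows K mem ρ
  | bind e p, ρ => e.Pows K mem ρ ∧ p.Pows K mem (ρ ++ [e.eval mem ρ])
  | each e p, ρ => e.Pows K mem ρ ∧ ∀ i < e.eval mem ρ, p.Pows K mem (ρ ++ [i])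

theorem fits {s K W : ℕ} {mem : ℕ → ℕ} (hs : 2 ≤ s) (hmem : ∀ i, mem i ≤ s) (hK : 2 ^ K ≤ s)
    (p : Cmd) : ∀ {ρ δ : List ℕ}, Bounded s ρ δ → p.Pows K mem ρ → s ^ p.deg δ ≤ W →
    p.Fits W mem ρ := by
  have hle : ∀ {a b : ℕ}, a ≤ b → s ^ b ≤ W → s ^ a ≤ W := fun h h' =>
    (Nat.pow_le_pow_right (by omega) h).trans h'
  induction p with
  | emit e =>
    intro ρ δ h hp hW
    exact (e.eval_le_and_fits hs hmem hK h hp).2 hW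
  | seq p q ihp ihq =>
    intro ρ δ h hp hW
    exact ⟨ihp h hp.1 (hle (by simp only [deg]; omega) hW),
      ihq h hp.2 (hle (by simp only [deg]; omega) hW)⟩
  | bind e p ih =>
    intro ρ δ h hp hW
    obtain ⟨a1, a2⟩ := e.eval_le_and_fits (W := W) hs hmem hK h hp.1
    exact ⟨a2 (hle (by simp only [deg]; omega) hW),
      ih (h.append a1) hp.2 (hle (by simp only [deg]; omega) hW)⟩
  | each e p ih =>
    intro ρ δ h hp hW
    obtain ⟨a1, a2⟩ := e.eval_le_and_fits (W := W) hs hmem hK h hp.1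
    exact ⟨a2 (hle (by simp only [deg]; omega) hW),
      a1.trans (hle (by simp only [deg]; omega) hW), fun i hi =>
      ih (h.append (hi.le.trans a1)) (hp.2 i hi) (hle (by simp only [deg]; omega) hW)⟩

/-- The word RAM program writes the output of `p` with words of logarithmic length. -/
theorem outputsWithin_length {p : Cmd} {input out : List ℕ} {K B : ℕ}
    (hout : p.out (fun i => input.getD i 0) [] = out) (h2 : 2 ≤ out.length)
    (hmem : ∀ i, input.getD i 0 ≤ out.length) (hK : 2 ^ K ≤ out.length)
    (hp : p.Pows K (fun i => input.getD i 0) [])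
    (hcost : p.cost (fun i => input.getD i 0) [] ≤ B * out.length) :
    (p.compile [] 0).OutputsWithin (out.length ^ p.deg []) input out (B * out.length) := by
  have h := p.outputsWithin (W := out.length ^ p.deg []) (Nat.one_le_pow _ _ (by omega))
    (p.fits h2 hmem hK .nil hp le_rfl) hcost
  rwa [hout] at h

theorem cost_each_le {R k : ℕ} {mem : ℕ → ℕ} {e : Exp} {p : Cmd} {ρ : List ℕ}
    (hk : e.eval mem ρ = k) (h : ∀ i < k, p.cost mem (ρ ++ [i]) ≤ R) :
    (each e p).cost mem ρ ≤ e.cost mem ρ + k * (R + 4) + 2 := by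
  rw [cost, hk]
  have := Finset.sum_le_card_nsmul (Finset.range k) (fun i => p.cost mem (ρ ++ [i]) + 4) (R + 4)
    fun i hi => by
      have := h i (Finset.mem_range.1 hi)
      omega
  rw [Finset.card_range, smul_eq_mul] at this
  omega

end Cmd

end WordRAM


/-! ### Clauses and partial assignments -/

/-- The memory at the start. -/
def Formula3.memory {n : ℕ} (φ : Formula3 n) (i : ℕ) : ℕ := φ.encode.getD i 0

namespace Formula3

variable {n : ℕ} (φ : Formula3 n)

theorem memory_zero : φ.memory 0 = n := rfl

theorem memory_one : φ.memory 1 = φ.length := rfl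

theorem getD_flatMap_encode (φ : Formula3 n) {j k : ℕ} (hk : k < 3) :
    (φ.flatMap Clause3.encode).getD (3 * j + k) 0 =
      (φ[j]?).elim 0 fun c => (c.1[k]?).elim 0 Literal.code := by
  induction φ generalizing j with
  | nil => simp
  | cons c φ ih =>
    rw [List.flatMap_cons]
    have hlen : (Clause3.encode c).length = 3 := by simp [Clause3.encode]
    cases j with
    | zero =>
      rw [List.getD_append _ _ _ _ (by omega)]
      interval_cases k <;> simp [Clause3.encode, List.range_succ]
    | succ j =>
      rw [List.getD_append_right _ _ _ _ (by omega), hlen,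
        show 3 * (j + 1) + k - 3 = 3 * j + k by omega, ih]
      simp

theorem memory_add_two {j k : ℕ} (hk : k < 3) : φ.memory (2 + 3 * j + k) =
    (φ[j]?).elim 0 fun c => (c.1[k]?).elim 0 Literal.code := by
  rw [← getD_flatMap_encode φ hk, memory, encode, show 2 + 3 * j + k = 3 * j + k + 1 + 1 by omega,
    List.getD_cons_succ, List.getD_cons_succ]

theorem memory_le {s : ℕ} (hn : 2 * n ≤ s) (hm : φ.length ≤ s) (i : ℕ) : φ.memory i ≤ s := by
  obtain h | h | ⟨j, k, hk, rfl⟩ : i = 0 ∨ i = 1 ∨ ∃ j k, k < 3 ∧ i = 2 + 3 * j + k := by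
    by_cases h0 : i = 0
    · exact Or.inl h0
    by_cases h1 : i = 1
    · exact Or.inr (Or.inl h1)
    exact Or.inr (Or.inr ⟨(i - 2) / 3, (i - 2) % 3, Nat.mod_lt _ (by omega), by omega⟩)
  · rw [h, memory_zero]
    omega
  · rwa [h, memory_one]
  · rw [memory_add_two _ hk]
    cases φ[j]? with
    | none => exact Nat.zero_le _
    | some c =>
      rw [Option.elim_some]
      cases c.1[k]? with
      | none => exact Nat.zero_le _
      | some l =>
        rw [Option.elim_some, Literal.code]
        have := l.1.2
        split_ifs <;> omega

end Formula3

/-- The word `c` codes a literal over a variable of the group `i` of `g` variables, and the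
assignment to this group whose bits are those of `a` makes it true. -/
def LiteralHolds (g i a c : ℕ) : Prop :=
  c ≠ 0 ∧ (c - 1) / 2 / g = i ∧ a / 2 ^ ((c - 1) / 2 % g) % 2 = (c - 1) % 2

instance (g i a c : ℕ) : Decidable (LiteralHolds g i a c) :=
  inferInstanceAs (Decidable (_ ∧ _ ∧ _))

theorem not_literalHolds_zero (g i a : ℕ) : ¬ LiteralHolds g i a 0 := fun h => h.1 rfl

theorem literalHolds_code {n g i a : ℕ} (l : Literal n) : LiteralHolds g i a l.code ↔
    (l.1 : ℕ) / g = i ∧ a.testBit (l.1 % g) = l.2 := by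
  have h1 : l.code - 1 = 2 * l.1 + (if l.2 then 1 else 0) := by
    rw [Literal.code, Nat.add_sub_cancel]
  have h2 : (l.code - 1) / 2 = l.1 := by
    rw [h1]
    split_ifs <;> omega
  have h3 : (l.code - 1) % 2 = if l.2 then 1 else 0 := by
    rw [h1]
    split_ifs <;> omega
  have h4 := Nat.mod_two_eq_zero_or_one (a / 2 ^ ((l.1 : ℕ) % g))
  rw [LiteralHolds, h2, h3, Nat.testBit_eq_decide_div_mod_eq]
  refine (and_iff_right (Nat.succ_ne_zero _)).trans (and_congr_right fun _ => ?_)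
  cases l.2 <;> simp

/-- The assignment `a` to the group `i` satisfies the clause `j` in the memory. -/
def ClauseHolds (mem : ℕ → ℕ) (g i a j : ℕ) : Prop :=
  LiteralHolds g i a (mem (2 + 3 * j)) ∨ LiteralHolds g i a (mem (2 + 3 * j + 1)) ∨
    LiteralHolds g i a (mem (2 + 3 * j + 2))

instance (mem : ℕ → ℕ) (g i a j : ℕ) : Decidable (ClauseHolds mem g i a j) :=
  inferInstanceAs (Decidable (_ ∨ _ ∨ _))

namespace Formula3

variable {n : ℕ} (φ : Formula3 n)

theorem clauseHolds_iff {g i a j : ℕ} (hj : j < φ.length) : ClauseHolds φ.memory g i a j ↔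
    ∃ l ∈ (φ[j]).1, (l.1 : ℕ) / g = i ∧ a.testBit (l.1 % g) = l.2 := by
  have h1 : ∀ k < 3, LiteralHolds g i a (φ.memory (2 + 3 * j + k)) ↔
      ∃ l, (φ[j]).1[k]? = some l ∧ (l.1 : ℕ) / g = i ∧ a.testBit (l.1 % g) = l.2 := by
    intro k hk
    rw [memory_add_two _ hk, List.getElem?_eq_getElem hj, Option.elim_some]
    cases h : (φ[j]).1[k]? with
    | none =>
      rw [Option.elim_none]
      exact iff_of_false (not_literalHolds_zero g i a) (by simp)
    | some l =>
      rw [Option.elim_some, literalHolds_code]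
      simp
  have h2 : ClauseHolds φ.memory g i a j ↔
      ∃ k < 3, LiteralHolds g i a (φ.memory (2 + 3 * j + k)) := by
    constructor
    · rintro (h | h | h)
      · exact ⟨0, by omega, h⟩
      · exact ⟨1, by omega, h⟩
      · exact ⟨2, by omega, h⟩
    · rintro ⟨k, hk, h⟩
      interval_cases k
      · exact Or.inl h
      · exact Or.inr (Or.inl h)
      · exact Or.inr (Or.inr h)
  rw [h2]
  constructor
  · rintro ⟨k, hk, h⟩
    obtain ⟨l, hl, h⟩ := (h1 k hk).1 h
    exact ⟨l, List.mem_of_getElem? hl, h⟩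
  · rintro ⟨l, hl, h⟩
    obtain ⟨k, hk, hl⟩ := List.getElem_of_mem hl
    have := (φ[j]).2
    refine ⟨k, by omega, (h1 k (by omega)).2 ⟨l, ?_, h⟩⟩
    rw [List.getElem?_eq_getElem hk, hl]

/-- An assignment is the same as an assignment to each of the groups. -/
theorem satisfiable_iff {q g : ℕ} (hg : n < q * g) : φ.Satisfiable ↔
    ∃ a : ℕ → ℕ, (∀ i < q, a i < 2 ^ g) ∧
      ∀ j < φ.length, ∃ i < q, ClauseHolds φ.memory g i (a i) j := by
  have hg0 : 0 < g := Nat.pos_of_ne_zero fun h => by simp [h] at hg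
  constructor
  · rintro ⟨b, hb⟩
    refine ⟨fun i => Nat.ofBits fun t : Fin g =>
      if h : i * g + t < n then b ⟨i * g + t, h⟩ else false, fun i _ => Nat.ofBits_lt_two_pow _,
      fun j hj => ?_⟩
    obtain ⟨l, hl, h⟩ := hb φ[j] (List.getElem_mem hj)
    refine ⟨l.1 / g, ?_, (φ.clauseHolds_iff hj).2 ⟨l, hl, rfl, ?_⟩⟩
    · rw [Nat.div_lt_iff_lt_mul hg0]
      exact l.1.2.trans hg
    · rw [Nat.testBit_ofBits_lt _ _ (Nat.mod_lt _ hg0), ← h]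
      simp only [Nat.div_add_mod', Fin.is_lt, dif_pos]
  · rintro ⟨a, -, h⟩
    refine ⟨fun v => (a (v / g)).testBit (v % g), fun c hc => ?_⟩
    obtain ⟨j, hj, rfl⟩ := List.getElem_of_mem hc
    obtain ⟨i, -, hi⟩ := h j hj
    obtain ⟨l, hl, rfl, h⟩ := (φ.clauseHolds_iff hj).1 hi
    exact ⟨l, hl, h⟩

end Formula3

/-! ### The instance for a formula -/

namespace StripData

theorem card_terminals_le (S : StripData) :
    (S.grid.toInstance S.term S.budget).terminals.card ≤ (7 * S.m + 2) * (S.q + 1) := by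
  classical
  have h : (S.grid.toInstance S.term S.budget).terminals.image Fin.val ⊆
      (Finset.range (7 * S.m + 2) ×ˢ Finset.range (S.q + 1)).image
        fun p => S.grid.vid p.1 (p.2 * S.period) 0 := by
    intro v hv
    obtain ⟨v, hv', rfl⟩ := Finset.mem_image.1 hv
    obtain ⟨x, y, hx, hy, hterm, hxy⟩ := WeightedGrid.mem_terminals.1 hv'
    have hy0 : y % S.period = 0 := by
      obtain ⟨-, ⟨-, rfl | rfl⟩ | ⟨h, -⟩⟩ := hterm
      · exact Nat.zero_mod _
      · exact Nat.mul_mod_left _ _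
      · exact h
    refine Finset.mem_image.2 ⟨(x, y / S.period), ?_, ?_⟩
    · rw [Finset.mem_product, Finset.mem_range, Finset.mem_range]
      refine ⟨hx, ?_⟩
      rw [Nat.div_lt_iff_lt_mul S.period_pos]
      have := S.period_pos
      have : y < S.q * S.period + 1 := hy
      simp only [add_mul, one_mul]
      omega
    · rw [hxy]
      simp only
      rw [Nat.div_mul_cancel (Nat.dvd_of_mod_eq_zero hy0)]
  have := (Finset.card_le_card h).trans Finset.card_image_le
  rwa [Finset.card_image_of_injective _ Fin.val_injective, Finset.card_product,
    Finset.card_range, Finset.card_range] at this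

theorem card_terminals_eq_zero (S : StripData) (hm : S.m = 0) :
    (S.grid.toInstance S.term S.budget).terminals.card = 0 := by
  rw [Finset.card_eq_zero, Finset.eq_empty_iff_forall_notMem]
  intro v hv
  obtain ⟨x, y, -, -, h, -⟩ := WeightedGrid.mem_terminals.1 hv
  exact h.1 hm

theorem card_grid_le (S : StripData) (hq : S.q ≠ 0) :
    S.grid.card ≤ 2114 * S.q ^ 3 * (S.m + 1) ^ 3 * S.period ^ 2 := by
  have hq : 1 ≤ S.q := Nat.pos_of_ne_zero hq
  have hp := S.period_pos
  have h1 : 1 ≤ S.q * (S.m + 1) := Nat.mul_pos hq (Nat.succ_pos _)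
  have h2 : S.gapWeight + S.rowWeight + S.period + 2 ≤
      75 * (S.q * (S.m + 1)) ^ 2 * S.period := by
    unfold gapWeight rowWeight scale
    have : 8 * S.q * (S.m + 1) = 8 * (S.q * (S.m + 1)) := by ring
    rw [this]
    generalize S.q * (S.m + 1) = k at *
    have : k * S.period ≤ k * k * S.period := Nat.mul_le_mul_right _ (Nat.le_mul_self k)
    have : S.period ≤ k * S.period := Nat.le_mul_of_pos_left _ h1
    nlinarith
  have h3 : S.grid.N = S.gapWeight + S.rowWeight + S.period + 2 := rfl
  have h4 : 1 ≤ (S.q * (S.m + 1)) ^ 2 * S.period := Nat.mul_pos (Nat.pow_pos h1) hp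
  have h5 : 2 * S.grid.N + 1 ≤ 151 * ((S.q * (S.m + 1)) ^ 2 * S.period) := by
    rw [h3]
    linarith
  have h6 : S.grid.X ≤ 7 * (S.m + 1) := by
    change 7 * S.m + 2 ≤ _
    omega
  have h7 : S.grid.Y ≤ 2 * (S.q * S.period) := by
    have := Nat.mul_pos hq hp
    change S.q * S.period + 1 ≤ _
    omega
  calc S.grid.card ≤ 7 * (S.m + 1) * (2 * (S.q * S.period)) *
        (151 * ((S.q * (S.m + 1)) ^ 2 * S.period)) :=
        Nat.mul_le_mul (Nat.mul_le_mul h6 h7) h5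
    _ = _ := by ring

/-- The data of a formula whose variables are distributed over `q` groups. -/
def ofMemory (q : ℕ) (mem : ℕ → ℕ) : StripData where
  q := q
  M := 2 ^ (mem 0 / q + 1)
  m := mem 1
  sat i a j := decide (ClauseHolds mem (mem 0 / q + 1) i a j)

theorem hasTreeWithinBudget_ofMemory_iff {q n : ℕ} (hq : q ≠ 0) (φ : Formula3 n) :
    ((ofMemory q φ.memory).grid.toInstance (ofMemory q φ.memory).term
      (ofMemory q φ.memory).budget).HasTreeWithinBudget ↔ φ.Satisfiable := by
  rw [hasTreeWithinBudget_iff hq (by simp [ofMemory]), φ.satisfiable_iff (q := q) (g := n / q + 1)]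
  · simp only [ofMemory, decide_eq_true_eq]
    rfl
  · exact Nat.lt_mul_div_succ n (Nat.pos_of_ne_zero hq)

end StripData


theorem List.flatMap_range_singleton {α : Type*} (k : ℕ) (a : α) :
    (List.range k).flatMap (fun _ => [a]) = List.replicate k a := by
  induction k with
  | zero => rfl
  | succ k ih => rw [List.range_succ, List.flatMap_append, ih, List.replicate_succ']; rfl

namespace WordRAM.Exp

abbrev add (a b : Exp) : Exp := .op .add a b

abbrev sub (a b : Exp) : Exp := .op .sub a b

abbrev mul (a b : Exp) : Exp := .op .mul a b

abbrev div (a b : Exp) : Exp := .op .div a b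

def mod (a b : Exp) : Exp := sub a (mul (div a b) b)

def ifEq (a b t f : Exp) : Exp := ite (add (sub a b) (sub b a)) f t

def ifLt (a b t f : Exp) : Exp := ite (sub b a) t f

variable {mem : ℕ → ℕ} {ρ : List ℕ} {K : ℕ} {a b t f : Exp}

theorem eval_mod : (mod a b).eval mem ρ = a.eval mem ρ % b.eval mem ρ := by
  have := Nat.div_add_mod' (a.eval mem ρ) (b.eval mem ρ)
  simp only [mod, eval, Op.eval]
  omega

theorem eval_ifEq : (ifEq a b t f).eval mem ρ =
    if a.eval mem ρ = b.eval mem ρ then t.eval mem ρ else f.eval mem ρ := by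
  simp only [ifEq, eval, Op.eval]
  unfold select
  split_ifs <;> first | rfl | omega

theorem eval_ifLt : (ifLt a b t f).eval mem ρ =
    if a.eval mem ρ < b.eval mem ρ then t.eval mem ρ else f.eval mem ρ := by
  simp only [ifLt, eval, Op.eval]
  unfold select
  split_ifs <;> first | rfl | omega

theorem pows_mod : (mod a b).Pows K mem ρ ↔ a.Pows K mem ρ ∧ b.Pows K mem ρ := by
  simp only [mod, Pows]
  tauto

theorem pows_ifEq : (ifEq a b t f).Pows K mem ρ ↔
    (a.Pows K mem ρ ∧ b.Pows K mem ρ) ∧ t.Pows K mem ρ ∧ f.Pows K mem ρ := by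
  simp only [ifEq, Pows]
  tauto

theorem pows_ifLt : (ifLt a b t f).Pows K mem ρ ↔
    (a.Pows K mem ρ ∧ b.Pows K mem ρ) ∧ t.Pows K mem ρ ∧ f.Pows K mem ρ := by
  simp only [ifLt, Pows]
  tauto

theorem sumFree_mod : (mod a b).SumFree ↔ a.SumFree ∧ b.SumFree := by
  simp only [mod, SumFree]
  tauto

theorem sumFree_ifEq : (ifEq a b t f).SumFree ↔
    (a.SumFree ∧ b.SumFree) ∧ t.SumFree ∧ f.SumFree := by
  simp only [ifEq, SumFree]
  tauto

theorem sumFree_ifLt : (ifLt a b t f).SumFree ↔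
    (a.SumFree ∧ b.SumFree) ∧ t.SumFree ∧ f.SumFree := by
  simp only [ifLt, SumFree]
  tauto

/-- The truth value of `LiteralHolds`. -/
def literal (g i a c : Exp) : Exp :=
  ifEq c (const 0) (const 0) (ifEq (div (div (sub c (const 1)) (const 2)) g) i
    (ifEq (mod (div a (pow (mod (div (sub c (const 1)) (const 2)) g))) (const 2))
      (mod (sub c (const 1)) (const 2)) (const 1) (const 0)) (const 0))

/-- The truth value of `ClauseHolds`. -/
def clause (g i a j : Exp) : Exp :=
  ite (literal g i a (load (add (const 2) (mul (const 3) j)))) (const 1)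
    (ite (literal g i a (load (add (add (const 2) (mul (const 3) j)) (const 1)))) (const 1)
      (ite (literal g i a (load (add (add (const 2) (mul (const 3) j)) (const 2)))) (const 1)
        (const 0)))

variable {g i c j : Exp}

theorem eval_literal : (literal g i a c).eval mem ρ =
    if LiteralHolds (g.eval mem ρ) (i.eval mem ρ) (a.eval mem ρ) (c.eval mem ρ) then 1 else 0 := by
  simp only [literal, eval_ifEq, eval_mod, eval, Op.eval]
  by_cases h : LiteralHolds (g.eval mem ρ) (i.eval mem ρ) (a.eval mem ρ) (c.eval mem ρ)
  · rw [if_pos h, if_neg h.1, if_pos h.2.1, if_pos h.2.2]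
  · rw [if_neg h]
    split_ifs with h1 h2 h3
    · rfl
    · exact absurd ⟨h1, h2, h3⟩ h
    · rfl
    · rfl

theorem eval_clause : (clause g i a j).eval mem ρ =
    if ClauseHolds mem (g.eval mem ρ) (i.eval mem ρ) (a.eval mem ρ) (j.eval mem ρ) then 1
      else 0 := by
  have h0 : (literal g i a (load (add (const 2) (mul (const 3) j)))).eval mem ρ =
      if LiteralHolds (g.eval mem ρ) (i.eval mem ρ) (a.eval mem ρ) (mem (2 + 3 * j.eval mem ρ))
        then 1 else 0 := eval_literal
  have h1 : (literal g i a (load (add (add (const 2) (mul (const 3) j)) (const 1)))).eval mem ρ =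
      if LiteralHolds (g.eval mem ρ) (i.eval mem ρ) (a.eval mem ρ) (mem (2 + 3 * j.eval mem ρ + 1))
        then 1 else 0 := eval_literal
  have h2 : (literal g i a (load (add (add (const 2) (mul (const 3) j)) (const 2)))).eval mem ρ =
      if LiteralHolds (g.eval mem ρ) (i.eval mem ρ) (a.eval mem ρ) (mem (2 + 3 * j.eval mem ρ + 2))
        then 1 else 0 := eval_literal
  simp only [clause, eval, h0, h1, h2]
  by_cases h : ClauseHolds mem (g.eval mem ρ) (i.eval mem ρ) (a.eval mem ρ) (j.eval mem ρ)
  · rw [if_pos h]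
    rcases h with h | h | h <;> rw [if_pos h] <;> split_ifs <;> rfl
  · rw [if_neg h]
    rw [ClauseHolds, not_or, not_or] at h
    rw [if_neg h.1, if_neg h.2.1, if_neg h.2.2]
    rfl

theorem pows_literal (hg : g.Pows K mem ρ) (hi : i.Pows K mem ρ) (ha : a.Pows K mem ρ)
    (hc : c.Pows K mem ρ) (h0 : 0 < g.eval mem ρ) (hK : g.eval mem ρ ≤ K) :
    (literal g i a c).Pows K mem ρ := by
  have h := (Nat.mod_lt ((c.eval mem ρ - 1) / 2) h0).le.trans hK
  simp only [literal, pows_ifEq, pows_mod, Pows, eval_mod, eval, Op.eval]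
  tauto

theorem pows_clause (hg : g.Pows K mem ρ) (hi : i.Pows K mem ρ) (ha : a.Pows K mem ρ)
    (hj : j.Pows K mem ρ) (h0 : 0 < g.eval mem ρ) (hK : g.eval mem ρ ≤ K) :
    (clause g i a j).Pows K mem ρ := by
  have h : ∀ c : Exp, c.Pows K mem ρ → (literal g i a c).Pows K mem ρ := fun c hc =>
    pows_literal hg hi ha hc h0 hK
  simp only [clause, Pows]
  refine ⟨h _ ?_, trivial, h _ ?_, trivial, h _ ?_, trivial, trivial⟩ <;>
    simp only [Pows, hj, and_self]

theorem sumFree_clause (hg : g.SumFree) (hi : i.SumFree) (ha : a.SumFree) (hj : j.SumFree) :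
    (clause g i a j).SumFree := by
  simp only [clause, literal, sumFree_ifEq, sumFree_mod, SumFree, hg, hi, ha, hj, and_self]

end WordRAM.Exp

namespace StripData

open WordRAM Exp

/-! The variables of the program: `0` to `10` are the numbers of variables and clauses, the number
of variables in a group, `M`, the period, the weights of rows and gaps, the numbers `N`, `X`, `Y` of
the grid, and `2 * N + 1`. Then come the coordinates `y` and `x`, the strip of `y`, the distance of
`y` to the gap row below it, the weight of an edge, and an index on this edge. -/

/-- The weight of a vertical edge. -/
def verticalExp (q : ℕ) : Exp :=
  ifLt (var 11) (mul (const q) (var 4)) (ifEq (var 12) (const 0) (const 1)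
    (ifEq (mod (var 12) (const 7)) (const 1) (ifEq (var 14) (const 0) (const 0) (const 2))
    (ifEq (mod (var 12) (const 7)) (const 3) (ifEq (var 14) (const 0) (const 0) (const 2))
    (ifEq (mod (var 12) (const 7)) (const 5) (ifEq (add (var 14) (const 1)) (var 4) (const 0) (const 2))
    (ifEq (mod (var 12) (const 7)) (const 0) (ifEq (add (var 14) (const 1)) (var 4) (const 0) (const 2))
    (const 0)))))) (const 0)

/-- The weight of a horizontal edge. -/
def horizontalExp : Exp :=
  ifLt (var 12) (add (mul (const 7) (var 1)) (const 1))
    (ifEq (var 14) (const 0) (ifEq (mod (var 12) (const 7)) (const 0) (const 0) (var 6))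
    (ifEq (mod (var 14) (const 3)) (const 2)
      (ifEq (mod (var 12) (const 7)) (const 0)
        (add (var 5) (ifEq (var 12) (const 0) (var 14)
          (ifEq (var 12) (mul (const 7) (var 1)) (var 14) (const 0))))
        (ite (clause (var 2) (var 13) (div (var 14) (const 3)) (div (var 12) (const 7)))
          (add (var 5) (ifEq (mod (var 12) (const 7)) (const 1) (const 2) (const 0))) (const 0)))
      (ifEq (mod (var 12) (const 7)) (const 0) (const 0) (var 5)))) (const 0)

/-- The truth value of `term`. -/
def markExp (q : ℕ) : Exp :=
  ifEq (var 1) (const 0) (const 0) (ifEq (var 12) (const 0)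
    (ifEq (var 11) (const 0) (const 1) (ifEq (var 11) (mul (const q) (var 4)) (const 1) (const 0)))
    (ifEq (mod (var 11) (var 4)) (const 0)
      (ifEq (var 12) (add (mul (const 7) (var 1)) (const 1))
        (ifEq (var 11) (const 0) (const 0) (const 1))
      (ifEq (mod (var 12) (const 7)) (const 2) (ifEq (var 11) (const 0) (const 0) (const 1))
      (ifEq (mod (var 12) (const 7)) (const 4) (const 1)
      (ifEq (mod (var 12) (const 7)) (const 6)
        (ifEq (var 11) (mul (const q) (var 4)) (const 0) (const 1)) (const 0))))) (const 0)))

def vidExp (x y o : Exp) : Exp := add (mul (add (mul y (var 8)) x) (var 10)) o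

/-- A vertex on a subdivided edge. -/
def nodeExp (d : Bool) (t : Exp) : Exp :=
  ifEq t (const 0) (vidExp (var 12) (var 11) (const 0)) (ifEq t (var 15)
    (if d then vidExp (var 12) (add (var 11) (const 1)) (const 0)
      else vidExp (add (var 12) (const 1)) (var 11) (const 0))
    (vidExp (var 12) (var 11) (add (if d then var 7 else const 0) t)))

def budgetExp (q : ℕ) : Exp :=
  add (add (add (mul (var 6) (mul (var 1) (const (3 * q + 1))))
    (mul (var 5) (mul (const q) (add (mul (const 7) (var 1)) (const 1)))))
    (mul (const q) (var 4)))
    (mul (const q) (add (mul (mul (const 2) (var 4)) (add (var 1) (const 1)))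
      (mul (const 2) (var 1))))

/-- Write the marks of the vertices. -/
def flagsCmd (q : ℕ) : Cmd :=
  .each (var 9) (.each (var 8) (.seq (.emit (markExp q))
    (.each (mul (const 2) (var 7)) (.emit (const 0)))))

def chainCmd (d : Bool) : Cmd :=
  .each (var 15) (.seq (.emit (nodeExp d (var 16))) (.emit (nodeExp d (add (var 16) (const 1)))))

/-- Write the edges. -/
def edgesCmd (q : ℕ) : Cmd :=
  .each (var 9) (.each (var 8) (.bind (div (var 11) (var 4)) (.bind (mod (var 11) (var 4))
    (.seq (.bind horizontalExp (chainCmd false)) (.bind (verticalExp q) (chainCmd true))))))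

def bodyCmd (q : ℕ) : Cmd :=
  .seq (.emit (mul (mul (var 8) (var 9)) (var 10))) (.seq (.emit (budgetExp q))
    (.seq (.emit (const 0)) (.seq (flagsCmd q) (edgesCmd q))))

/-- The program that writes the instance. -/
def program (q : ℕ) : Cmd :=
  .bind (load (const 0)) (.bind (load (const 1)) (.bind (add (div (var 0) (const q)) (const 1))
    (.bind (pow (var 2)) (.bind (add (mul (const 3) (var 3)) (const 1))
    (.bind (mul (mul (const (8 * q)) (add (var 1) (const 1))) (var 4))
    (.bind (mul (mul (const (8 * q)) (add (var 1) (const 1))) (var 5))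
    (.bind (add (add (add (var 6) (var 5)) (var 4)) (const 2))
    (.bind (add (mul (const 7) (var 1)) (const 2))
    (.bind (add (mul (const q) (var 4)) (const 1))
    (.bind (add (mul (const 2) (var 7)) (const 1)) (bodyCmd q)))))))))))

variable (q : ℕ) (mem : ℕ → ℕ)

/-- The values of the variables that do not change. -/
def constants : List ℕ :=
  let S := ofMemory q mem
  [mem 0, S.m, mem 0 / q + 1, S.M, S.period, S.rowWeight, S.gapWeight, S.grid.N, S.grid.X, S.grid.Y,
    2 * S.grid.N + 1]

variable {q mem}

theorem eval_horizontalExp {x y : ℕ} {ρ : List ℕ} (hy : y < (ofMemory q mem).grid.Y) :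
    horizontalExp.eval mem (constants q mem ++ y :: x :: (y / (ofMemory q mem).period) ::
      (y % (ofMemory q mem).period) :: ρ) = (ofMemory q mem).w false x y := by
  have hy' : y < (ofMemory q mem).q * (ofMemory q mem).period + 1 := hy
  simp only [horizontalExp, eval_ifLt, eval_ifEq, eval_mod, eval_clause, eval, Op.eval, constants,
    List.cons_append, List.nil_append, List.getD_cons_succ, List.getD_cons_zero, w,
    Bool.false_eq_true, if_false, hy', and_true, horiz]
  have h1 : ∀ a b, select 1 a b = a := fun _ _ => rfl
  have h0 : ∀ a b, select 0 a b = b := fun _ _ => rfl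
  by_cases hc : ClauseHolds mem (mem 0 / q + 1) (y / (ofMemory q mem).period)
      (y % (ofMemory q mem).period / 3) (x / 7)
  · have hsat : (ofMemory q mem).sat (y / (ofMemory q mem).period)
        (y % (ofMemory q mem).period / 3) (x / 7) = true := decide_eq_true hc
    rw [if_pos hc, h1, hsat, if_pos rfl]
    split_ifs <;> first | rfl | omega
  · have hsat : (ofMemory q mem).sat (y / (ofMemory q mem).period)
        (y % (ofMemory q mem).period / 3) (x / 7) = false := decide_eq_false hc
    rw [if_neg hc, h0, hsat, if_neg Bool.false_ne_true]
    split_ifs <;> first | rfl | omega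

theorem eval_verticalExp {x y : ℕ} {ρ : List ℕ} (hx : x < (ofMemory q mem).grid.X) :
    (verticalExp q).eval mem (constants q mem ++ y :: x :: (y / (ofMemory q mem).period) ::
      (y % (ofMemory q mem).period) :: ρ) = (ofMemory q mem).w true x y := by
  have hx' : x < 7 * (ofMemory q mem).m + 2 := hx
  have hq : (ofMemory q mem).q = q := rfl
  simp only [verticalExp, eval_ifLt, eval_ifEq, eval_mod, eval, Op.eval, constants,
    List.cons_append, List.nil_append, List.getD_cons_succ, List.getD_cons_zero, w,
    if_true, hx', true_and, vert, hq]
  split_ifs <;> first | rfl | omega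

theorem eval_markExp {x y : ℕ} {ρ : List ℕ} :
    (ofMemory q mem).term x y ∧ (markExp q).eval mem (constants q mem ++ y :: x :: ρ) = 1 ∨
      ¬ (ofMemory q mem).term x y ∧ (markExp q).eval mem (constants q mem ++ y :: x :: ρ) = 0 := by
  have hq : (ofMemory q mem).q = q := rfl
  simp only [markExp, eval_ifEq, eval_mod, eval, Op.eval, constants,
    List.cons_append, List.nil_append, List.getD_cons_succ, List.getD_cons_zero, term, hq]
  generalize (ofMemory q mem).m = m
  generalize y % (ofMemory q mem).period = r
  generalize q * (ofMemory q mem).period = Q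
  split_ifs <;> omega

theorem eval_nodeExp {d : Bool} {x y t : ℕ} {e : Exp} {ρ ρ' : List ℕ}
    (hρ : ρ = constants q mem ++ y :: x :: (y / (ofMemory q mem).period) ::
      (y % (ofMemory q mem).period) :: (ofMemory q mem).w d x y :: ρ') (he : e.eval mem ρ = t) :
    (nodeExp d e).eval mem ρ = (ofMemory q mem).grid.node d x y t := by
  have hw : (ofMemory q mem).grid.w d x y = (ofMemory q mem).w d x y := rfl
  have h0 : (Exp.var 7).eval mem ρ = (ofMemory q mem).grid.N := by rw [hρ]; rfl
  simp only [nodeExp, eval_ifEq, WeightedGrid.node, WeightedGrid.place, WeightedGrid.off]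
  cases d
  all_goals
    simp only [Bool.false_eq_true, if_false, if_true, vidExp, eval, Op.eval, he, hw]
    simp only [hρ, constants, List.cons_append, List.nil_append, List.getD_cons_succ,
      List.getD_cons_zero]
    split_ifs <;> rfl

theorem out_chainCmd {d : Bool} {x y : ℕ} :
    (chainCmd d).out mem (constants q mem ++ [y, x, y / (ofMemory q mem).period,
      y % (ofMemory q mem).period, (ofMemory q mem).w d x y]) =
      (ofMemory q mem).grid.chain d x y := by
  simp only [chainCmd, Cmd.out]
  have h : (Exp.var 15).eval mem (constants q mem ++ [y, x, y / (ofMemory q mem).period,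
      y % (ofMemory q mem).period, (ofMemory q mem).w d x y]) = (ofMemory q mem).w d x y := rfl
  rw [h]
  refine List.flatMap_congr fun t _ => ?_
  rw [eval_nodeExp (q := q) (d := d) (x := x) (y := y) (ρ' := [t]) (t := t) (by simp) rfl,
    eval_nodeExp (q := q) (d := d) (x := x) (y := y) (ρ' := [t]) (t := t + 1) (by simp) rfl]
  rfl

theorem out_edgesCmd : (edgesCmd q).out mem (constants q mem) =
    (List.range (ofMemory q mem).grid.Y).flatMap fun y =>
      (List.range (ofMemory q mem).grid.X).flatMap fun x =>
        (ofMemory q mem).grid.chain false x y ++ (ofMemory q mem).grid.chain true x y := by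
  simp only [edgesCmd, Cmd.out]
  refine List.flatMap_congr fun y hy => List.flatMap_congr fun x hx => ?_
  have hy : y < (ofMemory q mem).grid.Y := List.mem_range.1 hy
  have hx : x < (ofMemory q mem).grid.X := List.mem_range.1 hx
  have h1 : (div (var 11) (var 4)).eval mem (constants q mem ++ [y] ++ [x]) =
    y / (ofMemory q mem).period := rfl
  have h2 : (mod (var 11) (var 4)).eval mem (constants q mem ++ [y] ++ [x] ++
      [y / (ofMemory q mem).period]) = y % (ofMemory q mem).period := by
    rw [eval_mod]
    rfl
  rw [h1, h2]
  simp only [List.append_assoc, List.cons_append, List.nil_append]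
  rw [eval_horizontalExp hy, eval_verticalExp hx, out_chainCmd, out_chainCmd]

theorem out_flagsCmd : (flagsCmd q).out mem (constants q mem) =
    (List.range (ofMemory q mem).grid.Y).flatMap fun y =>
      (List.range (ofMemory q mem).grid.X).flatMap fun x =>
        (markExp q).eval mem (constants q mem ++ [y, x]) ::
          List.replicate (2 * (ofMemory q mem).grid.N) 0 := by
  simp only [flagsCmd, Cmd.out]
  refine List.flatMap_congr fun y _ => List.flatMap_congr fun x _ => ?_
  rw [List.append_assoc]
  refine congrArg _ ?_
  have h : (mul (const 2) (var 7)).eval mem (constants q mem ++ ([y] ++ [x])) =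
    2 * (ofMemory q mem).grid.N := rfl
  rw [h]
  exact List.flatMap_range_singleton _ 0

theorem out_program : (program q).out mem [] = (ofMemory q mem).grid.written
    (fun x y => (markExp q).eval mem (constants q mem ++ [y, x])) (ofMemory q mem).budget := by
  have h : (program q).out mem [] = (bodyCmd q).out mem (constants q mem) := rfl
  rw [h, bodyCmd]
  simp only [Cmd.out]
  rw [out_flagsCmd, out_edgesCmd, WeightedGrid.written, Int.toNat_natCast, Int.toNat_neg_natCast]
  rfl

end StripData


namespace StripData

open WordRAM Exp

variable {q : ℕ} {mem : ℕ → ℕ}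

theorem pows_horizontalExp {K : ℕ} {ρ : List ℕ} (h : (Exp.var 2).eval mem ρ = K) (h0 : 0 < K) :
    horizontalExp.Pows K mem ρ := by
  have hc : (clause (var 2) (var 13) (div (var 14) (const 3)) (div (var 12) (const 7))).Pows K mem ρ :=
    pows_clause trivial trivial ⟨trivial, trivial⟩ ⟨trivial, trivial⟩ (by rwa [h]) h.le
  simp only [horizontalExp, pows_ifLt, pows_ifEq, pows_mod, Pows, hc, and_self]

theorem pows_verticalExp {K : ℕ} {ρ : List ℕ} : (verticalExp q).Pows K mem ρ := by
  simp only [verticalExp, pows_ifLt, pows_ifEq, pows_mod, Pows, and_self]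

theorem pows_markExp {K : ℕ} {ρ : List ℕ} : (markExp q).Pows K mem ρ := by
  simp only [markExp, pows_ifEq, pows_mod, Pows, and_self]

theorem pows_nodeExp {K : ℕ} {ρ : List ℕ} {d : Bool} {t : Exp} (ht : t.Pows K mem ρ) :
    (nodeExp d t).Pows K mem ρ := by
  cases d <;> simp only [nodeExp, vidExp, pows_ifEq, Pows, ht, and_self, if_true, if_false,
    Bool.false_eq_true]

theorem pows_chainCmd {K : ℕ} {ρ : List ℕ} {d : Bool} : (chainCmd d).Pows K mem ρ :=
  ⟨trivial, fun _ _ => ⟨pows_nodeExp trivial, pows_nodeExp ⟨trivial, trivial⟩⟩⟩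

theorem pows_program : (program q).Pows (mem 0 / q + 1) mem [] := by
  have hbody : (bodyCmd q).Pows (mem 0 / q + 1) mem (constants q mem) := by
    simp only [bodyCmd, flagsCmd, edgesCmd, budgetExp, Cmd.Pows, Exp.Pows, pows_mod, and_self,
      true_and, pows_verticalExp, pows_markExp, pows_chainCmd, and_true, implies_true]
    exact fun y _ x _ => pows_horizontalExp rfl (Nat.succ_pos _)
  refine ⟨?_, ?_, ?_, ⟨trivial, le_rfl⟩, ?_, ?_, ?_, ?_, ?_, ?_, ?_, hbody⟩ <;>
    simp only [Exp.Pows, and_self]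

theorem sumFree_horizontalExp : horizontalExp.SumFree := by
  have hc : (clause (var 2) (var 13) (div (var 14) (const 3)) (div (var 12) (const 7))).SumFree :=
    sumFree_clause trivial trivial ⟨trivial, trivial⟩ ⟨trivial, trivial⟩
  simp only [horizontalExp, sumFree_ifLt, sumFree_ifEq, sumFree_mod, SumFree, hc, and_self]

theorem sumFree_verticalExp : (verticalExp q).SumFree := by
  simp only [verticalExp, sumFree_ifLt, sumFree_ifEq, sumFree_mod, SumFree, and_self]

theorem sumFree_markExp : (markExp q).SumFree := by
  simp only [markExp, sumFree_ifEq, sumFree_mod, SumFree, and_self]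

theorem sumFree_nodeExp {d : Bool} {t : Exp} (ht : t.SumFree) : (nodeExp d t).SumFree := by
  cases d <;> simp only [nodeExp, vidExp, sumFree_ifEq, SumFree, ht, and_self, if_true, if_false,
    Bool.false_eq_true]

theorem cost_each_var_le {R k c : ℕ} {p : Cmd} {ρ : List ℕ} (hk : (Exp.var c).eval mem ρ = k)
    (h0 : 0 < k) (h : ∀ i < k, p.cost mem (ρ ++ [i]) ≤ R) :
    (Cmd.each (.var c) p).cost mem ρ ≤ k * (R + 8) := by
  have h1 := Cmd.cost_each_le hk h
  rw [Exp.cost] at h1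
  have h2 : k * (R + 8) = k * (R + 4) + k * 4 := by ring
  omega

/-- The number of steps that a program spends on all points of the grid. -/
theorem cost_each_each_le {R : ℕ} {p : Cmd}
    (h : ∀ y < (ofMemory q mem).grid.Y, ∀ x < (ofMemory q mem).grid.X,
      p.cost mem (constants q mem ++ [y] ++ [x]) ≤ R) :
    (Cmd.each (.var 9) (.each (.var 8) p)).cost mem (constants q mem) ≤
      (ofMemory q mem).grid.X * (ofMemory q mem).grid.Y * (R + 16) := by
  have hX := (ofMemory q mem).grid.X_pos
  refine (cost_each_var_le (R := (ofMemory q mem).grid.X * (R + 8)) (k := (ofMemory q mem).grid.Y)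
    rfl (ofMemory q mem).grid.Y_pos fun y hy => cost_each_var_le rfl hX fun x hx =>
      h y hy x hx).trans ?_
  have hXY : (ofMemory q mem).grid.X * (ofMemory q mem).grid.Y * (R + 16) =
    (ofMemory q mem).grid.Y * ((ofMemory q mem).grid.X * (R + 16)) := by ring
  rw [hXY]
  refine Nat.mul_le_mul_left _ ?_
  have : (ofMemory q mem).grid.X * (R + 16) =
    (ofMemory q mem).grid.X * (R + 8) + (ofMemory q mem).grid.X * 8 := by ring
  omega

theorem cost_flagsCmd_le : (flagsCmd q).cost mem (constants q mem) ≤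
    ((markExp q).size + 23) * (ofMemory q mem).grid.card := by
  refine (cost_each_each_le (q := q) (R := (markExp q).size + 12 * (ofMemory q mem).grid.N + 7)
    fun y _ x _ => ?_).trans ?_
  · have h1 := cost_le (K := 0) (mem := mem) (ρ := constants q mem ++ [y] ++ [x])
      (sumFree_markExp (q := q)) pows_markExp
    have h2 : (mul (const 2) (var 7)).eval mem (constants q mem ++ [y] ++ [x]) =
      2 * (ofMemory q mem).grid.N := rfl
    have h3 := Cmd.cost_each_le (p := .emit (const 0)) (R := 2) h2 fun _ _ => le_rfl
    have h4 : (mul (const 2) (var 7)).cost mem (constants q mem ++ [y] ++ [x]) = 4 := rfl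
    simp only [Cmd.cost] at h3 ⊢
    omega
  · rw [WeightedGrid.card, mul_comm _ ((ofMemory q mem).grid.X * (ofMemory q mem).grid.Y * _),
      mul_assoc ((ofMemory q mem).grid.X * (ofMemory q mem).grid.Y)]
    refine Nat.mul_le_mul_left _ ?_
    nlinarith [Nat.zero_le ((ofMemory q mem).grid.N * (markExp q).size)]

theorem lt_N : mem 0 / q + 1 < (ofMemory q mem).grid.N := by
  have h1 : mem 0 / q + 1 < 2 ^ (mem 0 / q + 1) := Nat.lt_two_pow_self
  have h2 : (ofMemory q mem).grid.N = (ofMemory q mem).gapWeight + (ofMemory q mem).rowWeight +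
    (3 * 2 ^ (mem 0 / q + 1) + 1) + 2 := rfl
  omega

theorem cost_chainCmd_le {d : Bool} {k : ℕ} {ρ : List ℕ} (hk : (Exp.var 15).eval mem ρ = k) :
    (chainCmd d).cost mem ρ ≤ k * ((nodeExp d (var 16)).size +
      (nodeExp d (add (var 16) (const 1))).size + 6) + 4 := by
  have h := Cmd.cost_each_le (mem := mem) (ρ := ρ) (R := (nodeExp d (var 16)).size +
      (nodeExp d (add (var 16) (const 1))).size + 2)
    (p := .seq (.emit (nodeExp d (var 16))) (.emit (nodeExp d (add (var 16) (const 1))))) hk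
    fun t _ => by
      have h1 := cost_le (K := 0) (mem := mem) (ρ := ρ ++ [t]) (e := nodeExp d (var 16))
        (sumFree_nodeExp trivial) (pows_nodeExp trivial)
      have h2 := cost_le (K := 0) (mem := mem) (ρ := ρ ++ [t])
        (e := nodeExp d (add (var 16) (const 1)))
        (sumFree_nodeExp ⟨trivial, trivial⟩) (pows_nodeExp ⟨trivial, trivial⟩)
      simp only [Cmd.cost]
      omega
  rw [Exp.cost] at h
  rw [chainCmd]
  simp only [add_assoc, Nat.reduceAdd] at h ⊢
  omega

/-- A bound for the cost of a grid point in `edgesCmd`, divided by the number `2 * N + 1`. -/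
def edgesCost (q : ℕ) : ℕ :=
  horizontalExp.size + (verticalExp q).size +
    ((nodeExp false (var 16)).size + (nodeExp false (add (var 16) (const 1))).size + 6) +
    ((nodeExp true (var 16)).size + (nodeExp true (add (var 16) (const 1))).size + 6) + 60

theorem cost_edgesCmd_le : (edgesCmd q).cost mem (constants q mem) ≤
    edgesCost q * (ofMemory q mem).grid.card := by
  have hN := lt_N (q := q) (mem := mem)
  refine (cost_each_each_le (q := q) (R := (edgesCost q - 16) * (2 * (ofMemory q mem).grid.N + 1))
    fun y hy x hx => ?_).trans ?_
  · have h1 : (div (var 11) (var 4)).eval mem (constants q mem ++ [y] ++ [x]) =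
      y / (ofMemory q mem).period := rfl
    have h2 : (mod (var 11) (var 4)).eval mem (constants q mem ++ [y] ++ [x] ++
        [y / (ofMemory q mem).period]) = y % (ofMemory q mem).period := by
      rw [eval_mod]
      rfl
    have e1 : (div (var 11) (var 4)).cost mem (constants q mem ++ [y] ++ [x]) = 5 := rfl
    have e2 : (mod (var 11) (var 4)).cost mem (constants q mem ++ [y] ++ [x] ++
        [y / (ofMemory q mem).period]) = 11 := rfl
    simp only [Cmd.cost]
    rw [h1, h2, e1, e2]
    have w1 : (ofMemory q mem).w false x y ≤ (ofMemory q mem).grid.N := (ofMemory q mem).w_le _ _ _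
    have w2 : (ofMemory q mem).w true x y ≤ (ofMemory q mem).grid.N := (ofMemory q mem).w_le _ _ _
    have c1 := cost_le (ρ := constants q mem ++ [y, x, y / (ofMemory q mem).period,
      y % (ofMemory q mem).period]) sumFree_horizontalExp
      (pows_horizontalExp (mem := mem) (K := mem 0 / q + 1) rfl (Nat.succ_pos _))
    have c2 := cost_le (K := 0) (mem := mem) (ρ := constants q mem ++ [y, x,
      y / (ofMemory q mem).period, y % (ofMemory q mem).period]) (sumFree_verticalExp (q := q))
      pows_verticalExp
    have c3 := cost_chainCmd_le (d := false) (mem := mem) (ρ := constants q mem ++ [y, x,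
      y / (ofMemory q mem).period, y % (ofMemory q mem).period, (ofMemory q mem).w false x y]) rfl
    have c4 := cost_chainCmd_le (d := true) (mem := mem) (ρ := constants q mem ++ [y, x,
      y / (ofMemory q mem).period, y % (ofMemory q mem).period, (ofMemory q mem).w true x y]) rfl
    simp only [List.append_assoc, List.cons_append, List.nil_append]
    rw [eval_horizontalExp hy, eval_verticalExp hx]
    replace c3 := c3.trans (Nat.add_le_add_right (Nat.mul_le_mul_right _ w1) 4)
    replace c4 := c4.trans (Nat.add_le_add_right (Nat.mul_le_mul_right _ w2) 4)
    replace c1 := c1.trans (Nat.mul_le_mul_left _ (show mem 0 / q + 1 + 1 ≤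
      (ofMemory q mem).grid.N by omega))
    refine (Nat.add_le_add_left (Nat.add_le_add_left (Nat.add_le_add (Nat.add_le_add c1 c3)
      (Nat.add_le_add c2 c4)) _) _).trans ?_
    have h3 : edgesCost q - 16 = horizontalExp.size + (verticalExp q).size +
      ((nodeExp false (var 16)).size + (nodeExp false (add (var 16) (const 1))).size + 6) +
      ((nodeExp true (var 16)).size + (nodeExp true (add (var 16) (const 1))).size + 6) + 44 := rfl
    rw [h3]
    generalize (nodeExp false (var 16)).size + (nodeExp false (add (var 16) (const 1))).size + 6 = a
    generalize (nodeExp true (var 16)).size + (nodeExp true (add (var 16) (const 1))).size + 6 = b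
    generalize horizontalExp.size = c
    generalize (verticalExp q).size = d
    generalize (ofMemory q mem).grid.N = N
    nlinarith [Nat.zero_le (c * N), Nat.zero_le (d * N), Nat.zero_le (a * N), Nat.zero_le (b * N)]
  · rw [WeightedGrid.card, mul_comm _ ((ofMemory q mem).grid.X * (ofMemory q mem).grid.Y * _),
      mul_assoc ((ofMemory q mem).grid.X * (ofMemory q mem).grid.Y)]
    refine Nat.mul_le_mul_left _ ?_
    have h3 : 16 ≤ edgesCost q := by unfold edgesCost; omega
    obtain ⟨e, he⟩ := Nat.exists_eq_add_of_le h3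
    rw [he, Nat.add_sub_cancel_left]
    nlinarith

theorem cost_program_le : (program q).cost mem [] ≤
    ((budgetExp q).size + (markExp q).size + edgesCost q + 200) * (ofMemory q mem).grid.card := by
  have h1 : (program q).cost mem [] = 2 + (2 + (6 + ((2 + 4 * (mem 0 / q + 1) + 4) + (6 + (9 + (9 +
    (10 + (6 + (6 + (6 + (bodyCmd q).cost mem (constants q mem))))))))))) := rfl
  have h2 : (budgetExp q).cost mem (constants q mem) ≤ (budgetExp q).size * (0 + 1) :=
    cost_le (by simp only [budgetExp, SumFree, and_self]) (by simp only [budgetExp, Pows, and_self])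
  have h3 : (bodyCmd q).cost mem (constants q mem) = 9 +
    (((budgetExp q).cost mem (constants q mem) + 1) + (2 + ((flagsCmd q).cost mem (constants q mem) +
      (edgesCmd q).cost mem (constants q mem)))) := rfl
  have h4 := cost_flagsCmd_le (q := q) (mem := mem)
  have h5 := cost_edgesCmd_le (q := q) (mem := mem)
  have h6 : (ofMemory q mem).grid.N < (ofMemory q mem).grid.card := by
    have : 1 * (2 * (ofMemory q mem).grid.N + 1) ≤ (ofMemory q mem).grid.card :=
      Nat.mul_le_mul_right _ (Nat.mul_pos (ofMemory q mem).grid.X_pos (ofMemory q mem).grid.Y_pos)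
    omega
  have h7 := lt_N (q := q) (mem := mem)
  generalize (ofMemory q mem).grid.card = V at *
  have h8 : (budgetExp q).size ≤ (budgetExp q).size * V := Nat.le_mul_of_pos_right _ (by omega)
  rw [h1, h3]
  simp only [add_mul] at *
  omega

/-- The program writes the instance of a formula. -/
theorem outputsWithin_program {n : ℕ} (hq : q ≠ 0) (φ : Formula3 n) :
    ∃ out : List ℕ, ((ofMemory q φ.memory).grid.toInstance (ofMemory q φ.memory).term
        (ofMemory q φ.memory).budget).IsEncoding out ∧
      ((program q).compile [] 0).OutputsWithin (out.length ^ (program q).deg []) φ.encode out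
        (((budgetExp q).size + (markExp q).size + edgesCost q + 200) * out.length) := by
  refine ⟨_, WeightedGrid.isEncoding_written fun x y _ _ => eval_markExp (ρ := []), ?_⟩
  have hlen := WeightedGrid.card_le_length_written (W := (ofMemory q φ.memory).grid)
    (fun x y => (markExp q).eval φ.memory (constants q φ.memory ++ [y, x]))
    (ofMemory q φ.memory).budget
  have hout := out_program (q := q) (mem := φ.memory)
  have hcost := cost_program_le (q := q) (mem := φ.memory)
  generalize hl : (ofMemory q φ.memory).grid.written
    (fun x y => (markExp q).eval φ.memory (constants q φ.memory ++ [y, x]))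
    (ofMemory q φ.memory).budget = out at *
  have hpos : 0 < 2 * (ofMemory q φ.memory).grid.N + 1 := Nat.succ_pos _
  have hX : (ofMemory q φ.memory).grid.X ≤ (ofMemory q φ.memory).grid.card := by
    rw [WeightedGrid.card, mul_assoc]
    exact Nat.le_mul_of_pos_right _ (Nat.mul_pos (ofMemory q φ.memory).grid.Y_pos hpos)
  have hY : (ofMemory q φ.memory).grid.Y ≤ (ofMemory q φ.memory).grid.card := by
    rw [WeightedGrid.card, mul_comm (ofMemory q φ.memory).grid.X, mul_assoc]
    exact Nat.le_mul_of_pos_right _ (Nat.mul_pos (ofMemory q φ.memory).grid.X_pos hpos)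
  have hm : (ofMemory q φ.memory).grid.X = 7 * φ.length + 2 := rfl
  have hn : (ofMemory q φ.memory).grid.Y = q * (3 * 2 ^ (n / q + 1) + 1) + 1 := rfl
  have hn1 : n < q * (n / q + 1) := Nat.lt_mul_div_succ n (Nat.pos_of_ne_zero hq)
  have hn2 : q * (n / q + 1) ≤ q * 2 ^ (n / q + 1) := Nat.mul_le_mul_left _ Nat.lt_two_pow_self.le
  have hn3 : 2 ^ (n / q + 1) ≤ q * 2 ^ (n / q + 1) :=
    Nat.le_mul_of_pos_left _ (Nat.pos_of_ne_zero hq)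
  have hn4 : q * (3 * 2 ^ (n / q + 1) + 1) = 3 * (q * 2 ^ (n / q + 1)) + q := by ring
  refine Cmd.outputsWithin_length hout (by omega) (φ.memory_le (by omega) (by omega))
    (K := n / q + 1) (by omega) pows_program (hcost.trans (Nat.mul_le_mul_left _ (by omega)))

end StripData


/-! ### Instances without edges and terminals -/

/-- `V` isolated vertices and no terminals. -/
def SteinerInstance.isolated (V : ℕ) (k : ℤ) : SteinerInstance where
  vertexCount := V
  graph := ⊥
  terminals := ∅
  budget := k

namespace SteinerInstance

variable {V : ℕ} {k : ℤ}

theorem notMem_edgeSet_isolated (e : Sym2 (Fin (isolated V k).vertexCount)) :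
    e ∉ (isolated V k).graph.edgeSet := by
  have h : (isolated V k).graph.edgeSet = ∅ := SimpleGraph.edgeSet_bot
  rw [h]
  exact Set.notMem_empty e

theorem isEncoding_isolated : (isolated V k).IsEncoding
    (V :: k.toNat :: (-k).toNat :: List.replicate V 0) := by
  refine ⟨[], List.nodup_nil, fun e => ?_, ?_⟩
  · exact iff_of_false (notMem_edgeSet_isolated e) List.not_mem_nil
  have h : (List.finRange V).map (isolated V k).flag = List.replicate V 0 := by
    rw [List.eq_replicate_iff]
    refine ⟨(List.length_map _).trans List.length_finRange, fun b hb => ?_⟩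
    obtain ⟨v, -, rfl⟩ := List.mem_map.1 hb
    exact if_neg (Finset.notMem_empty v)
  rw [← h]
  exact congrArg (V :: k.toNat :: (-k).toNat :: ·) (List.append_nil _).symm

theorem isPlanar_isolated : (isolated V k).graph.IsPlanar := by
  refine ⟨fun v => ((v : ℕ), 0), fun _ _ => 0, fun u v h => ?_,
    fun e he => absurd he (notMem_edgeSet_isolated e), fun e he => absurd he (notMem_edgeSet_isolated e),
    fun e he => absurd he (notMem_edgeSet_isolated e)⟩
  simpa [Fin.ext_iff] using h

theorem hasTreeWithinBudget_isolated (hV : 0 < V) :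
    (isolated V k).HasTreeWithinBudget ↔ 0 ≤ k := by
  constructor
  · rintro ⟨H, -, h⟩
    exact (Int.natCast_nonneg _).trans h
  · intro hk
    let v : Fin (isolated V k).vertexCount := ⟨0, hV⟩
    refine ⟨(isolated V k).graph.singletonSubgraph v, ⟨?_, fun v hv => ?_⟩, ?_⟩
    · have : Unique ((isolated V k).graph.singletonSubgraph v).verts :=
        inferInstanceAs (Unique ({v} : Set _))
      exact SimpleGraph.IsTree.of_subsingleton
    · exact absurd hv (Finset.notMem_empty v)
    · rw [SimpleGraph.edgeSet_singletonSubgraph, Set.ncard_empty]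
      exact hk

end SteinerInstance

namespace BruteForce

open WordRAM Exp

/-- `0` if some assignment satisfies all clauses, and `1` otherwise. -/
def unsatExp : Exp :=
  ite (sum (var 3) (ite (sum (var 1) (ite (clause (var 2) (const 0) (var 5) (var 6)) (const 0)
    (const 1))) (const 0) (const 1))) (const 0) (const 1)

def bodyCmd : Cmd :=
  .seq (.emit (var 4)) (.seq (.emit (const 0)) (.seq (.emit unsatExp)
    (.each (var 4) (.emit (const 0)))))

/-- The program that tries all assignments. The variables are the numbers of variables and clauses,
the number of variables plus one, the number of assignments, the number of vertices, an assignment,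
and a clause. -/
def program : Cmd :=
  .bind (load (const 0)) (.bind (load (const 1)) (.bind (add (var 0) (const 1))
    (.bind (pow (var 2)) (.bind (mul (var 3) (mul (var 2) (add (var 1) (const 1)))) bodyCmd))))

/-- The number of vertices. -/
def vertexCount (n m : ℕ) : ℕ := 2 ^ (n + 1) * ((n + 1) * (m + 1))

variable {n : ℕ} (φ : Formula3 n)

def constants : List ℕ := [n, φ.length, n + 1, 2 ^ (n + 1), vertexCount n φ.length]

theorem pows_clauseExp {a j : ℕ} : (clause (var 2) (const 0) (var 5) (var 6)).Pows (n + 1)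
    φ.memory (constants φ ++ [a] ++ [j]) :=
  pows_clause trivial trivial trivial trivial (Nat.succ_pos _) le_rfl

theorem eval_unsatExp [Decidable φ.Satisfiable] :
    unsatExp.eval φ.memory (constants φ) = if φ.Satisfiable then 0 else 1 := by
  have hsat := φ.satisfiable_iff (q := 1) (g := n + 1) (by omega)
  have h1 : ∀ c : ℕ, select c 0 1 = 0 ↔ c ≠ 0 := fun c => by
    unfold select
    split_ifs <;> simp_all
  have hclause : ∀ a j, (clause (var 2) (const 0) (var 5) (var 6)).eval φ.memory
      (constants φ ++ [a] ++ [j]) = 0 ↔ ¬ ClauseHolds φ.memory (n + 1) 0 a j := by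
    intro a j
    have h : (clause (var 2) (const 0) (var 5) (var 6)).eval φ.memory (constants φ ++ [a] ++ [j]) =
      if ClauseHolds φ.memory (n + 1) 0 a j then 1 else 0 := eval_clause
    rw [h]
    split_ifs <;> simp_all
  have hval : unsatExp.eval φ.memory (constants φ) = select (∑ a ∈ Finset.range (2 ^ (n + 1)),
      select (∑ j ∈ Finset.range φ.length, select ((clause (var 2) (const 0) (var 5)
        (var 6)).eval φ.memory (constants φ ++ [a] ++ [j])) 0 1) 0 1) 0 1 := rfl
  have hiff : unsatExp.eval φ.memory (constants φ) = 0 ↔ φ.Satisfiable := by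
    rw [hval, h1, ne_eq, Finset.sum_eq_zero_iff, hsat]
    simp only [h1, ne_eq, Finset.sum_eq_zero_iff, Finset.mem_range, hclause, not_not]
    constructor
    · intro h
      push Not at h
      obtain ⟨a, ha, h⟩ := h
      exact ⟨fun _ => a, fun _ _ => ha, fun j hj => ⟨0, Nat.one_pos, h j hj⟩⟩
    · rintro ⟨a, ha, h⟩ hn
      refine hn (a 0) (ha 0 Nat.one_pos) fun j hj => ?_
      obtain ⟨i, hi, h⟩ := h j hj
      obtain rfl : i = 0 := by omega
      exact h
  split_ifs with h
  · exact hiff.2 h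
  · have h2 := mt hiff.1 h
    rw [hval] at h2 ⊢
    unfold select at h2 ⊢
    split_ifs at * <;> simp_all

theorem cost_unsatExp_le : unsatExp.cost φ.memory (constants φ) ≤
    (2 * (clause (var 2) (const 0) (var 5) (var 6)).size + 50) * vertexCount n φ.length := by
  set s := (clause (var 2) (const 0) (var 5) (var 6)).size
  have h1 : ∀ a j, (clause (var 2) (const 0) (var 5) (var 6)).cost φ.memory
      (constants φ ++ [a] ++ [j]) ≤ s * (n + 2) := fun a j =>
    cost_le (sumFree_clause trivial trivial trivial trivial) (pows_clauseExp φ)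
  have hval : unsatExp.cost φ.memory (constants φ) = (2 + ∑ a ∈ Finset.range (2 ^ (n + 1)),
      (((2 + ∑ j ∈ Finset.range φ.length, (((clause (var 2) (const 0) (var 5) (var 6)).cost φ.memory
        (constants φ ++ [a] ++ [j]) + 3) + 5) + 5) + 3) + 5) + 5) + 3 := rfl
  have h2 : ∀ a, ∑ j ∈ Finset.range φ.length, (((clause (var 2) (const 0) (var 5)
      (var 6)).cost φ.memory (constants φ ++ [a] ++ [j]) + 3) + 5) ≤
      φ.length * (s * (n + 2) + 3 + 5) := by
    intro a
    refine (Finset.sum_le_card_nsmul _ _ (s * (n + 2) + 3 + 5) fun j _ => ?_).trans ?_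
    · have := h1 a j
      omega
    · rw [Finset.card_range, smul_eq_mul]
  have h3 := Finset.sum_le_card_nsmul (Finset.range (2 ^ (n + 1)))
    (fun a => ((2 + ∑ j ∈ Finset.range φ.length, (((clause (var 2) (const 0) (var 5)
      (var 6)).cost φ.memory (constants φ ++ [a] ++ [j]) + 3) + 5) + 5) + 3) + 5)
    (φ.length * (s * (n + 2) + 3 + 5) + 15) fun a _ => by
      have := h2 a
      omega
  rw [Finset.card_range, smul_eq_mul] at h3
  rw [hval]
  have h4 : φ.length * (s * (n + 2) + 3 + 5) + 15 + 10 ≤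
      (2 * s + 50) * ((n + 1) * (φ.length + 1)) := by
    nlinarith [Nat.zero_le (φ.length * n), Nat.zero_le (s * n), Nat.zero_le (φ.length * (s * n)),
      Nat.zero_le (φ.length * s)]
  have h5 : (2 * s + 50) * vertexCount n φ.length =
      2 ^ (n + 1) * ((2 * s + 50) * ((n + 1) * (φ.length + 1))) := by
    unfold vertexCount
    ring
  have h6 := Nat.mul_le_mul_left (2 ^ (n + 1)) h4
  have h7 : 1 ≤ 2 ^ (n + 1) := Nat.one_le_two_pow
  rw [mul_add] at h6
  rw [h5]
  omega

theorem two_pow_le_vertexCount (m : ℕ) : 2 ^ (n + 1) ≤ vertexCount n m :=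
  Nat.le_mul_of_pos_right _ (Nat.mul_pos (Nat.succ_pos _) (Nat.succ_pos _))

theorem mul_le_vertexCount (m : ℕ) : 2 * ((n + 1) * (m + 1)) ≤ vertexCount n m :=
  Nat.mul_le_mul_right _ (by rw [pow_succ]; have := Nat.one_le_two_pow (n := n); omega)

theorem pows_program : program.Pows (n + 1) φ.memory [] := by
  refine ⟨trivial, trivial, ⟨trivial, trivial⟩, ⟨trivial, le_rfl⟩,
    ⟨trivial, trivial, trivial, trivial⟩, trivial, trivial, ⟨⟨trivial, fun a _ =>
    ⟨⟨trivial, fun j _ => ⟨pows_clauseExp φ, trivial, trivial⟩⟩, trivial, trivial⟩⟩,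
    trivial, trivial⟩, trivial, fun _ _ => trivial⟩

theorem cost_program_le : program.cost φ.memory [] ≤
    (2 * (clause (var 2) (const 0) (var 5) (var 6)).size + 100) * vertexCount n φ.length := by
  have h1 : program.cost φ.memory [] = 2 + (2 + (4 + ((2 + 4 * (n + 1) + 4) + (10 +
    (3 + (2 + ((unsatExp.cost φ.memory (constants φ) + 1) +
      (Cmd.each (var 4) (.emit (const 0))).cost φ.memory (constants φ)))))))) := rfl
  have h2 := Cmd.cost_each_le (mem := φ.memory) (ρ := constants φ) (e := var 4)
    (p := .emit (const 0)) (k := vertexCount n φ.length) (R := 2) rfl fun _ _ => le_rfl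
  have h3 : (var 4).cost φ.memory (constants φ) = 2 := rfl
  have h4 := cost_unsatExp_le φ
  have h5 := mul_le_vertexCount (n := n) φ.length
  have h6 : n + 1 ≤ (n + 1) * (φ.length + 1) := Nat.le_mul_of_pos_right _ (Nat.succ_pos _)
  generalize vertexCount n φ.length = V at *
  simp only [add_mul] at *
  omega

theorem out_program [Decidable φ.Satisfiable] : program.out φ.memory [] =
    vertexCount n φ.length :: 0 :: (if φ.Satisfiable then 0 else 1) ::
      List.replicate (vertexCount n φ.length) 0 := by
  have h : program.out φ.memory [] = vertexCount n φ.length :: 0 ::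
    unsatExp.eval φ.memory (constants φ) ::
      (List.range (vertexCount n φ.length)).flatMap fun _ => [0] := rfl
  rw [h, eval_unsatExp, List.flatMap_range_singleton]

/-- The instance that has a solution if and only if the formula is satisfiable. -/
def inst [Decidable φ.Satisfiable] : SteinerInstance :=
  .isolated (vertexCount n φ.length) (if φ.Satisfiable then 0 else -1)

theorem hasTreeWithinBudget_inst [Decidable φ.Satisfiable] :
    (inst φ).HasTreeWithinBudget ↔ φ.Satisfiable := by
  have h := mul_le_vertexCount (n := n) φ.length
  have h' : 0 < (n + 1) * (φ.length + 1) := Nat.mul_pos (Nat.succ_pos _) (Nat.succ_pos _)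
  rw [inst, SteinerInstance.hasTreeWithinBudget_isolated (by omega)]
  split_ifs with h <;> simp [h]

theorem outputsWithin_program [Decidable φ.Satisfiable] :
    ∃ out : List ℕ, (inst φ).IsEncoding out ∧
      (program.compile [] 0).OutputsWithin (out.length ^ program.deg []) φ.encode out
        ((2 * (clause (var 2) (const 0) (var 5) (var 6)).size + 100) * out.length) := by
  have hout := out_program φ
  have hcost := cost_program_le φ
  have henc : (inst φ).IsEncoding (vertexCount n φ.length :: 0 ::
      (if φ.Satisfiable then 0 else 1) :: List.replicate (vertexCount n φ.length) 0) := by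
    have h := SteinerInstance.isEncoding_isolated (V := vertexCount n φ.length)
      (k := if φ.Satisfiable then 0 else -1)
    rw [inst]
    split_ifs with hs
    · rw [if_pos hs] at h
      exact h
    · rw [if_neg hs] at h
      exact h
  have hlen : (vertexCount n φ.length :: 0 :: (if φ.Satisfiable then 0 else 1) ::
      List.replicate (vertexCount n φ.length) 0).length = vertexCount n φ.length + 3 := by simp
  generalize (vertexCount n φ.length :: 0 :: (if φ.Satisfiable then 0 else 1) ::
      List.replicate (vertexCount n φ.length) 0) = out at *
  have h5 := mul_le_vertexCount (n := n) φ.length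
  have h6 : n + 1 ≤ (n + 1) * (φ.length + 1) := Nat.le_mul_of_pos_right _ (Nat.succ_pos _)
  have h7 : φ.length + 1 ≤ (n + 1) * (φ.length + 1) := Nat.le_mul_of_pos_left _ (Nat.succ_pos _)
  have h8 := two_pow_le_vertexCount (n := n) φ.length
  exact ⟨out, henc, Cmd.outputsWithin_length hout (by omega) (φ.memory_le (by omega) (by omega))
    (K := n + 1) (by omega) (pows_program φ) (hcost.trans (Nat.mul_le_mul_left _ (by omega)))⟩

end BruteForce


namespace BruteForce

theorem vertexCount_le {ε : ℝ} (hε : 1 ≤ ε) {n m : ℕ} (h : 1 ≤ n + m) :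
    (vertexCount n m : ℝ) ≤ 8 * ((2 : ℝ) ^ (ε * ((n : ℝ) + m)) * ((n : ℝ) + m) ^ 3) := by
  have h1 : (1 : ℝ) ≤ (n : ℝ) + m := by exact_mod_cast h
  have hn : (0 : ℝ) ≤ n := Nat.cast_nonneg n
  have hm : (0 : ℝ) ≤ m := Nat.cast_nonneg m
  have h2 : (2 : ℝ) ^ n ≤ (2 : ℝ) ^ (ε * ((n : ℝ) + m)) := by
    rw [← Real.rpow_natCast]
    exact Real.rpow_le_rpow_of_exponent_le (by norm_num) (by nlinarith)
  have h3 : ((n : ℝ) + 1) * (m + 1) ≤ 4 * ((n : ℝ) + m) ^ 3 := by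
    calc ((n : ℝ) + 1) * (m + 1) ≤ (2 * (n + m)) * (2 * (n + m)) := by
          gcongr <;> linarith
      _ = 4 * ((n : ℝ) + m) ^ 2 := by ring
      _ ≤ 4 * ((n : ℝ) + m) ^ 3 := by
          gcongr
          norm_num
  unfold vertexCount
  push_cast
  rw [pow_succ]
  calc (2 : ℝ) ^ n * 2 * (((n : ℝ) + 1) * (m + 1))
      ≤ (2 : ℝ) ^ (ε * ((n : ℝ) + m)) * 2 * (4 * ((n : ℝ) + m) ^ 3) := by gcongr
    _ = _ := by ring

end BruteForce

namespace StripData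

theorem card_grid_ofMemory_le {ε : ℝ} {q n m : ℕ} (hq : q ≠ 0) (hqε : 2 ≤ ε * q)
    (hε : 0 < ε) (h : 1 ≤ n + m) {mem : ℕ → ℕ} (hn : mem 0 = n) (hm : mem 1 = m) :
    ((ofMemory q mem).grid.card : ℝ) ≤ 1082368 * (q : ℝ) ^ 3 *
      ((2 : ℝ) ^ (ε * ((n : ℝ) + m)) * ((n : ℝ) + m) ^ 3) := by
  have h1 : (1 : ℝ) ≤ (n : ℝ) + m := by exact_mod_cast h
  have hm0 : (0 : ℝ) ≤ m := Nat.cast_nonneg m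
  have hn0 : (0 : ℝ) ≤ n := Nat.cast_nonneg n
  have h2 : ((ofMemory q mem).grid.card : ℝ) ≤
      2114 * (q : ℝ) ^ 3 * ((m : ℝ) + 1) ^ 3 * ((ofMemory q mem).period : ℝ) ^ 2 := by
    have := card_grid_le (ofMemory q mem) hq
    rw [← hm]
    exact_mod_cast this
  have h3 : ((ofMemory q mem).period : ℝ) ^ 2 ≤ 64 * (2 : ℝ) ^ (ε * ((n : ℝ) + m)) := by
    have h4 : (ofMemory q mem).period ≤ 8 * 2 ^ (n / q) := by
      have h5 : (ofMemory q mem).period = 3 * 2 ^ (n / q + 1) + 1 := by rw [← hn]; rfl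
      have := Nat.one_le_two_pow (n := n / q)
      rw [h5, pow_succ]
      omega
    have h5 : ((ofMemory q mem).period : ℝ) ≤ 8 * 2 ^ (n / q) := by exact_mod_cast h4
    have h6 : ((2 : ℝ) ^ (n / q)) ^ 2 ≤ (2 : ℝ) ^ (ε * ((n : ℝ) + m)) := by
      rw [← pow_mul, ← Real.rpow_natCast]
      refine Real.rpow_le_rpow_of_exponent_le (by norm_num) ?_
      have h7 : ((n / q : ℕ) : ℝ) * q ≤ n := by exact_mod_cast Nat.div_mul_le_self n q
      have h8 : (0 : ℝ) ≤ ((n / q : ℕ) : ℝ) := Nat.cast_nonneg _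
      push_cast
      nlinarith [mul_le_mul_of_nonneg_left hqε h8, mul_le_mul_of_nonneg_left h7 hε.le,
        mul_nonneg hε.le hm0]
    calc ((ofMemory q mem).period : ℝ) ^ 2 ≤ (8 * 2 ^ (n / q)) ^ 2 := by gcongr
      _ = 64 * ((2 : ℝ) ^ (n / q)) ^ 2 := by ring
      _ ≤ _ := by gcongr
  calc ((ofMemory q mem).grid.card : ℝ)
      ≤ 2114 * (q : ℝ) ^ 3 * (2 * ((n : ℝ) + m)) ^ 3 * (64 * (2 : ℝ) ^ (ε * ((n : ℝ) + m))) := by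
        refine h2.trans ?_
        gcongr
        linarith
    _ = _ := by ring

theorem card_terminals_ofMemory_le {ε : ℝ} {q n m : ℕ} (hq : q ≠ 0) (hqε : ε * q ≤ 3)
    (hε : 0 < ε) {mem : ℕ → ℕ} (hm : mem 1 = m) :
    (((ofMemory q mem).grid.toInstance (ofMemory q mem).term
      (ofMemory q mem).budget).terminals.card : ℝ) ≤ 54 * ε⁻¹ * ((n : ℝ) + m) := by
  have hn0 : (0 : ℝ) ≤ n := Nat.cast_nonneg n
  have hm0 : (0 : ℝ) ≤ m := Nat.cast_nonneg m
  have hm' : (ofMemory q mem).m = m := hm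
  rcases Nat.eq_zero_or_pos m with h | h
  · rw [card_terminals_eq_zero _ (hm'.trans h), Nat.cast_zero]
    positivity
  · have h1 : ((ofMemory q mem).grid.toInstance (ofMemory q mem).term
        (ofMemory q mem).budget).terminals.card ≤ 18 * (q * m) := by
      refine (card_terminals_le _).trans ?_
      rw [hm']
      calc (7 * m + 2) * (q + 1) ≤ (9 * m) * (2 * q) := Nat.mul_le_mul (by omega) (by omega)
        _ = 18 * (q * m) := by ring
    have h2 : (q : ℝ) ≤ 3 * ε⁻¹ := by
      rw [← div_eq_mul_inv, le_div_iff₀ hε, mul_comm]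
      exact hqε
    calc _ ≤ ((18 * (q * m) : ℕ) : ℝ) := Nat.cast_le.2 h1
      _ = 18 * (q * m) := by push_cast; ring
      _ ≤ 18 * ((3 * ε⁻¹) * (n + m)) := by
        gcongr
        linarith
      _ = _ := by ring

end StripData


/-- There are universal constants `c` and `C` such that for every `ε > 0` there is an algorithm (a
word RAM program `p`) that turns every 3SAT formula with `n` variables and `m` clauses into an
instance of Steiner Tree with unit weights as described. The constants `A`, `B` and `D`, hidden in
the size bound, in the linear running time and in the word length `O(log (output size))`, may depend
on `ε`. -/
theorem lemma6p3 :
    ∃ (c : ℕ) (C : ℝ), ∀ ε : ℝ, 0 < ε →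
      ∃ (p : WordRAM.Prog) (A : ℝ) (B D : ℕ), ∀ (n m : ℕ) (φ : Formula3 n), φ.length = m →
        ∃ (I : SteinerInstance) (out : List ℕ),
          I.IsEncoding out ∧
          p.OutputsWithin (out.length ^ D) φ.encode out (B * out.length) ∧
          I.graph.IsPlanar ∧
          (1 ≤ n + m →
            (I.vertexCount : ℝ) ≤ A * ((2 : ℝ) ^ (ε * ((n : ℝ) + m)) * ((n : ℝ) + m) ^ c)) ∧
          (I.terminals.card : ℝ) ≤ C * ε⁻¹ * ((n : ℝ) + m) ∧
          (φ.Satisfiable ↔ I.HasTreeWithinBudget) := by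
  refine ⟨3, 54, fun ε hε => ?_⟩
  classical
  rcases le_or_gt ε 1 with h1 | h1
  · obtain ⟨q, hq, hq2, hq3⟩ : ∃ q : ℕ, q ≠ 0 ∧ 2 ≤ ε * q ∧ ε * q ≤ 3 := by
      have h2 : 2 / ε ≤ (⌈2 / ε⌉₊ : ℝ) := Nat.le_ceil _
      have h3 : (⌈2 / ε⌉₊ : ℝ) < 2 / ε + 1 := Nat.ceil_lt_add_one (by positivity)
      rw [div_le_iff₀ hε, mul_comm] at h2
      have h4 : ε * (2 / ε + 1) = 2 + ε := by field_simp
      refine ⟨⌈2 / ε⌉₊, fun h => ?_, h2, ?_⟩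
      · rw [h, Nat.cast_zero, mul_zero] at h2
        norm_num at h2
      · nlinarith [mul_lt_mul_of_pos_left h3 hε]
    refine ⟨(StripData.program q).compile [] 0, 1082368 * (q : ℝ) ^ 3,
      (StripData.budgetExp q).size + (StripData.markExp q).size + StripData.edgesCost q + 200,
      (StripData.program q).deg [], fun n m φ hm => ?_⟩
    obtain ⟨out, henc, hout⟩ := StripData.outputsWithin_program hq φ
    exact ⟨_, out, henc, hout, WeightedGrid.subdivision_isPlanar _,
      fun h => StripData.card_grid_ofMemory_le hq hq2 hε h φ.memory_zero (φ.memory_one.trans hm),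
      StripData.card_terminals_ofMemory_le hq hq3 hε (φ.memory_one.trans hm),
      (StripData.hasTreeWithinBudget_ofMemory_iff hq φ).symm⟩
  · refine ⟨BruteForce.program.compile [] 0, 8,
      2 * (WordRAM.Exp.clause (.var 2) (.const 0) (.var 5) (.var 6)).size + 100,
      BruteForce.program.deg [], fun n m φ hm => ?_⟩
    obtain ⟨out, henc, hout⟩ := BruteForce.outputsWithin_program φ
    refine ⟨_, out, henc, hout, SteinerInstance.isPlanar_isolated, fun h => ?_, ?_,
      (BruteForce.hasTreeWithinBudget_inst φ).symm⟩
    · rw [← hm] at h ⊢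
      exact BruteForce.vertexCount_le h1.le h
    · change ((∅ : Finset (Fin _)).card : ℝ) ≤ _
      rw [Finset.card_empty, Nat.cast_zero]
      positivity
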